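/- Let $p$ be a prime, $F$ a (non-archimedean) local field with finite residue field $k$ of characteristic $p$ and normalised valuation $v$, $K=F(\sqrt[p-1]{F^\times})$ the extension obtained by adjoining all $(p-1)$-th roots of elements of $F$, and $G=\mathrm{Gal}(K|F)$. Let $\mathfrak o$ be the ring of integers of $K$, $\mathfrak p$ its maximal ideal, $l=\mathfrak o/\mathfrak p$, and $U_n=1+\mathfrak p^n$ for $n>0$. Every character $\chi:G\to\mathbf F_p^\times$ is of the form $\chi(\sigma)=\sigma(y)/y$ with $y^{p-1}=a\in F^\times$ ($\mathbf F_p^\times$ being identified with the group of $(p-1)$-th roots of $1$ in $F$), the class $\bar v(\chi)\in\mathbf Z/(p-1)\mathbf Z$ of $v(a)$ depends only on $\chi$, and every element of $\mathbf Z/(p-1)\mathbf Z$ is of this form. For a module $M$ with an action of $G$, $M\{\chi\}$ denotes $M$ with the action $\sigma\star x=\chi(\sigma)\sigma(x)$. For $i\in\mathbf Z$ let $l[i]$ be the $k[G]$-module $l\{\xi\}$, where $\xi$ is any character with $\bar v(\xi)\equiv i\pmod{p-1}$. Let $\omega:G\to\mathbf F_p^\times$ be the character giving the action on the $p$-th roots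 of $1$ if $F$ has characteristic $0$, and $\omega=1$ if $F$ has characteristic $p$. For $i\ge 1$ let $V_i=\bigoplus_{j=1}^{p-1} l[-((i-1)p+j)]\{\omega\}$, filtered by giving the summand $l[-b]\{\omega\}$ the level $b$ (the $m$-th term of the filtration is the sum of the summands of level $\le m$). Then: (1) For every $i\in\mathbf Z$ and every character $\chi:G\to\mathbf F_p^\times$, the $\chi$-eigenspace of $l[i]$ is a $k$-line if $\bar v(\chi)\equiv i\pmod{p-1}$, and is $0$ otherwise. (2) Each $V_i$ is a free $k[G]$-module of rank $1$. (3) Suppose that $F$ has characteristic $0$, and let $e=v(p)$. Let $\bar U_n\subset K^\times/K^{\times p}$ be the image of $U_n$ for $n>0$, and $\bar U_n=K^\times/K^{\times p}$ for $n\le 0$. For $0<i<pe$ prime to $p$, the quotient $\bar U_i/\bar U_{i+1}$, with the $k$-structure coming from $U_i/U_{i+1}=\mathfrak p^i/\mathfrak p^{i+1}$ (so that $\bar a\cdot\overline{1+x}=\overline{1+ax}$), is isomorphic as a $k[G]$-module to $l[i]$. Moreover $K^\times/K^{\times p}$, with the increasing filtration $\mathcal F_m=\bar U_{pe-m}$ $(m\in\mathbf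 Z)$, is isomorphic as a filtered $\mathbf F_p[G]$-module to $$\mathbf F_p\{\omega\}\oplus V_1\oplus\cdots\oplus V_e\oplus\mathbf F_p,$$ where $\mathbf F_p\{\omega\}$ has level $0$ and the last summand, with trivial action, has level $pe$. (4) Suppose that $F$ has characteristic $p$, and let $\wp(x)=x^p-x$. Let $\overline{\mathfrak p^n}$ be the image of $\mathfrak p^n$ in $K/\wp(K)$ $(n\in\mathbf Z)$. For $i<0$ prime to $p$, the quotient $\overline{\mathfrak p^i}/\overline{\mathfrak p^{i+1}}$, with the $k$-structure coming from $\mathfrak p^i/\mathfrak p^{i+1}$, is isomorphic as a $k[G]$-module to $l[i]$. Moreover $K/\wp(K)$, with the increasing filtration $\mathcal F_m=\overline{\mathfrak p^{-m}}$ $(m\in\mathbf Z)$, is isomorphic as a filtered $\mathbf F_p[G]$-module to $$\mathbf F_p\oplus V_1\oplus V_2\oplus\cdots,$$ where $\mathbf F_p$, with trivial action, has level $0$. -/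

import Mathlib

open ValuativeRel WithZero
open scoped DirectSum

namespace FilteredGalois

noncomputable section

/-- The normalised valuation `v_K` of a local field `K`, written multiplicatively, with value group
`exp ℤ`: `normVal K x = exp (-n)` means that `v_K(x) = n`. -/
def normVal (K : Type*) [Field K] [ValuativeRel K] [TopologicalSpace K]
    [IsNonarchimedeanLocalField K] : Valuation K ℤᵐ⁰ :=
  (valuation K).map
    (IsNonarchimedeanLocalField.valueGroupWithZeroIsoInt K).toMulEquiv.toMonoidWithZeroHom
    (OrderHomClass.mono (IsNonarchimedeanLocalField.valueGroupWithZeroIsoInt K))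

section
variable (K : Type*) [Field K] [ValuativeRel K] [TopologicalSpace K] [IsNonarchimedeanLocalField K]

theorem normVal_apply (x : K) : normVal K x =
    IsNonarchimedeanLocalField.valueGroupWithZeroIsoInt K (valuation K x) := rfl

theorem normVal_surjective : Function.Surjective (normVal K) := fun y => by
  obtain ⟨x, hx⟩ := ValuativeRel.valuation_surjective
    ((IsNonarchimedeanLocalField.valueGroupWithZeroIsoInt K).symm y)
  exact ⟨x, by simp [normVal_apply, hx]⟩

theorem normVal_le_one_iff (x : K) : normVal K x ≤ 1 ↔ valuation K x ≤ 1 := by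
  rw [normVal_apply, ← map_one (IsNonarchimedeanLocalField.valueGroupWithZeroIsoInt K), map_le_map_iff]

theorem normVal_lt_one_iff (x : K) : normVal K x < 1 ↔ valuation K x < 1 := by
  rw [normVal_apply, ← map_one (IsNonarchimedeanLocalField.valueGroupWithZeroIsoInt K), map_lt_map_iff]

variable {K}

open Polynomial in
theorem exists_pow_eq_of_normVal_lt {x : K} (hx : normVal K x < 1) (t : ℕ) :
    ∃ y : K, y ^ (1 + Nat.card 𝓀[K] * t) = 1 + x := by
  let := IsTopologicalAddGroup.rightUniformSpace K
  have := isUniformAddGroup_of_addCommGroup (G := K)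
  have hx' : valuation K x < 1 := (normVal_lt_one_iff K x).1 hx
  let x₀ : 𝒪[K] := ⟨x, hx'.le⟩
  have hx₀ : x₀ ∈ 𝓂[K] := by
    rw [IsLocalRing.mem_maximalIdeal, mem_nonunits_iff]
    intro h
    have := (Valuation.integer.integers (valuation K)).isUnit_iff_valuation_eq_one.1 h
    exact hx'.ne this
  set n := 1 + Nat.card 𝓀[K] * t with hn
  have hn0 : n ≠ 0 := by omega
  have hcast : (n : 𝓀[K]) = 1 := by
    have : Fintype 𝓀[K] := Fintype.ofFinite _
    have : ((Nat.card 𝓀[K] : ℕ) : 𝓀[K]) = 0 := by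
      rw [Nat.card_eq_fintype_card]; exact Nat.cast_card_eq_zero 𝓀[K]
    simp [hn]
  have hder : IsUnit (Ideal.Quotient.mk 𝓂[K]
      (eval 1 (derivative (X ^ n - C (1 + x₀) : 𝒪[K][X])))) := by
    have h1 : eval 1 (derivative (X ^ n - C (1 + x₀) : 𝒪[K][X])) = (n : 𝒪[K]) := by
      simp [derivative_X_pow]
    have h2 : Ideal.Quotient.mk 𝓂[K] (n : 𝒪[K]) = 1 := by
      rw [map_natCast]; exact hcast
    rw [h1, h2]
    exact isUnit_one
  have h := HenselianRing.is_henselian (I := 𝓂[K]) (X ^ n - C (1 + x₀) : 𝒪[K][X])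
    (monic_X_pow_sub_C _ hn0) 1 (by simpa using hx₀) hder
  obtain ⟨a, ha, -⟩ := h
  refine ⟨a, ?_⟩
  have : a ^ n = 1 + x₀ := by
    simpa [IsRoot, sub_eq_zero] using ha
  simpa using congrArg (Subtype.val) this

theorem normVal_ringEquiv_le_one (σ : K ≃+* K) {x : K} (hx : normVal K x ≤ 1) :
    normVal K (σ x) ≤ 1 := by
  have key : ∀ x : K, normVal K x < 1 → normVal K (σ x) ≤ 1 := by
    intro x hx
    have h1 : normVal K (σ (1 + x)) ≤ 1 := by
      set c := Nat.card 𝓀[K] with hc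
      have hcpos : 0 < c := Nat.card_pos
      have h0 : normVal K (σ (1 + x)) ≠ 0 := by
        simp only [ne_eq, map_eq_zero]
        intro h
        have : normVal K (1 + x) = 1 := Valuation.map_one_add_of_lt _ hx
        simp [h] at this
      by_contra! hlt
      set m := log (normVal K (σ (1 + x))) with hm
      have hmpos : 0 < m := by
        rw [hm]; rw [← log_one (M := ℤ)]; exact (log_lt_log one_ne_zero h0).2 hlt
      obtain ⟨y, hy⟩ := exists_pow_eq_of_normVal_lt hx m.toNat
      have : m = (1 + c * m.toNat : ℕ) * log (normVal K (σ y)) := by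
        conv_lhs => rw [hm, ← hy, map_pow, map_pow, log_pow, nsmul_eq_mul, ← hc]
      have hdvd : ((1 + c * m.toNat : ℕ) : ℤ) ∣ m := ⟨_, this⟩
      have := Int.le_of_dvd hmpos hdvd
      push_cast at this
      rw [Int.toNat_of_nonneg hmpos.le] at this
      have hc' : (1 : ℤ) ≤ c := by exact_mod_cast hcpos
      nlinarith
    have : σ x = σ (1 + x) - 1 := by simp
    rw [this]
    exact (Valuation.map_sub _ _ _).trans (max_le h1 (by rw [map_one]))
  by_contra! hlt
  obtain ⟨π, hπ⟩ := normVal_surjective K (exp (-1))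
  have hπ0 : π ≠ 0 := by
    rintro rfl; rw [map_zero] at hπ; exact exp_ne_zero hπ.symm
  have hσπ : normVal K (σ π) ≠ 0 := by simp [hπ0]
  have hσx : normVal K (σ x) ≠ 0 := by intro h; simp [h] at hlt
  set b := log (normVal K (σ x)) with hb
  set a := log (normVal K (σ π)) with ha
  have hbpos : 0 < b := by
    rw [hb]; rw [← log_one (M := ℤ)]; exact (log_lt_log one_ne_zero hσx).2 hlt
  have h2 := key (π * x ^ (a.natAbs + 1)) (by
    rw [map_mul, map_pow, hπ]
    calc exp (-1 : ℤ) * normVal K x ^ (a.natAbs + 1) ≤ exp (-1 : ℤ) * 1 := by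
          gcongr; exact pow_le_one' hx _
      _ < 1 := by rw [mul_one, ← exp_zero, exp_lt_exp]; norm_num)
  rw [map_mul, map_mul, map_pow, map_pow] at h2
  have h3 : log (normVal K (σ π) * normVal K (σ x) ^ (a.natAbs + 1)) ≤ log (1 : ℤᵐ⁰) :=
    (log_le_log (mul_ne_zero hσπ (pow_ne_zero _ hσx)) one_ne_zero).2 h2
  rw [log_mul hσπ (pow_ne_zero _ hσx), log_pow, log_one, ← ha, ← hb] at h3
  simp only [nsmul_eq_mul, Nat.cast_add, Int.natCast_natAbs, Nat.cast_one] at h3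
  have := neg_abs_le a
  nlinarith [abs_nonneg a]

/-- Every field automorphism of a local field preserves the normalised valuation. -/
theorem normVal_ringEquiv (σ : K ≃+* K) (x : K) : normVal K (σ x) = normVal K x := by
  have hle : ∀ x : K, normVal K (σ x) ≤ 1 ↔ normVal K x ≤ 1 := fun x =>
    ⟨fun h => by simpa using normVal_ringEquiv_le_one σ.symm h, normVal_ringEquiv_le_one σ⟩
  have hone : ∀ x : K, x ≠ 0 → normVal K x = 1 → normVal K (σ x) = 1 := by
    intro x h0 hx
    refine le_antisymm ((hle x).2 hx.le) ?_
    have := (hle x⁻¹).2 (by simp [hx])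
    rw [map_inv₀, map_inv₀] at this
    exact (inv_le_one₀ (by simp [zero_lt_iff, h0])).1 this
  obtain ⟨π, hπ⟩ := normVal_surjective K (exp (-1))
  have hπ0 : π ≠ 0 := by
    rintro rfl; rw [map_zero] at hπ; exact exp_ne_zero hπ.symm
  have hpow : ∀ x : K, x ≠ 0 → normVal K (σ x) = normVal K (σ π) ^ (-log (normVal K x)) := by
    intro x h0
    have h1 : normVal K (x * π ^ (log (normVal K x))) = 1 := by
      rw [map_mul, map_zpow₀, hπ, ← exp_zsmul]
      nth_rw 1 [← exp_log (x := normVal K x) (by simp [h0])]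
      rw [← exp_add]; simp
    have h2 := hone _ (mul_ne_zero h0 (zpow_ne_zero _ hπ0)) h1
    rw [map_mul, map_mul, map_zpow₀, map_zpow₀] at h2
    rw [zpow_neg]
    exact eq_inv_of_mul_eq_one_left h2
  have hσπ : normVal K (σ π) ≠ 0 := by simp [hπ0]
  have hneg : log (normVal K (σ π)) ≤ 0 := by
    rw [← log_one (M := ℤ)]
    refine (log_le_log hσπ one_ne_zero).2 ((hle π).2 ?_)
    rw [hπ, ← exp_zero, exp_le_exp]; norm_num
  have hval : log (normVal K (σ π)) = -1 := by
    have h := hpow (σ.symm π) (by simpa using hπ0)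
    rw [σ.apply_symm_apply, hπ] at h
    have h' := congrArg log h
    rw [log_exp, log_zpow] at h'
    have hd : log (normVal K (σ π)) ∣ 1 := by
      refine ⟨log (normVal K (σ.symm π)), ?_⟩
      simp only [smul_eq_mul] at h'
      linarith
    rcases Int.isUnit_iff.1 (isUnit_of_dvd_one hd) with h | h
    · omega
    · exact h
  by_cases h0 : x = 0
  · simp [h0]
  · rw [hpow x h0, ← exp_log hσπ, hval, ← exp_zsmul]
    simp only [smul_eq_mul, mul_neg, mul_one, neg_neg]
    exact exp_log (by simp [h0])
end

/-! ### Local fields: ideals, units, residue fields -/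

section
variable (K : Type*) [Field K] [ValuativeRel K] [TopologicalSpace K] [IsNonarchimedeanLocalField K]

/-- The fractional ideal `𝔭ⁿ` of `K` (`n ∈ ℤ`), where `𝔭` is the maximal ideal of `𝒪[K]`. -/
def primePow (n : ℤ) : AddSubgroup K where
  carrier := {x | normVal K x ≤ exp (-n)}
  add_mem' {x y} hx hy := by
    rw [Set.mem_ofPred_eq] at *
    exact (Valuation.map_add _ _ _).trans (max_le hx hy)
  zero_mem' := by simp
  neg_mem' {x} hx := by simpa using hx

theorem mem_primePow {n : ℤ} {x : K} : x ∈ primePow K n ↔ normVal K x ≤ exp (-n) := by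
  rw [primePow]
  exact Set.mem_ofPred_eq ▸ Iff.rfl

/-- The unit group `U_n`: the units `u` of `𝒪[K]` with `u - 1 ∈ 𝔭ⁿ`; for `n > 0` this is
`1 + 𝔭ⁿ`. -/
def unitGroup (n : ℤ) : Subgroup Kˣ where
  carrier := {u | normVal K (u : K) = 1 ∧ (u : K) - 1 ∈ primePow K n}
  mul_mem' {u w} hu hw := by
    refine ⟨by rw [Units.val_mul, map_mul, hu.1, hw.1, one_mul], ?_⟩
    have h : ((u * w : Kˣ) : K) - 1 = u * (w - 1) + (u - 1) := by push_cast; ring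
    rw [h]
    refine add_mem ?_ hu.2
    rw [mem_primePow, map_mul, hu.1, one_mul]
    exact (mem_primePow K).1 hw.2
  one_mem' := by simp [primePow]
  inv_mem' {u} hu := by
    have hu1 : normVal K ((u⁻¹ : Kˣ) : K) = 1 := by rw [Units.val_inv_eq_inv_val, map_inv₀, hu.1, inv_one]
    refine ⟨hu1, ?_⟩
    have h : ((u⁻¹ : Kˣ) : K) - 1 = -(((u⁻¹ : Kˣ) : K) * (u - 1)) := by
      rw [mul_sub, Units.inv_mul]; ring
    rw [h]
    refine neg_mem ?_
    rw [mem_primePow, map_mul, hu1, one_mul]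
    exact (mem_primePow K).1 hu.2

variable {K}

theorem ringEquiv_mem_primePow (σ : K ≃+* K) {n : ℤ} {x : K} (hx : x ∈ primePow K n) :
    σ x ∈ primePow K n := by
  rw [mem_primePow, normVal_ringEquiv]; exact (mem_primePow K).1 hx

theorem ringEquiv_mem_unitGroup (σ : K ≃+* K) {n : ℤ} {u : Kˣ} (hu : u ∈ unitGroup K n) :
    Units.map (σ : K →* K) u ∈ unitGroup K n := by
  refine ⟨?_, ?_⟩
  · change normVal K (σ u) = 1
    rw [normVal_ringEquiv]; exact hu.1
  · have := ringEquiv_mem_primePow σ hu.2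
    rwa [map_sub, map_one] at this

/-- The automorphism of the ring of integers induced by a field automorphism. -/
def integerEquiv (σ : K ≃+* K) : 𝒪[K] ≃+* 𝒪[K] where
  toFun x := ⟨σ x, (normVal_le_one_iff K _).1
    (by rw [normVal_ringEquiv]; exact (normVal_le_one_iff K _).2 x.2)⟩
  invFun x := ⟨σ.symm x, (normVal_le_one_iff K _).1
    (by rw [normVal_ringEquiv]; exact (normVal_le_one_iff K _).2 x.2)⟩
  left_inv x := by simp
  right_inv x := by simp
  map_mul' x y := by ext; simp
  map_add' x y := by ext; simp

end

instance (F K : Type*) [Field F] [ValuativeRel F] [Field K] [ValuativeRel K] [Algebra F K]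
    [ValuativeExtension F K] : (valuation F).HasExtension (valuation K) where
  val_isEquiv_comap := by
    have := ValuativeExtension.compatible_comap F (valuation K)
    exact ValuativeRel.isEquiv _ _

/-! ### Representations: twists, eigenspaces, graded pieces, filtered isomorphisms -/

section
variable (p : ℕ) [Fact p.Prime]

/-- The twist `M{ξ}` of a representation `M` over a ring `R` of characteristic `p` by a character
`ξ : G → 𝔽_pˣ`: the group element `σ` acts as `x ↦ ξ(σ) σ(x)`. -/
def twist {R G V : Type*} [CommRing R] [CharP R p] [Group G] [AddCommGroup V] [Module R V]
    (ρ : Representation R G V) (ξ : G →* (ZMod p)ˣ) : Representation R G V where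
  toFun σ := ZMod.castHom (dvd_refl p) R (ξ σ : ZMod p) • ρ σ
  map_one' := by simp
  map_mul' σ τ := by
    ext x
    rw [map_mul, Units.val_mul, map_mul, map_mul, mul_smul]
    simp only [LinearMap.smul_apply, Module.End.mul_apply, map_smul]
    rw [smul_comm]

/-- The `χ`-eigenspace `M(χ) = {x | σ x = χ(σ) x for all σ}`. -/
def eigenspace {R G V : Type*} [CommRing R] [CharP R p] [Group G] [AddCommGroup V] [Module R V]
    (ρ : Representation R G V) (χ : G →* (ZMod p)ˣ) : Submodule R V where
  carrier := {x | ∀ σ, ρ σ x = ZMod.castHom (dvd_refl p) R (χ σ : ZMod p) • x}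
  add_mem' {x y} hx hy σ := by rw [map_add, hx σ, hy σ, smul_add]
  zero_mem' σ := by simp
  smul_mem' c x hx σ := by rw [map_smul, hx σ, smul_comm]

/-- A representation by automorphisms of `𝔽_p`-spaces, from additive maps (which are automatically
`𝔽_p`-linear). -/
def repOfAdd {G V : Type*} [Group G] [AddCommGroup V] [Module (ZMod p) V] (f : G → V →+ V)
    (h1 : ∀ x, f 1 x = x) (hmul : ∀ σ τ x, f (σ * τ) x = f σ (f τ x)) :
    Representation (ZMod p) G V where
  toFun σ := (f σ).toZModLinearMap p
  map_one' := by ext x; exact h1 x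
  map_mul' σ τ := by ext x; exact hmul σ τ x

/-- Two representations endowed with increasing `ℤ`-indexed filtrations are isomorphic as filtered
representations. -/
def FilteredIso {R G V W : Type*} [CommRing R] [Group G] [AddCommGroup V] [Module R V]
    [AddCommGroup W] [Module R W] (ρ : Representation R G V) (fil : ℤ → Submodule R V)
    (ρ' : Representation R G W) (fil' : ℤ → Submodule R W) : Prop :=
  ∃ φ : ρ.Equiv ρ', ∀ (m : ℤ) (x : V), x ∈ fil m ↔ φ x ∈ fil' m

/-- The graded piece `A / B` of two subrepresentations `B ⊆ A` (in general `A / (A ∩ B)`). -/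
abbrev Graded {R G V : Type*} [CommRing R] [Group G] [AddCommGroup V] [Module R V]
    {ρ : Representation R G V} (A B : Subrepresentation ρ) : Type _ :=
  A.toSubmodule ⧸ B.toSubmodule.submoduleOf A.toSubmodule

/-- The action of `G` on the graded piece `A / B`. -/
def gradedRep {R G V : Type*} [CommRing R] [Group G] [AddCommGroup V] [Module R V]
    {ρ : Representation R G V} (A B : Subrepresentation ρ) : Representation R G (Graded A B) :=
  A.toRepresentation.quotient _ fun σ _ hx => B.apply_mem_toSubmodule σ hx

/-- The class in `A / B` of an element of `A`. -/
def gradedMk {R G V : Type*} [CommRing R] [Group G] [AddCommGroup V] [Module R V]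
    {ρ : Representation R G V} (A B : Subrepresentation ρ) (x : V) (hx : x ∈ A.toSubmodule) :
    Graded A B :=
  Submodule.Quotient.mk ⟨x, hx⟩

/-- The direct product of a family of representations (the direct sum, if the family is finite). -/
def piRep {R G ι : Type*} {V : ι → Type*} [CommRing R] [Group G] [∀ i, AddCommGroup (V i)]
    [∀ i, Module R (V i)] (ρ : ∀ i, Representation R G (V i)) :
    Representation R G (∀ i, V i) where
  toFun σ := LinearMap.pi fun i => ρ i σ ∘ₗ LinearMap.proj i
  map_one' := by
    refine LinearMap.ext fun x => funext fun i => ?_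
    simp
  map_mul' σ τ := by
    refine LinearMap.ext fun x => funext fun i => ?_
    simp

/-- The filtration of a direct sum `⨁ᵢ Mᵢ` of filtered modules. -/
def directSumFil {R ι : Type*} {V : ι → Type*} [CommRing R] [∀ i, AddCommGroup (V i)]
    [∀ i, Module R (V i)] (fil : ∀ i, ℤ → Submodule R (V i)) (m : ℤ) : Submodule R (⨁ i, V i) :=
  ⨅ i, (fil i m).comap (DirectSum.component R ι V i)

/-- The filtration of a module all of whose nonzero elements have level `s`. -/
def levelFil {R V : Type*} [CommRing R] [AddCommGroup V] [Module R V] (s m : ℤ) :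
    Submodule R V :=
  if s ≤ m then ⊤ else ⊥

/-- The line `𝔽_p{χ}` on which `G` acts through the character `χ`. -/
def lineRep {G : Type*} [Group G] (χ : G →* (ZMod p)ˣ) : Representation (ZMod p) G (ZMod p) :=
  twist p (Representation.trivial (ZMod p) G (ZMod p)) χ

end

/-! ### The extension `K = F(F^{×1/(p-1)})`, characters of its group, and the modules `l[i]` -/

section
variable (p : ℕ) [Fact p.Prime]
variable (F : Type*) [Field F] [ValuativeRel F] [TopologicalSpace F] [IsNonarchimedeanLocalField F]
variable (K : Type*) [Field K] [ValuativeRel K] [TopologicalSpace K] [IsNonarchimedeanLocalField K]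
variable [Algebra F K] [ValuativeExtension F K]

/-- `K = F(ⁿ√F^×)`: every element of `F` has an `n`-th root in `K`, and `K` is generated over `F` by
the `n`-th roots of elements of `F`.  (If `F` contains a primitive `n`-th root of `1`, this
determines the extension `K` of `F` up to isomorphism.) -/
structure IsAdjoinRoots (F K : Type*) [Field F] [Field K] [Algebra F K] (n : ℕ) : Prop where
  exists_root : ∀ a : F, ∃ y : K, y ^ n = algebraMap F K a
  adjoin_eq_top : IntermediateField.adjoin F {y : K | ∃ a : F, y ^ n = algebraMap F K a} = ⊤

/-- The character `χ : G → 𝔽_pˣ` corresponds to the class of `a ∈ Fˣ` in `Fˣ/Fˣ^(p-1)`: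
`σ(y) / y = χ(σ)` for `y ^ (p-1) = a`, where `𝔽_pˣ` is identified with the group of `(p-1)`-th
roots of `1` by reduction modulo `𝔭`. -/
def IsKummerCharacter (χ : Gal(K/F) →* (ZMod p)ˣ) (a : F) : Prop :=
  a ≠ 0 ∧ ∃ y : K, y ^ (p - 1) = algebraMap F K a ∧
    ∀ σ : Gal(K/F), σ y / y - ((χ σ : ZMod p).val : K) ∈ primePow K 1

open Classical in
/-- The valuation `v̄(χ) ∈ ℤ/(p-1)ℤ` of a character `χ` of `G`: the class of `v_F(a)`, for any
`a ∈ Fˣ` such that `χ` corresponds to the class of `a`. -/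
def charVal (χ : Gal(K/F) →* (ZMod p)ˣ) : ZMod (p - 1) :=
  if h : ∃ n : ℤ, ∃ a : F, normVal F a = exp (-n) ∧ IsKummerCharacter p F K χ a then
    (h.choose : ZMod (p - 1))
  else 0

open Classical in
/-- The character `ω : G → 𝔽_pˣ`: the cyclotomic character giving the action on the `p`-th roots
of `1` if `K` contains `p` of them (as is the case in characteristic `0`), and the trivial character
otherwise (so in characteristic `p`). -/
def omega : Gal(K/F) →* (ZMod p)ˣ :=
  if h : Nat.card (rootsOfUnity p K) = p then
    { toFun := fun σ => modularCyclotomicCharacter K h (σ : K ≃+* K)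
      map_one' := map_one (modularCyclotomicCharacter K h)
      map_mul' := fun σ τ => map_mul (modularCyclotomicCharacter K h) (σ : K ≃+* K) (τ : K ≃+* K) }
  else 1

/-- The residue field `l` of `K`, as a representation of `G` over the residue field `k` of `F`. -/
def residueRep : Representation 𝓀[F] Gal(K/F) 𝓀[K] where
  toFun σ :=
    { toFun := IsLocalRing.ResidueField.mapEquiv (integerEquiv (σ : K ≃+* K))
      map_add' := map_add _
      map_smul' := by
        intro c x
        obtain ⟨c, rfl⟩ := IsLocalRing.residue_surjective c
        obtain ⟨x, rfl⟩ := IsLocalRing.residue_surjective x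
        rw [Algebra.smul_def, map_mul, RingHom.id_apply, Algebra.smul_def]
        congr 1
        change IsLocalRing.residue 𝒪[K] (integerEquiv _ (algebraMap 𝒪[F] 𝒪[K] c)) =
          IsLocalRing.residue 𝒪[K] (algebraMap 𝒪[F] 𝒪[K] c)
        congr 1
        ext
        exact σ.commutes _ }
  map_one' := by
    ext x
    obtain ⟨x, rfl⟩ := IsLocalRing.residue_surjective x
    rfl
  map_mul' σ τ := by
    ext x
    obtain ⟨x, rfl⟩ := IsLocalRing.residue_surjective x
    rfl

variable [CharP 𝓀[F] p]

/-- The integers `b = pi + 1, …, pi + p - 1` (`j = 0, …, p - 2`). -/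
def level (i : ℕ) (j : Fin (p - 1)) : ℤ := p * i + j + 1

/-- The `k[G]`-module `V_{i+1} = l[-(pi+1)]{ω} ⊕ ⋯ ⊕ l[-(pi+p-1)]{ω}`, where `l[n] = l{ξ n}`. -/
def blockRep (ξ : ℤ → (Gal(K/F) →* (ZMod p)ˣ)) (i : ℕ) :
    Representation 𝓀[F] Gal(K/F) (Fin (p - 1) → 𝓀[K]) :=
  piRep fun j => twist p (twist p (residueRep F K) (ξ (-level p i j))) (omega p F K)

/-- The filtration of `V_{i+1}` by `k[G]`-submodules: the summand `l[-b]{ω}` has level `b`. -/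
def blockFil (i : ℕ) (m : ℤ) : Submodule 𝓀[F] (Fin (p - 1) → 𝓀[K]) :=
  Submodule.pi Set.univ fun j => levelFil (level p i j) m

/-- The space `Fin (p - 1) → l` underlying `V_{i+1}`, to be viewed as an `𝔽_p`-space through the
`k`-space structure. -/
def Block (p : ℕ) (F K : Type*) [Field F] [Field K] [ValuativeRel K] : Type _ := Fin (p - 1) → 𝓀[K]

instance : AddCommGroup (Block p F K) := inferInstanceAs (AddCommGroup (Fin (p - 1) → 𝓀[K]))

instance : Module (ZMod p) (Block p F K) :=
  Module.compHom (Fin (p - 1) → 𝓀[K]) (ZMod.castHom (dvd_refl p) 𝓀[F])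

/-- `V_{i+1}` as an `𝔽_p[G]`-module. -/
def blockRepFp (ξ : ℤ → (Gal(K/F) →* (ZMod p)ˣ)) (i : ℕ) :
    Representation (ZMod p) Gal(K/F) (Block p F K) :=
  repOfAdd (V := Block p F K) p (fun σ => (blockRep p F K ξ i σ).toAddMonoidHom)
    (fun x => by
      rw [map_one]
      rfl)
    (fun σ τ x => by
      rw [map_mul]
      rfl)

/-- The filtration of `V_{i+1}` by `𝔽_p[G]`-submodules. -/
def blockFilFp (i : ℕ) (m : ℤ) : Submodule (ZMod p) (Block p F K) :=
  AddSubgroup.toZModSubmodule p (blockFil p F K i m).toAddSubgroup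

end

/-! ### The filtered module `Kˣ/Kˣᵖ` -/

section
variable (p : ℕ) [Fact p.Prime]
variable (F : Type*) [Field F] (K : Type*) [Field K] [Algebra F K]

/-- The `𝔽_p`-space `Kˣ/Kˣᵖ`, written additively. -/
def MulMod (p : ℕ) (K : Type*) [Field K] : Type _ :=
  Additive (Kˣ ⧸ (powMonoidHom p : Kˣ →* Kˣ).range)

instance : AddCommGroup (MulMod p K) :=
  inferInstanceAs (AddCommGroup (Additive (Kˣ ⧸ (powMonoidHom p : Kˣ →* Kˣ).range)))

/-- The projection `Kˣ → Kˣ/Kˣᵖ`. -/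
def mulMk (p : ℕ) (K : Type*) [Field K] : Additive Kˣ →+ MulMod p K :=
  MonoidHom.toAdditive (QuotientGroup.mk' (powMonoidHom p : Kˣ →* Kˣ).range)

theorem mulMk_surjective (p : ℕ) (K : Type*) [Field K] : Function.Surjective (mulMk p K) :=
  QuotientGroup.mk'_surjective (powMonoidHom p : Kˣ →* Kˣ).range

instance : Module (ZMod p) (MulMod p K) := AddCommGroup.zmodModule fun x => by
  obtain ⟨u, rfl⟩ := mulMk_surjective p K x
  rw [← map_nsmul]
  exact (QuotientGroup.eq_one_iff (N := (powMonoidHom p : Kˣ →* Kˣ).range)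
    (u.toMul ^ p)).2 ⟨u.toMul, rfl⟩

/-- The action of `G` on `Kˣ/Kˣᵖ`. -/
def mulRep : Representation (ZMod p) Gal(K/F) (MulMod p K) :=
  repOfAdd p
    (fun σ => MonoidHom.toAdditive (QuotientGroup.map (powMonoidHom p : Kˣ →* Kˣ).range
      (powMonoidHom p : Kˣ →* Kˣ).range (Units.map (σ : K →* K)) (by
        rintro _ ⟨u, rfl⟩
        exact ⟨Units.map (σ : K →* K) u, by simp⟩)))
    (fun x => by
      obtain ⟨u, rfl⟩ := mulMk_surjective p K x
      exact congrArg (mulMk p K) (congrArg Additive.ofMul (Units.ext rfl)))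
    (fun σ τ x => by
      obtain ⟨u, rfl⟩ := mulMk_surjective p K x
      exact congrArg (mulMk p K) (congrArg Additive.ofMul (Units.ext rfl)))

theorem mulRep_mk (σ : Gal(K/F)) (u : Kˣ) : mulRep p F K σ (mulMk p K (Additive.ofMul u)) =
    mulMk p K (Additive.ofMul (Units.map (σ : K →* K) u)) := rfl

variable [ValuativeRel K] [TopologicalSpace K] [IsNonarchimedeanLocalField K]

/-- The subrepresentation `Ū_n` of `Kˣ/Kˣᵖ`: the image of `U_n` for `n > 0`, and the whole of
`Kˣ/Kˣᵖ` for `n ≤ 0`. -/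
def mulStep (n : ℤ) : Subrepresentation (mulRep p F K) where
  toSubmodule := AddSubgroup.toZModSubmodule p
    (if 0 < n then (Subgroup.toAddSubgroup (unitGroup K n)).map (mulMk p K) else ⊤)
  apply_mem_toSubmodule σ x hx := by
    rw [AddSubgroup.mem_toZModSubmodule] at hx ⊢
    split_ifs at hx ⊢
    · obtain ⟨u, hu, rfl⟩ := hx
      exact ⟨Additive.ofMul (Units.map (σ : K →* K) u.toMul),
        ringEquiv_mem_unitGroup (σ : K ≃+* K) hu, rfl⟩
    · trivial

theorem mulMk_mem_mulStep {n : ℤ} {u : Kˣ} (hu : u ∈ unitGroup K n) :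
    mulMk p K (Additive.ofMul u) ∈ (mulStep p F K n).toSubmodule := by
  change _ ∈ AddSubgroup.toZModSubmodule p _
  rw [AddSubgroup.mem_toZModSubmodule]
  split_ifs
  · exact ⟨Additive.ofMul u, hu, rfl⟩
  · trivial

/-- The increasing filtration `ℱ_m = Ū_{pe-m}` of `Kˣ/Kˣᵖ`. -/
def mulFil (e : ℕ) (m : ℤ) : Submodule (ZMod p) (MulMod p K) :=
  (mulStep p F K (p * e - m)).toSubmodule

/-- The class of a unit `u ∈ U_i` in `Ū_i/Ū_{i+1}`. -/
def mulGradedMk (i : ℤ) (u : Kˣ) (hu : u ∈ unitGroup K i) :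
    Graded (mulStep p F K i) (mulStep p F K (i + 1)) :=
  gradedMk _ _ (mulMk p K (Additive.ofMul u)) (mulMk_mem_mulStep p F K hu)

end

/-! ### The filtered module `K/℘(K)` -/

section
variable (p : ℕ) [Fact p.Prime]
variable (F : Type*) [Field F] (K : Type*) [Field K] [Algebra F K] [CharP K p]

/-- The additive map `℘ : K → K`, `x ↦ xᵖ - x`. -/
def artinSchreier (p : ℕ) [Fact p.Prime] (K : Type*) [Field K] [CharP K p] : K →+ K :=
  (frobenius K p : K →+ K) - AddMonoidHom.id K

theorem artinSchreier_apply (x : K) : artinSchreier p K x = x ^ p - x := rfl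

/-- The `𝔽_p`-space `K/℘(K)`. -/
def AddMod (p : ℕ) [Fact p.Prime] (K : Type*) [Field K] [CharP K p] : Type _ :=
  K ⧸ (artinSchreier p K).range

instance : AddCommGroup (AddMod p K) := inferInstanceAs (AddCommGroup (K ⧸ (artinSchreier p K).range))

/-- The projection `K → K/℘(K)`. -/
def addMk : K →+ AddMod p K := QuotientAddGroup.mk' (artinSchreier p K).range

theorem addMk_surjective : Function.Surjective (addMk p K) :=
  QuotientAddGroup.mk'_surjective (artinSchreier p K).range

instance : Module (ZMod p) (AddMod p K) := AddCommGroup.zmodModule fun x => by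
  obtain ⟨u, rfl⟩ := addMk_surjective p K x
  rw [← map_nsmul, nsmul_eq_mul, CharP.cast_eq_zero, zero_mul, map_zero]

/-- The action of `G` on `K/℘(K)`. -/
def addRep : Representation (ZMod p) Gal(K/F) (AddMod p K) :=
  repOfAdd p
    (fun σ => QuotientAddGroup.map (artinSchreier p K).range
      (artinSchreier p K).range (σ : K →+ K) (by
        rintro _ ⟨u, rfl⟩
        exact ⟨σ u, by simp [artinSchreier_apply]⟩))
    (fun x => by
      obtain ⟨u, rfl⟩ := addMk_surjective p K x
      rfl)
    (fun σ τ x => by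
      obtain ⟨u, rfl⟩ := addMk_surjective p K x
      rfl)

theorem addRep_mk (σ : Gal(K/F)) (x : K) : addRep p F K σ (addMk p K x) = addMk p K (σ x) := rfl

variable [ValuativeRel K] [TopologicalSpace K] [IsNonarchimedeanLocalField K]

/-- The subrepresentation of `K/℘(K)` which is the image of `𝔭ⁿ`. -/
def addStep (n : ℤ) : Subrepresentation (addRep p F K) where
  toSubmodule := AddSubgroup.toZModSubmodule p ((primePow K n).map (addMk p K))
  apply_mem_toSubmodule σ x hx := by
    rw [AddSubgroup.mem_toZModSubmodule] at hx ⊢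
    obtain ⟨u, hu, rfl⟩ := hx
    exact ⟨σ u, ringEquiv_mem_primePow (σ : K ≃+* K) hu, rfl⟩

theorem addMk_mem_addStep {n : ℤ} {x : K} (hx : x ∈ primePow K n) :
    addMk p K x ∈ (addStep p F K n).toSubmodule :=
  (AddSubgroup.mem_toZModSubmodule p).2 ⟨x, hx, rfl⟩

/-- The increasing filtration of `K/℘(K)` whose `m`-th term is the image of `𝔭^{-m}`. -/
def addFil (m : ℤ) : Submodule (ZMod p) (AddMod p K) := (addStep p F K (-m)).toSubmodule

/-- The class of `x ∈ 𝔭^i` in the `i`-th graded piece of `K/℘(K)`. -/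
def addGradedMk (i : ℤ) (x : K) (hx : x ∈ primePow K i) :
    Graded (addStep p F K i) (addStep p F K (i + 1)) :=
  gradedMk _ _ (addMk p K x) (addMk_mem_addStep p F K hx)

end

/-! ### The statements about graded pieces and filtered modules -/

section
variable (p : ℕ) [Fact p.Prime]
variable (F : Type*) [Field F] [ValuativeRel F] [TopologicalSpace F] [IsNonarchimedeanLocalField F]
variable (K : Type*) [Field K] [ValuativeRel K] [TopologicalSpace K] [IsNonarchimedeanLocalField K]
variable [Algebra F K] [ValuativeExtension F K] [CharP 𝓀[F] p]

/-- The space `Ū_i/Ū_{i+1}`, with the `k`-structure coming from the identification of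
`U_i/U_{i+1}` with `𝔭^i/𝔭^{i+1}` (so that `ā • [1 + x] = [1 + a x]`) and with its natural action of
`G`, is a `k[G]`-module isomorphic to `τ`. -/
def MulGradedIso (i : ℤ) {W : Type*} [AddCommGroup W] [Module 𝓀[F] W]
    (τ : Representation 𝓀[F] Gal(K/F) W) : Prop :=
  ∃ _ : Module 𝓀[F] (Graded (mulStep p F K i) (mulStep p F K (i + 1))),
    (∀ (a : 𝒪[F]) (u w : Kˣ) (hu : u ∈ unitGroup K i) (hw : w ∈ unitGroup K i),
      (w : K) - 1 = algebraMap F K a * ((u : K) - 1) →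
        IsLocalRing.residue 𝒪[F] a • mulGradedMk p F K i u hu = mulGradedMk p F K i w hw) ∧
    ∃ ρ : Representation 𝓀[F] Gal(K/F) (Graded (mulStep p F K i) (mulStep p F K (i + 1))),
      (∀ σ x, ρ σ x = gradedRep (mulStep p F K i) (mulStep p F K (i + 1)) σ x) ∧
      Nonempty (ρ.Equiv τ)

/-- The quotient of the image of `𝔭^i` in `K/℘(K)` by the image of `𝔭^{i+1}`, with the
`k`-structure coming from `𝔭^i/𝔭^{i+1}` (so that `ā • [x] = [a x]`) and with its natural action
of `G`, is a `k[G]`-module isomorphic to `τ`. -/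
def AddGradedIso [CharP K p] (i : ℤ) {W : Type*} [AddCommGroup W] [Module 𝓀[F] W]
    (τ : Representation 𝓀[F] Gal(K/F) W) : Prop :=
  ∃ _ : Module 𝓀[F] (Graded (addStep p F K i) (addStep p F K (i + 1))),
    (∀ (a : 𝒪[F]) (x y : K) (hx : x ∈ primePow K i) (hy : y ∈ primePow K i),
      y = algebraMap F K a * x →
        IsLocalRing.residue 𝒪[F] a • addGradedMk p F K i x hx = addGradedMk p F K i y hy) ∧
    ∃ ρ : Representation 𝓀[F] Gal(K/F) (Graded (addStep p F K i) (addStep p F K (i + 1))),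
      (∀ σ x, ρ σ x = gradedRep (addStep p F K i) (addStep p F K (i + 1)) σ x) ∧
      Nonempty (ρ.Equiv τ)

/-- The `𝔽_p[G]`-module `𝔽_p{ω} ⊕ V_1 ⊕ ⋯ ⊕ V_e ⊕ 𝔽_p`. -/
def mulModel (ξ : ℤ → (Gal(K/F) →* (ZMod p)ˣ)) (e : ℕ) :
    Representation (ZMod p) Gal(K/F) (ZMod p × (⨁ _ : Fin e, Block p F K) × ZMod p) :=
  (lineRep p (omega p F K)).prod
    ((Representation.directSum fun i : Fin e => blockRepFp p F K ξ i).prod (lineRep p 1))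

/-- Its filtration: `𝔽_p{ω}` has level `0`, the last summand `𝔽_p` has level `pe`. -/
def mulModelFil (e : ℕ) (m : ℤ) :
    Submodule (ZMod p) (ZMod p × (⨁ _ : Fin e, Block p F K) × ZMod p) :=
  (levelFil 0 m).prod
    ((directSumFil (fun i : Fin e => blockFilFp p F K i) m).prod (levelFil (p * e) m))

/-- The `𝔽_p[G]`-module `𝔽_p ⊕ V_1 ⊕ V_2 ⊕ ⋯`. -/
def addModel (ξ : ℤ → (Gal(K/F) →* (ZMod p)ˣ)) :
    Representation (ZMod p) Gal(K/F) (ZMod p × (⨁ _ : ℕ, Block p F K)) :=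
  (lineRep p 1).prod (Representation.directSum fun i : ℕ => blockRepFp p F K ξ i)

/-- Its filtration: the line `𝔽_p` has level `0`. -/
def addModelFil (m : ℤ) : Submodule (ZMod p) (ZMod p × (⨁ _ : ℕ, Block p F K)) :=
  (levelFil 0 m).prod (directSumFil (fun i : ℕ => blockFilFp p F K i) m)

end

end

end FilteredGalois

open FilteredGalois

/-!
The group `G = Gal(K/F)` is finite, abelian, and killed by `p - 1`: every `σ` multiplies each
`(p - 1)`-th root `y` of an element of `F` by a `(p - 1)`-th root of `1`, and `K` is generated by
such `y`. So the order of `G` is prime to `p`, the characters `G → 𝔽_pˣ` separate the elements of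
`G`, and by Hilbert 90 each character `χ` is the character of an eigenvector `y ∈ Kˣ`, that is,
`σ y = χ(σ) y` for the Teichmüller lift of `χ(σ)` (`exists_eigenvector`). The ramification index of
`K` over `F` is exactly `p - 1` (`normVal_algebraMap`); as a consequence, `v̄(χ)` is the class of
`v_K(y)` modulo `p - 1`, and `χ` has eigenvectors of every valuation in the class `v̄(χ)`
(`exists_eigenvector_of_charVal`).

Eigenvectors do most of the work. If `y` has valuation `i` and character `χ`, then
`z ↦ z / y mod 𝔭` identifies `𝔭^i/𝔭^{i+1}` with the residue field `l` twisted by `χ`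
(`red_apply_div`). Eigenvectors in `l` lift to roots of unity in `K`, which are eigenvectors of
valuation `0`; this gives the eigenspaces of `l[i]`, and the fact that each character occurs exactly
once in `V_i`, which is equivalent to `V_i` being free of rank one since `|G|` is prime to `p`
(`nonempty_asModule_equiv`).

By Maschke's theorem a bounded filtration by subrepresentations splits, so that the filtered
isomorphisms only have to be constructed on graded pieces (`filteredIso_of_graded`).

In characteristic `p`, the valuation of `xᵖ - x` is `p v(x)` if `v(x) < 0`. Therefore, the graded
piece of `K/℘(K)` in a negative degree `i` is that of `K` if `i` is prime to `p`, and it is zero if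
`p` divides `i`, because `l` is perfect. In degree `0` it is `l/℘(l)`, which the trace identifies
with `𝔽_p`; in positive degrees it vanishes by Hensel's lemma.

In characteristic `0`, let `π` be a `(p - 1)`-th root of `-p`, so that `v_K(π) = e`. The substitution
`u = 1 + π x` turns `uᵖ - 1` into `πᵖ` times a polynomial congruent to `xᵖ - x`
(`exists_one_add_mul_pow_sub_one_eq`). Solving `uᵖ = 1` shows that `K` contains the `p`-th roots of
`1` and that `ω` is the character of `π` (`apply_eq_teichmuller_omega_mul`); in degree `pe` one finds
`l/℘(l)` twisted by `ω`, and in degrees above `pe` every unit is a `p`-th power. In degrees `i`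
between `0` and `pe` the `p`-th powers contribute exactly when `p` divides `i`, since the valuation
of `(1 + z)ᵖ - 1` is `p v(z)` for `v(z) < e`. Finally `Kˣ/Ū_1` is identified with `𝔽_p` by the
valuation modulo `p`.
-/

namespace FilteredGalois

set_option linter.unusedSectionVars false

/-! ### Filtered representations -/

/-- A filtration by subrepresentations that is exhaustive and whose terms of negative index
vanish. -/
structure IsBoundedFil {R G V : Type*} [CommRing R] [Group G] [AddCommGroup V] [Module R V]
    (ρ : Representation R G V) (fil : ℤ → Submodule R V) : Prop where
  mono : Monotone fil
  apply_mem : ∀ (m : ℤ) (σ : G) (x : V), x ∈ fil m → ρ σ x ∈ fil m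
  eq_bot : ∀ m < 0, fil m = ⊥
  exists_mem : ∀ x, ∃ m, x ∈ fil m

section Filtered

variable {R G W : Type*} [CommRing R] [Group G] [AddCommGroup W] [Module R W]

/-- If equivariant maps `f m : X m → W` identify each `X m` with the graded piece of level `m`, then
their sum identifies `⨁ₘ X m` with `W` as filtered representations. -/
theorem exists_directSum_equiv {ρ : Representation R G W} {fil : ℤ → Submodule R W}
    (h : IsBoundedFil ρ fil) {X : ℕ → Type*} [∀ m, AddCommGroup (X m)] [∀ m, Module R (X m)]
    (τ : ∀ m, Representation R G (X m)) (f : ∀ m, X m →ₗ[R] W)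
    (hequiv : ∀ m σ x, f m (τ m σ x) = ρ σ (f m x))
    (hmem : ∀ (m : ℕ) x, f m x ∈ fil m)
    (hinj : ∀ (m : ℕ) x, f m x ∈ fil (m - 1) → x = 0)
    (hsurj : ∀ (m : ℕ), ∀ z ∈ fil m, ∃ x, z - f m x ∈ fil (m - 1)) :
    ∃ φ : (Representation.directSum τ).Equiv ρ,
      ∀ (m : ℤ) x, φ x ∈ fil m ↔ ∀ i : ℕ, m < i → x i = 0 := by
  classical
  set Φ : (⨁ m, X m) →ₗ[R] W := DirectSum.toModule R ℕ W f with hΦ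
  have hof : ∀ m x, Φ (DirectSum.of X m x) = f m x := fun m x =>
    DirectSum.toModule_lof R m x
  have hle : ∀ (m : ℤ) (x : ⨁ m, X m), (∀ i : ℕ, m < i → x i = 0) → Φ x ∈ fil m := by
    intro m x hx
    rw [← DirectSum.sum_support_of x, map_sum]
    refine Submodule.sum_mem _ fun i hi => ?_
    rw [hof]
    refine h.mono ?_ (hmem i _)
    by_contra! hlt
    exact (DFinsupp.mem_support_iff.1 hi) (hx i hlt)
  have hge : ∀ (N : ℕ) (m : ℤ) (x : ⨁ m, X m), (∀ i : ℕ, N ≤ i → x i = 0) → Φ x ∈ fil m →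
      ∀ i : ℕ, m < i → x i = 0 := by
    intro N
    induction N with
    | zero => exact fun m x hx _ i _ => hx i (Nat.zero_le i)
    | succ N ih =>
      intro m x hx hm
      by_cases hN : (N : ℤ) ≤ m
      · exact fun i hi => hx i (by omega)
      have h1 : Φ (x - DirectSum.of X N (x N)) ∈ fil (N - 1) := by
        refine hle _ _ fun i hi => ?_
        rcases eq_or_ne i N with rfl | hne
        · simp
        · rw [DirectSum.sub_apply, DirectSum.of_eq_of_ne _ _ _ hne, sub_zero]
          exact hx i (by omega)
      have h2 : x N = 0 := by
        apply hinj N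
        rw [map_sub, hof] at h1
        have := sub_mem (h.mono (show m ≤ (N : ℤ) - 1 by omega) hm) h1
        simpa using this
      refine ih m x (fun i hi => ?_) hm
      rcases eq_or_ne i N with rfl | hne
      · exact h2
      · exact hx i (by omega)
  have hbound : ∀ x : ⨁ m, X m, ∃ N : ℕ, ∀ i : ℕ, N ≤ i → x i = 0 := fun x => by
    refine ⟨(DFinsupp.support x).sup id + 1, fun i hi => ?_⟩
    by_contra hne
    have := Finset.le_sup (f := id) (DFinsupp.mem_support_iff.2 hne)
    simp only [id] at this
    omega
  have hiff : ∀ (m : ℤ) x, Φ x ∈ fil m ↔ ∀ i : ℕ, m < i → x i = 0 := fun m x =>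
    ⟨fun hm => let ⟨N, hN⟩ := hbound x; hge N m x hN hm, hle m x⟩
  have hsur : ∀ (N : ℕ) (z : W), z ∈ fil ((N : ℤ) - 1) → ∃ x, Φ x = z := by
    intro N
    induction N with
    | zero =>
      intro z hz
      rw [h.eq_bot _ (by simp), Submodule.mem_bot] at hz
      exact ⟨0, by rw [map_zero, hz]⟩
    | succ N ih =>
      intro z hz
      obtain ⟨x, hx⟩ := hsurj N z (by simpa using hz)
      obtain ⟨y, hy⟩ := ih _ hx
      exact ⟨y + DirectSum.of X N x, by rw [map_add, hof, hy, sub_add_cancel]⟩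
  have hbij : Function.Bijective Φ := by
    refine ⟨(injective_iff_map_eq_zero Φ).2 fun x hx => ?_, fun z => ?_⟩
    · refine DFinsupp.ext fun i => (hiff (-1) x).1 (by rw [hx]; exact zero_mem _) i (by omega)
    · obtain ⟨m, hm⟩ := h.exists_mem z
      exact hsur (m.toNat + 1) z (h.mono (by push_cast; omega) hm)
  refine ⟨Representation.Equiv.mk (LinearEquiv.ofBijective Φ hbij) fun σ => ?_, hiff⟩
  refine DirectSum.linearMap_ext R fun i => LinearMap.ext fun x => ?_
  change Φ (Representation.directSum τ σ (DirectSum.of X i x)) = ρ σ (Φ (DirectSum.of X i x))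
  rw [hof, ← hequiv, ← hof]
  congr 1
  exact DirectSum.lmap_lof (fun i => τ i σ) i x

end Filtered

/-- An isomorphism between the graded pieces of level `m` of two filtered representations, given by a
lift `g` to a map from the `m`-th term of the first filtration to the second representation; the
values of `g` outside this term do not matter. -/
def HasGradedLift {R G V W : Type*} [CommRing R] [Group G] [AddCommGroup V] [Module R V]
    [AddCommGroup W] [Module R W] (ρ : Representation R G V) (fil : ℤ → Submodule R V)
    (ρ' : Representation R G W) (fil' : ℤ → Submodule R W) (m : ℤ) : Prop :=
  ∃ g : V → W, (∀ x ∈ fil m, ∀ y ∈ fil m, g (x + y) = g x + g y) ∧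
    (∀ x ∈ fil m, ∀ σ, g (ρ σ x) = ρ' σ (g x)) ∧
    (∀ x ∈ fil m, g x ∈ fil' m) ∧
    (∀ x ∈ fil m, g x ∈ fil' (m - 1) → x ∈ fil (m - 1)) ∧
    (∀ x ∈ fil (m - 1), g x ∈ fil' (m - 1)) ∧
    (∀ z ∈ fil' m, ∃ x ∈ fil m, z - g x ∈ fil' (m - 1))

/-- Two filtered representations over `𝔽_p` of a finite group of order prime to `p` are isomorphic
if their graded pieces are: by Maschke's theorem, both are the direct sums of their graded pieces. -/
theorem filteredIso_of_graded {p : ℕ} [Fact p.Prime] {G V W : Type*} [Group G] [Finite G]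
    (hG : ¬ p ∣ Nat.card G) [AddCommGroup V] [Module (ZMod p) V] [AddCommGroup W]
    [Module (ZMod p) W] {ρ : Representation (ZMod p) G V} {fil : ℤ → Submodule (ZMod p) V}
    (h : IsBoundedFil ρ fil) {ρ' : Representation (ZMod p) G W} {fil' : ℤ → Submodule (ZMod p) W}
    (h' : IsBoundedFil ρ' fil')
    (hgr : ∀ m : ℕ, HasGradedLift ρ fil ρ' fil' m) :
    FilteredIso ρ fil ρ' fil' := by
  have : NeZero (Nat.card G : ZMod p) :=
    ⟨fun h0 => hG ((ZMod.natCast_eq_zero_iff _ _).1 h0)⟩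
  let S : ℤ → Subrepresentation ρ := fun m => ⟨fil m, fun σ x hx => h.apply_mem m σ x hx⟩
  have hC : ∀ m : ℕ, ∃ C : Subrepresentation ρ, C.toSubmodule ≤ fil m ∧
      C.toSubmodule ⊓ fil (m - 1) = ⊥ ∧ ∀ z ∈ fil m, ∃ x ∈ C.toSubmodule, z - x ∈ fil (m - 1) := by
    intro m
    obtain ⟨D, hD⟩ := exists_isCompl (S (m - 1))
    have hsup : (S (m - 1)).toSubmodule ⊔ D.toSubmodule = ⊤ := by
      rw [← Subrepresentation.toSubmodule_sup, hD.sup_eq_top]; rfl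
    have hinf : (S (m - 1)).toSubmodule ⊓ D.toSubmodule = ⊥ := by
      rw [← Subrepresentation.toSubmodule_inf, hD.inf_eq_bot]; rfl
    have hle : fil ((m : ℤ) - 1) ≤ fil m := h.mono (by omega)
    refine ⟨S m ⊓ D, inf_le_left, ?_, fun z hz => ?_⟩
    · rw [eq_bot_iff, ← hinf]
      rintro x ⟨⟨-, h1⟩, h2⟩
      exact ⟨h2, h1⟩
    · obtain ⟨a, ha, d, hd, rfl⟩ := Submodule.mem_sup.1 (hsup ▸ Submodule.mem_top : z ∈ _)
      refine ⟨d, ⟨?_, hd⟩, by simpa using ha⟩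
      simpa using sub_mem hz (hle ha)
  choose C hCle hCinf hCsurj using hC
  choose g hadd hequiv hmem hinj hlow hsurj using hgr
  obtain ⟨φ, hφ⟩ := exists_directSum_equiv h (fun m => (C m).toRepresentation)
    (fun m => (C m).toSubmodule.subtype) (fun m σ x => rfl) (fun m x => hCle m x.2)
    (fun m x hx => by
      have : (x : V) ∈ (C m).toSubmodule ⊓ fil (m - 1) := ⟨x.2, hx⟩
      rw [hCinf, Submodule.mem_bot] at this
      exact Subtype.ext this)
    (fun m z hz => by
      obtain ⟨x, hx, hzx⟩ := hCsurj m z hz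
      exact ⟨⟨x, hx⟩, hzx⟩)
  let f : ∀ m, (C m).toSubmodule →+ W := fun m => AddMonoidHom.mk' (fun x => g m x)
    fun x y => hadd m _ (hCle m x.2) _ (hCle m y.2)
  have hf : ∀ m x, f m x = g m x := fun m x => rfl
  obtain ⟨ψ, hψ⟩ := exists_directSum_equiv h' (fun m => (C m).toRepresentation)
    (fun m => (f m).toZModLinearMap p) (fun m σ x => hequiv m x (hCle m x.2) σ)
    (fun m x => hmem m _ (hCle m x.2))
    (fun m x hx => by
      have : (x : V) ∈ (C m).toSubmodule ⊓ fil (m - 1) := ⟨x.2, hinj m _ (hCle m x.2) hx⟩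
      rw [hCinf, Submodule.mem_bot] at this
      exact Subtype.ext this)
    (fun m z hz => by
      obtain ⟨y, hy, hzy⟩ := hsurj m z hz
      obtain ⟨x, hx, hyx⟩ := hCsurj m y hy
      refine ⟨⟨x, hx⟩, ?_⟩
      change z - g m x ∈ _
      have h1 : g m y = g m (y - x) + g m x := by
        rw [← hadd m _ (sub_mem hy (hCle m hx)) _ (hCle m hx), sub_add_cancel]
      have h2 := add_mem hzy (hlow m _ hyx)
      rw [h1] at h2
      rwa [show z - (g m (y - x) + g m x) + g m (y - x) = z - g m x by abel] at h2)
  refine ⟨φ.symm.trans ψ, fun m x => ?_⟩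
  have h1 := hφ m (φ.symm x)
  have h2 := hψ m (φ.symm x)
  rw [show φ (φ.symm x) = x from φ.toLinearEquiv.apply_symm_apply x] at h1
  exact h1.trans h2.symm

/-- Both graded pieces of level `m` vanish. -/
theorem hasGradedLift_of_eq {R G V W : Type*} [CommRing R] [Group G] [AddCommGroup V] [Module R V]
    [AddCommGroup W] [Module R W] {ρ : Representation R G V} {fil : ℤ → Submodule R V}
    {ρ' : Representation R G W} {fil' : ℤ → Submodule R W} {m : ℤ}
    (h : fil m ≤ fil (m - 1)) (h' : fil' m ≤ fil' (m - 1)) : HasGradedLift ρ fil ρ' fil' m :=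
  ⟨0, fun _ _ _ _ => by simp, fun _ _ _ => by simp, fun _ _ => zero_mem _, fun _ hx _ => h hx,
    fun _ _ => zero_mem _, fun z hz => ⟨0, zero_mem _, by simpa using h' hz⟩⟩

/-- `θ` induces an isomorphism from the quotient `A / B` of two terms of a filtration to `L`, where
the group acts through `act`. The values of `θ` outside `A` do not matter. -/
structure IsGradedCoord {R G V L : Type*} [CommRing R] [Group G] [AddCommGroup V] [Module R V]
    [AddCommGroup L] (ρ : Representation R G V) (A B : Submodule R V) (act : G → L → L)
    (θ : V → L) : Prop where
  map_add : ∀ x ∈ A, ∀ y ∈ A, θ (x + y) = θ x + θ y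
  map_act : ∀ x ∈ A, ∀ σ, θ (ρ σ x) = act σ (θ x)
  eq_zero_iff : ∀ x ∈ A, θ x = 0 ↔ x ∈ B
  exists_eq : ∀ w, ∃ x ∈ A, θ x = w

/-- A coordinate on the graded piece of level `m` of the first filtration, with values in a direct
summand `L` of the second representation. -/
theorem hasGradedLift_of_summand {R G V W L : Type*} [CommRing R] [Group G] [AddCommGroup V]
    [Module R V] [AddCommGroup W] [Module R W] [AddCommGroup L] {ρ : Representation R G V}
    {fil : ℤ → Submodule R V} {ρ' : Representation R G W} {fil' : ℤ → Submodule R W} {m : ℤ}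
    (hle : fil (m - 1) ≤ fil m) {act : G → L → L} (s : L →+ W) (π : W →+ L)
    (hπs : ∀ w, π (s w) = w) (hs : ∀ σ w, s (act σ w) = ρ' σ (s w)) (hsm : ∀ w, s w ∈ fil' m)
    (hπ : ∀ z, z ∈ fil' (m - 1) ↔ z ∈ fil' m ∧ π z = 0)
    {θ : V → L} (hθ : IsGradedCoord ρ (fil m) (fil (m - 1)) act θ) :
    HasGradedLift ρ fil ρ' fil' m := by
  refine ⟨fun x => s (θ x), fun x hx y hy => ?_, fun x hx σ => ?_, fun x _ => hsm _,
    fun x hx h => ?_, fun x hx => ?_, fun z hz => ?_⟩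
  · dsimp only
    rw [hθ.map_add x hx y hy, map_add]
  · dsimp only
    rw [hθ.map_act x hx, hs]
  · rw [hπ, hπs] at h
    exact (hθ.eq_zero_iff x hx).1 h.2
  · dsimp only
    rw [(hθ.eq_zero_iff x (hle hx)).2 hx, map_zero]
    exact zero_mem _
  · obtain ⟨x, hx, hxz⟩ := hθ.exists_eq (π z)
    refine ⟨x, hx, (hπ _).2 ⟨sub_mem hz (hsm _), ?_⟩⟩
    rw [map_sub, hπs, hxz, sub_self]

/-- The isomorphism from the graded piece to `L` induced by a coordinate. -/
theorem IsGradedCoord.exists_equiv {R G V L : Type*} [CommRing R] [Group G] [AddCommGroup V]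
    [Module R V] [AddCommGroup L] {ρ : Representation R G V} {A B : Subrepresentation ρ}
    {act : G → L → L} {θ : V → L} (hθ : IsGradedCoord ρ A.toSubmodule B.toSubmodule act θ) :
    ∃ e : Graded A B ≃+ L, (∀ x hx, e (gradedMk A B x hx) = θ x) ∧
      ∀ σ x, e (gradedRep A B σ x) = act σ (e x) := by
  let f : A.toSubmodule →+ L := AddMonoidHom.mk' (fun x => θ x) fun x y =>
    hθ.map_add x x.2 y y.2
  let f' : Graded A B →+ L := QuotientAddGroup.lift
    (B.toSubmodule.submoduleOf A.toSubmodule).toAddSubgroup f fun x hx =>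
      (hθ.eq_zero_iff x x.2).2 hx
  have hf' : ∀ x hx, f' (gradedMk A B x hx) = θ x := fun x hx => rfl
  have hbij : Function.Bijective f' := by
    refine ⟨(injective_iff_map_eq_zero f').2 fun x hx => ?_, fun w => ?_⟩
    · obtain ⟨⟨x, hxA⟩, rfl⟩ := Submodule.Quotient.mk_surjective _ x
      exact (Submodule.Quotient.mk_eq_zero _).2 ((hθ.eq_zero_iff x hxA).1 hx)
    · obtain ⟨x, hx, rfl⟩ := hθ.exists_eq w
      exact ⟨gradedMk A B x hx, rfl⟩
  refine ⟨AddEquiv.ofBijective f' hbij, hf', fun σ x => ?_⟩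
  obtain ⟨⟨x, hxA⟩, rfl⟩ := Submodule.Quotient.mk_surjective _ x
  exact hθ.map_act x hxA σ

/-- Transport of a linear structure and of a linear action along an equivariant bijection. -/
theorem exists_module_of_addEquiv {k G Q L : Type*} [CommRing k] [Group G] [AddCommGroup Q]
    [AddCommGroup L] [Module k L] (e : Q ≃+ L) (τ : Representation k G L) (act : G → Q → Q)
    (h : ∀ σ x, e (act σ x) = τ σ (e x)) :
    ∃ _ : Module k Q, (∀ (c : k) x, e (c • x) = c • e x) ∧
      ∃ ρ : Representation k G Q, (∀ σ x, ρ σ x = act σ x) ∧ Nonempty (ρ.Equiv τ) := by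
  let _ : Module k Q := e.module k
  let e' : Q ≃ₗ[k] L := { e with map_smul' := fun c x => e.apply_symm_apply _ }
  let ρ : Representation k G Q :=
    { toFun := fun σ => e'.symm.toLinearMap ∘ₗ τ σ ∘ₗ e'.toLinearMap
      map_one' := LinearMap.ext fun x => by simp
      map_mul' := fun σ σ' => LinearMap.ext fun x => by simp }
  refine ⟨inferInstance, e'.map_smul, ρ, fun σ x => ?_,
    ⟨Representation.Equiv.mk e' fun σ => LinearMap.ext fun x => ?_⟩⟩
  · exact e.injective ((e.apply_symm_apply _).trans (h σ x).symm)
  · exact e.apply_symm_apply _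

theorem IsBoundedFil.prod {R G V W : Type*} [CommRing R] [Group G] [AddCommGroup V] [Module R V]
    [AddCommGroup W] [Module R W] {ρ : Representation R G V} {fil : ℤ → Submodule R V}
    {ρ' : Representation R G W} {fil' : ℤ → Submodule R W} (h : IsBoundedFil ρ fil)
    (h' : IsBoundedFil ρ' fil') :
    IsBoundedFil (ρ.prod ρ') (fun m => (fil m).prod (fil' m)) := by
  refine ⟨fun m n hmn x hx => ⟨h.mono hmn hx.1, h'.mono hmn hx.2⟩,
    fun m σ x hx => ⟨h.apply_mem m σ _ hx.1, h'.apply_mem m σ _ hx.2⟩, fun m hm => ?_, fun x => ?_⟩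
  · rw [h.eq_bot m hm, h'.eq_bot m hm, Submodule.prod_bot]
  · obtain ⟨m, hm⟩ := h.exists_mem x.1
    obtain ⟨n, hn⟩ := h'.exists_mem x.2
    exact ⟨max m n, h.mono (le_max_left _ _) hm, h'.mono (le_max_right _ _) hn⟩

theorem mem_levelFil {R V : Type*} [CommRing R] [AddCommGroup V] [Module R V] {s m : ℤ} {x : V} :
    x ∈ (levelFil s m : Submodule R V) ↔ (m < s → x = 0) := by
  unfold levelFil
  split_ifs with h
  · exact ⟨fun _ h' => absurd h (not_le.2 h'), fun _ => trivial⟩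
  · rw [Submodule.mem_bot]
    exact ⟨fun hx _ => hx, fun hx => hx (not_le.1 h)⟩

theorem isBoundedFil_levelFil {R G V : Type*} [CommRing R] [Group G] [AddCommGroup V] [Module R V]
    (ρ : Representation R G V) {s : ℤ} (hs : 0 ≤ s) : IsBoundedFil ρ (levelFil s) := by
  refine ⟨fun m n hmn x hx => ?_, fun m σ x hx => ?_, fun m hm => ?_, fun x => ⟨s, ?_⟩⟩
  · rw [mem_levelFil] at hx ⊢
    exact fun h => hx (by omega)
  · rw [mem_levelFil] at hx ⊢
    exact fun h => by rw [hx h, map_zero]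
  · exact eq_bot_iff.2 fun x hx => mem_levelFil.1 hx (by omega)
  · exact mem_levelFil.2 fun h => absurd h (lt_irrefl _)

/-! ### Characters of a finite abelian group of exponent dividing `p - 1` -/

section Characters

variable (p : ℕ) [Fact p.Prime]

instance : NeZero (p - 1) := ⟨by have := (Fact.out : p.Prime).two_le; omega⟩

instance : HasEnoughRootsOfUnity (ZMod p) (p - 1) :=
  HasEnoughRootsOfUnity.of_card_le <| by
    have h : rootsOfUnity (p - 1) (ZMod p) = ⊤ :=
      eq_top_iff.2 fun u _ => ZMod.units_pow_card_sub_one_eq_one p u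
    rw [h, Subgroup.card_top, Nat.card_eq_fintype_card, ZMod.card_units]

variable {p}
variable {G : Type*} [CommGroup G]

theorem hasEnoughRootsOfUnity_exponent (hG : ∀ σ : G, σ ^ (p - 1) = 1) :
    HasEnoughRootsOfUnity (ZMod p) (Monoid.exponent G) :=
  HasEnoughRootsOfUnity.of_dvd _ (Monoid.exponent_dvd_of_forall_pow_eq_one hG)

variable [Finite G]

theorem finite_characters (hG : ∀ σ : G, σ ^ (p - 1) = 1) : Finite (G →* (ZMod p)ˣ) :=
  have := hasEnoughRootsOfUnity_exponent hG
  inferInstance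

theorem card_characters (hG : ∀ σ : G, σ ^ (p - 1) = 1) :
    Nat.card (G →* (ZMod p)ˣ) = Nat.card G :=
  have := hasEnoughRootsOfUnity_exponent hG
  CommGroup.card_monoidHom_of_hasEnoughRootsOfUnity G (ZMod p)

theorem sum_characters_eq_zero [Fintype (G →* (ZMod p)ˣ)] (hG : ∀ σ : G, σ ^ (p - 1) = 1)
    {R : Type*} [CommRing R] [IsDomain R] (t : (ZMod p)ˣ →* R) (ht : Function.Injective t)
    {σ : G} (hσ : σ ≠ 1) : ∑ χ : G →* (ZMod p)ˣ, t (χ σ) = 0 := by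
  have := hasEnoughRootsOfUnity_exponent hG
  obtain ⟨ψ, hψ⟩ := CommGroup.exists_apply_ne_one_of_hasEnoughRootsOfUnity G (ZMod p) hσ
  refine sum_hom_units_eq_zero (t.comp (MonoidHom.eval σ)) fun h => hψ (ht ?_)
  rw [map_one]
  exact DFunLike.congr_fun h ψ

/-- The decomposition `|G| x = ∑_χ ∑_σ χ(σ)⁻¹ σ(x)` of an element into eigenvectors. -/
theorem sum_eigenprojections [Fintype (G →* (ZMod p)ˣ)] [Fintype G]
    (hG : ∀ σ : G, σ ^ (p - 1) = 1)
    {R : Type*} [CommRing R] [IsDomain R] (t : (ZMod p)ˣ →* R) (ht : Function.Injective t)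
    {V : Type*} [AddCommGroup V] [Module R V] (f : G → V) :
    ∑ χ : G →* (ZMod p)ˣ, ∑ σ, t (χ σ⁻¹) • f σ = (Nat.card G : R) • f 1 := by
  rw [Finset.sum_comm, Finset.sum_eq_single 1]
  · simp only [inv_one, map_one, one_smul, Finset.sum_const, Finset.card_univ]
    rw [← Nat.card_eq_fintype_card, card_characters hG, Nat.cast_smul_eq_nsmul]
  · intro σ _ hσ
    rw [← Finset.sum_smul, sum_characters_eq_zero hG t ht (inv_ne_one.2 hσ), zero_smul]
  · simp

/-- The embedding of `𝔽_pˣ` into a ring of characteristic `p`. -/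
def unitsCast (p : ℕ) (k : Type*) [CommRing k] [CharP k p] : (ZMod p)ˣ →* k :=
  (ZMod.castHom (dvd_refl p) k : ZMod p →* k).comp (Units.coeHom (ZMod p))

theorem unitsCast_apply (k : Type*) [CommRing k] [CharP k p] (c : (ZMod p)ˣ) :
    unitsCast p k c = ZMod.castHom (dvd_refl p) k (c : ZMod p) := rfl

theorem unitsCast_injective (k : Type*) [Field k] [CharP k p] :
    Function.Injective (unitsCast p k) := fun _ _ h =>
  Units.ext ((ZMod.castHom (dvd_refl p) k).injective h)

theorem unitsCast_ne_zero (k : Type*) [Field k] [CharP k p] (c : (ZMod p)ˣ) :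
    unitsCast p k c ≠ 0 := by
  rw [unitsCast_apply, Ne, map_eq_zero]
  exact c.ne_zero

/-- A representation of a finite abelian group `G` of exponent dividing `p - 1` over a field of
characteristic `p` is free of rank one if each character of `G` occurs in it exactly once: the sum
of eigenvectors, one for each character, is a generator. -/
theorem nonempty_asModule_equiv (hG : ∀ σ : G, σ ^ (p - 1) = 1) (hcard : ¬ p ∣ Nat.card G)
    {k : Type*} [Field k] [CharP k p] {V : Type*} [AddCommGroup V] [Module k V]
    (ρ : Representation k G V)
    (h : ∀ χ, Module.finrank k (eigenspace p ρ χ) = 1) :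
    Nonempty (ρ.asModule ≃ₗ[MonoidAlgebra k G] MonoidAlgebra k G) := by
  classical
  have := finite_characters hG
  have := Fintype.ofFinite (G →* (ZMod p)ˣ)
  have := Fintype.ofFinite G
  set t := unitsCast p k with htdef
  have ht : Function.Injective t := unitsCast_injective k
  have hN : (Nat.card G : k) ≠ 0 := fun h0 => hcard ((CharP.cast_eq_zero_iff k p _).1 h0)
  have hv : ∀ χ : G →* (ZMod p)ˣ, ∃ v : V, v ≠ 0 ∧ (∀ σ, ρ σ v = t (χ σ) • v) ∧
      ∀ w, (∀ σ, ρ σ w = t (χ σ) • w) → ∃ c : k, w = c • v := by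
    intro χ
    obtain ⟨v, hv0, hv⟩ := finrank_eq_one_iff'.1 (h χ)
    refine ⟨v, fun h0 => hv0 (Subtype.ext h0), v.2, fun w hw => ?_⟩
    obtain ⟨c, hc⟩ := hv ⟨w, hw⟩
    exact ⟨c, (congrArg Subtype.val hc).symm⟩
  choose v hv0 hv hvspan using hv
  -- the projections onto the eigenspaces, multiplied by the order of the group
  let E : (G →* (ZMod p)ˣ) → V →ₗ[k] V := fun χ => ∑ σ, t (χ σ⁻¹) • ρ σ
  have hE : ∀ χ x, E χ x = ∑ σ, t (χ σ⁻¹) • ρ σ x := fun χ x => by simp [E]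
  -- `E χ` maps into the `χ`-eigenspace and is equivariant
  have hEeig : ∀ χ x τ, ρ τ (E χ x) = t (χ τ) • E χ x := by
    intro χ x τ
    simp only [hE, map_sum, Finset.smul_sum]
    rw [← Equiv.sum_comp (Equiv.mulLeft τ⁻¹)]
    refine Finset.sum_congr rfl fun σ _ => ?_
    rw [map_smul, smul_smul, Equiv.coe_mulLeft, ← Module.End.mul_apply, ← map_mul, ← map_mul,
      ← map_mul, mul_inv_cancel_left]
    congr 3
    simp [mul_comm]
  have hEcomm : ∀ χ x τ, E χ (ρ τ x) = t (χ τ) • E χ x := by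
    intro χ x τ
    rw [← hEeig]
    simp only [hE, map_sum, map_smul]
    refine Finset.sum_congr rfl fun σ _ => ?_
    rw [← Module.End.mul_apply, ← Module.End.mul_apply, ← map_mul, ← map_mul, mul_comm]
  have hEv : ∀ χ χ', E χ (v χ') = if χ = χ' then (Nat.card G : k) • v χ else 0 := by
    intro χ χ'
    have h1 : E χ (v χ') = (∑ σ, t ((χ⁻¹ * χ') σ)) • v χ' := by
      simp only [hE, hv, smul_smul, Finset.sum_smul]
      refine Finset.sum_congr rfl fun σ _ => ?_
      rw [← map_mul, map_inv, MonoidHom.mul_apply, MonoidHom.inv_apply]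
    rw [h1]
    split_ifs with heq
    · subst heq
      congr 1
      simp
    · have h2 := sum_hom_units_eq_zero (t.comp (χ⁻¹ * χ'))
      simp only [MonoidHom.comp_apply] at h2
      rw [h2, zero_smul]
      intro h1
      refine heq (inv_mul_eq_one.1 (MonoidHom.ext fun σ => ht ?_))
      rw [MonoidHom.one_apply, map_one]
      exact DFunLike.congr_fun h1 σ
  have hEsum : ∀ χ, E χ (∑ χ', v χ') = (Nat.card G : k) • v χ := by
    intro χ
    rw [map_sum]
    simp [hEv]
  let w : ρ.asModule := ρ.asModuleEquiv.symm (∑ χ, v χ)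
  let f : MonoidAlgebra k G →ₗ[MonoidAlgebra k G] ρ.asModule :=
    LinearMap.toSpanSingleton (MonoidAlgebra k G) ρ.asModule w
  have hf : ∀ a : MonoidAlgebra k G, ρ.asModuleEquiv (f a) = ∑ σ, a.coeff σ • ρ σ (∑ χ, v χ) := by
    intro a
    rw [LinearMap.toSpanSingleton_apply, Representation.asModuleEquiv_map_smul,
      Representation.asAlgebraHom_def, MonoidAlgebra.lift_apply, Finsupp.sum_fintype _ _ (by simp),
      LinearMap.sum_apply]
    exact Finset.sum_congr rfl fun σ _ => by simp only [w, LinearMap.smul_apply, LinearEquiv.apply_symm_apply]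
  have hbij : Function.Bijective f := by
    constructor
    · -- applying `E χ` to `a (∑ v χ) = 0` shows that `∑ a_σ χ(σ) = 0` for every `χ`; Fourier
      -- inversion on `G` then gives `a = 0`
      refine (injective_iff_map_eq_zero f).2 fun a ha => ?_
      have h1 : ∀ χ : G →* (ZMod p)ˣ, ∑ σ, a.coeff σ * t (χ σ) = 0 := by
        intro χ
        have h2 : E χ (ρ.asModuleEquiv (f a)) =
            ((∑ σ, a.coeff σ * t (χ σ)) * (Nat.card G : k)) • v χ := by
          rw [hf, mul_smul, ← hEsum, map_sum, Finset.sum_smul]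
          refine Finset.sum_congr rfl fun σ _ => ?_
          rw [map_smul, hEcomm, smul_smul]
        rw [ha] at h2
        rw [map_zero, map_zero, eq_comm, smul_eq_zero, mul_eq_zero] at h2
        exact (h2.resolve_right (hv0 χ)).resolve_right hN
      refine MonoidAlgebra.ext (Finsupp.ext fun τ => ?_)
      have h5 := sum_eigenprojections hG t ht fun σ => a.coeff (σ⁻¹ * τ)
      have h6 : ∀ χ : G →* (ZMod p)ˣ, ∑ σ, t (χ σ⁻¹) • a.coeff (σ⁻¹ * τ) = 0 := by
        intro χ
        have h7 : t (χ τ⁻¹) * ∑ σ, a.coeff σ * t (χ σ) = 0 := by rw [h1, mul_zero]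
        rw [← h7, Finset.mul_sum, ← Equiv.sum_comp ((Equiv.inv G).trans (Equiv.mulRight τ))]
        refine Finset.sum_congr rfl fun σ _ => ?_
        simp only [Equiv.trans_apply, Equiv.inv_apply, Equiv.coe_mulRight, smul_eq_mul, map_mul,
          map_inv]
        rw [show (σ⁻¹ * τ)⁻¹ * τ = σ by rw [mul_inv, inv_inv, inv_mul_cancel_right]]
        rw [mul_inv, inv_inv]
        ring
      rw [Finset.sum_congr rfl fun χ _ => h6 χ, Finset.sum_const_zero, eq_comm, smul_eq_mul,
        inv_one, one_mul] at h5
      simpa using (mul_eq_zero.1 h5).resolve_left hN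
    · -- the range contains each `v χ`, a multiple of `E χ (∑ v χ)`, hence each eigenspace
      rw [← LinearMap.range_eq_top, eq_top_iff]
      intro x _
      have hsmul : ∀ (c : k) (y : V), ρ.asModuleEquiv.symm y ∈ LinearMap.range f →
          ρ.asModuleEquiv.symm (c • y) ∈ LinearMap.range f := by
        rintro c y ⟨a, ha⟩
        refine ⟨c • a, ρ.asModuleEquiv.injective ?_⟩
        have h1 := hf (c • a)
        have h2 := hf a
        rw [ha, LinearEquiv.apply_symm_apply] at h2
        rw [h1, LinearEquiv.apply_symm_apply, h2, Finset.smul_sum]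
        simp [smul_smul]
      have hvmem : ∀ χ, ρ.asModuleEquiv.symm (v χ) ∈ LinearMap.range f := by
        intro χ
        have h1 : ρ.asModuleEquiv.symm ((Nat.card G : k) • v χ) ∈ LinearMap.range f := by
          refine ⟨MonoidAlgebra.ofCoeff (Finsupp.equivFunOnFinite.symm fun σ => t (χ σ⁻¹)), ?_⟩
          apply ρ.asModuleEquiv.injective
          rw [hf, LinearEquiv.apply_symm_apply, ← hEsum, hE]
          rfl
        have h2 := hsmul (Nat.card G : k)⁻¹ _ h1
        rwa [smul_smul, inv_mul_cancel₀ hN, one_smul] at h2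
      have h1 := sum_eigenprojections hG t ht fun σ => ρ σ (ρ.asModuleEquiv x)
      have h2 : ρ.asModuleEquiv.symm ((Nat.card G : k) • ρ.asModuleEquiv x) ∈
          LinearMap.range f := by
        rw [map_one, Module.End.one_apply] at h1
        rw [← h1, map_sum]
        refine Submodule.sum_mem _ fun χ _ => ?_
        obtain ⟨c, hc⟩ := hvspan χ _ (hEeig χ (ρ.asModuleEquiv x))
        rw [← hE, hc]
        exact hsmul _ _ (hvmem χ)
      have h3 := hsmul (Nat.card G : k)⁻¹ _ h2
      rwa [smul_smul, inv_mul_cancel₀ hN, one_smul, LinearEquiv.symm_apply_apply] at h3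
  exact ⟨(LinearEquiv.ofBijective f hbij).symm⟩

end Characters

/-! ### Arithmetic of a local field -/

section LocalField

variable {K : Type*} [Field K] [ValuativeRel K] [TopologicalSpace K] [IsNonarchimedeanLocalField K]

theorem exists_normVal_eq {x : K} (hx : x ≠ 0) : ∃ n : ℤ, normVal K x = exp (-n) :=
  ⟨-log (normVal K x), by rw [neg_neg, exp_log (by simpa using hx)]⟩

theorem ne_zero_of_normVal_eq {x : K} {n : ℤ} (hx : normVal K x = exp n) : x ≠ 0 := by
  rintro rfl
  rw [map_zero] at hx
  exact exp_ne_zero hx.symm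

theorem normVal_lt_iff {x : K} {n : ℤ} : normVal K x < exp (-n) ↔ x ∈ primePow K (n + 1) := by
  rw [mem_primePow]
  by_cases hx : x = 0
  · simp [hx]
  obtain ⟨m, hm⟩ := exists_normVal_eq hx
  rw [hm, exp_lt_exp, exp_le_exp]
  omega

theorem normVal_eq_iff {x : K} {n : ℤ} :
    normVal K x = exp (-n) ↔ x ∈ primePow K n ∧ x ∉ primePow K (n + 1) := by
  rw [← normVal_lt_iff, mem_primePow, not_lt, le_antisymm_iff]

theorem primePow_anti {m n : ℤ} (h : m ≤ n) {x : K} (hx : x ∈ primePow K n) :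
    x ∈ primePow K m := by
  rw [mem_primePow] at hx ⊢
  exact hx.trans (exp_le_exp.2 (by omega))

theorem mul_mem_primePow {m n : ℤ} {x y : K} (hx : x ∈ primePow K m) (hy : y ∈ primePow K n) :
    x * y ∈ primePow K (m + n) := by
  rw [mem_primePow] at hx hy ⊢
  rw [map_mul, neg_add, exp_add]
  exact mul_le_mul' hx hy

theorem mem_primePow_of_normVal_eq {x : K} {n : ℤ} (hx : normVal K x = exp (-n)) :
    x ∈ primePow K n := (mem_primePow K).2 hx.le

theorem inv_mem_primePow {x : K} {n : ℤ} (hx : normVal K x = exp (-n)) :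
    x⁻¹ ∈ primePow K (-n) := by
  rw [mem_primePow, map_inv₀, hx, ← exp_neg]

theorem mem_primePow_zero {x : K} : x ∈ primePow K 0 ↔ normVal K x ≤ 1 := by
  rw [mem_primePow, neg_zero, exp_zero]

theorem one_mem_primePow : (1 : K) ∈ primePow K 0 := by
  rw [mem_primePow_zero, map_one]

theorem natCast_mem_primePow (n : ℕ) : (n : K) ∈ primePow K 0 := by
  induction n with
  | zero => simp
  | succ n ih =>
    rw [Nat.cast_succ]
    exact add_mem ih one_mem_primePow

theorem pow_mem_primePow {m : ℤ} {x : K} (hx : x ∈ primePow K m) (n : ℕ) :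
    x ^ n ∈ primePow K (n * m) := by
  induction n with
  | zero => simpa using one_mem_primePow
  | succ n ih =>
    rw [pow_succ, Nat.cast_succ, add_mul, one_mul]
    exact mul_mem_primePow ih hx

theorem normVal_zpow {x : K} {m : ℤ} (hx : normVal K x = exp (-m)) (n : ℤ) :
    normVal K (x ^ n) = exp (-(n * m)) := by
  rw [map_zpow₀, hx, ← exp_zsmul, smul_eq_mul, mul_neg]

theorem normVal_pow {x : K} {m : ℤ} (hx : normVal K x = exp (-m)) (n : ℕ) :
    normVal K (x ^ n) = exp (-(n * m)) := by
  have := normVal_zpow hx n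
  rwa [zpow_natCast] at this

theorem normVal_mul {x y : K} {m n : ℤ} (hx : normVal K x = exp (-m)) (hy : normVal K y = exp (-n)) :
    normVal K (x * y) = exp (-(m + n)) := by
  rw [map_mul, hx, hy, neg_add, exp_add]

theorem normVal_div {x y : K} {m n : ℤ} (hx : normVal K x = exp (-m)) (hy : normVal K y = exp (-n)) :
    normVal K (x / y) = exp (-(m - n)) := by
  rw [map_div₀, hx, hy, neg_sub, div_eq_mul_inv, ← exp_neg, ← exp_add]
  congr 1
  ring

variable (K) in
theorem exists_uniformizer : ∃ π : K, normVal K π = exp (-1) := normVal_surjective K _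

theorem exists_normVal_eq_exp (n : ℤ) : ∃ x : K, normVal K x = exp (-n) := normVal_surjective K _

theorem normVal_eq_one_of_pow_eq_one {y : K} {m : ℕ} (hm : m ≠ 0) (hy : y ^ m = 1) :
    normVal K y = 1 := by
  have h : normVal K y ^ m = 1 := by rw [← map_pow, hy, map_one]
  rw [← one_pow m] at h
  exact (pow_left_inj₀ zero_le zero_le hm).1 h

theorem mem_integer {x : K} (hx : x ∈ primePow K 0) : x ∈ 𝒪[K] :=
  (normVal_le_one_iff K x).1 (mem_primePow_zero.1 hx)

theorem coe_mem_primePow (x : 𝒪[K]) : (x : K) ∈ primePow K 0 :=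
  mem_primePow_zero.2 ((normVal_le_one_iff K x).2 x.2)

open Classical in
/-- The reduction of an element of `𝒪[K]` modulo `𝔭`; it is extended by `0` to `K`. -/
noncomputable def red (x : K) : 𝓀[K] :=
  if h : x ∈ primePow K 0 then IsLocalRing.residue 𝒪[K] ⟨x, mem_integer h⟩ else 0

theorem red_of_mem {x : K} (h : x ∈ primePow K 0) :
    red x = IsLocalRing.residue 𝒪[K] ⟨x, mem_integer h⟩ := dif_pos h

theorem red_coe (x : 𝒪[K]) : red (x : K) = IsLocalRing.residue 𝒪[K] x :=
  red_of_mem (coe_mem_primePow x)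

theorem red_add {x y : K} (hx : x ∈ primePow K 0) (hy : y ∈ primePow K 0) :
    red (x + y) = red x + red y := by
  rw [red_of_mem hx, red_of_mem hy, red_of_mem (add_mem hx hy), ← map_add]
  rfl

theorem red_sub {x y : K} (hx : x ∈ primePow K 0) (hy : y ∈ primePow K 0) :
    red (x - y) = red x - red y := by
  rw [red_of_mem hx, red_of_mem hy, red_of_mem (sub_mem hx hy), ← map_sub]
  rfl

theorem red_mul {x y : K} (hx : x ∈ primePow K 0) (hy : y ∈ primePow K 0) :
    red (x * y) = red x * red y := by
  have hxy : x * y ∈ primePow K 0 := by simpa using mul_mem_primePow hx hy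
  rw [red_of_mem hx, red_of_mem hy, red_of_mem hxy, ← map_mul]
  rfl

variable (K) in
theorem red_one : red (1 : K) = 1 := by
  rw [← map_one (IsLocalRing.residue 𝒪[K]), ← red_coe]
  rfl

theorem red_pow {x : K} (hx : x ∈ primePow K 0) (n : ℕ) : red (x ^ n) = red x ^ n := by
  rw [red_of_mem hx, ← map_pow, ← red_coe]
  rfl

variable (K) in
theorem red_natCast (n : ℕ) : red (n : K) = n := by
  rw [← map_natCast (IsLocalRing.residue 𝒪[K]), ← red_coe]
  norm_cast

theorem red_eq_zero_iff {x : K} (hx : x ∈ primePow K 0) : red x = 0 ↔ x ∈ primePow K 1 := by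
  rw [red_of_mem hx, IsLocalRing.residue_eq_zero_iff, IsLocalRing.mem_maximalIdeal,
    mem_nonunits_iff, (Valuation.integer.integers (valuation K)).isUnit_iff_valuation_eq_one,
    show (1 : ℤ) = 0 + 1 from rfl, ← normVal_lt_iff, neg_zero, exp_zero, normVal_lt_one_iff]
  exact ⟨fun h => lt_of_le_of_ne (mem_integer hx) h, fun h => h.ne⟩

theorem red_eq_red_iff {x y : K} (hx : x ∈ primePow K 0) (hy : y ∈ primePow K 0) :
    red x = red y ↔ x - y ∈ primePow K 1 := by
  rw [← red_eq_zero_iff (sub_mem hx hy), red_sub hx hy, sub_eq_zero]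

theorem exists_red_eq (r : 𝓀[K]) : ∃ x ∈ primePow K 0, red x = r := by
  obtain ⟨x, rfl⟩ := IsLocalRing.residue_surjective r
  exact ⟨x, coe_mem_primePow x, red_coe x⟩

theorem normVal_eq_one_iff_red {x : K} (hx : x ∈ primePow K 0) :
    normVal K x = 1 ↔ red x ≠ 0 := by
  rw [Ne, red_eq_zero_iff hx, show (1 : ℤ) = 0 + 1 from rfl, ← exp_zero, ← neg_zero,
    normVal_eq_iff]
  exact ⟨fun h => h.2, fun h => ⟨hx, h⟩⟩

theorem mem_primePow_of_normVal_eq_one {x : K} (hx : normVal K x = 1) : x ∈ primePow K 0 :=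
  mem_primePow_zero.2 hx.le

theorem red_ne_zero_of_normVal_eq_one {x : K} (hx : normVal K x = 1) : red x ≠ 0 :=
  (normVal_eq_one_iff_red (mem_primePow_of_normVal_eq_one hx)).1 hx

open Polynomial in
/-- Hensel's lemma. -/
theorem exists_root_of_residue (f : 𝒪[K][X]) (hf : f.Monic) (a₀ : 𝒪[K])
    (h : IsLocalRing.residue 𝒪[K] (f.eval a₀) = 0)
    (h' : IsLocalRing.residue 𝒪[K] (f.derivative.eval a₀) ≠ 0) :
    ∃ a : 𝒪[K], f.eval a = 0 ∧ IsLocalRing.residue 𝒪[K] a = IsLocalRing.residue 𝒪[K] a₀ := by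
  let := IsTopologicalAddGroup.rightUniformSpace K
  have := isUniformAddGroup_of_addCommGroup (G := K)
  obtain ⟨a, ha, ha'⟩ := HenselianRing.is_henselian (I := 𝓂[K]) f hf a₀
    ((IsLocalRing.residue_eq_zero_iff _).1 h) (isUnit_iff_ne_zero.2 h' :
      IsUnit (IsLocalRing.residue 𝒪[K] (f.derivative.eval a₀)))
  refine ⟨a, ha, ?_⟩
  rw [← sub_eq_zero, ← map_sub]
  exact (IsLocalRing.residue_eq_zero_iff _).2 ha'

open Polynomial in
theorem exists_pow_eq_of_red {x y : K} (hx : x ∈ primePow K 0) (hy : normVal K y = 1) {m : ℕ}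
    (hm : (m : 𝓀[K]) ≠ 0) (h : red x = red y ^ m) : ∃ z : K, z ^ m = x ∧ red z = red y := by
  have hm0 : m ≠ 0 := by rintro rfl; simp at hm
  have hy0 := mem_primePow_of_normVal_eq_one hy
  obtain ⟨a, ha, ha'⟩ := exists_root_of_residue (X ^ m - C ⟨x, mem_integer hx⟩)
    (monic_X_pow_sub_C _ hm0) ⟨y, mem_integer hy0⟩
    (by
      simp only [eval_sub, eval_pow, eval_X, eval_C, map_sub, map_pow]
      rw [← red_of_mem hx, ← red_of_mem hy0, h, sub_self])
    (by
      simp only [derivative_sub, derivative_X_pow, derivative_C, sub_zero, eval_mul, eval_pow,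
        eval_X, map_mul, map_natCast, eval_natCast, map_pow, ← red_of_mem hy0]
      exact mul_ne_zero hm (pow_ne_zero _ (red_ne_zero_of_normVal_eq_one hy)))
  refine ⟨a, ?_, by rw [red_coe, ha', red_of_mem hy0]⟩
  simp only [eval_sub, eval_pow, eval_X, eval_C, sub_eq_zero] at ha
  simpa using congrArg Subtype.val ha

theorem exists_pow_eq_of_sub_one_mem {x : K} (hx : x - 1 ∈ primePow K 1) {m : ℕ}
    (hm : (m : 𝓀[K]) ≠ 0) : ∃ z : K, z ^ m = x := by
  have hx0 : x ∈ primePow K 0 := by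
    simpa using add_mem (primePow_anti zero_le_one hx) one_mem_primePow
  obtain ⟨z, hz, -⟩ := exists_pow_eq_of_red hx0 (map_one (normVal K)) hm
    (by rw [red_one, one_pow, ← red_one K, red_eq_red_iff hx0 one_mem_primePow]; exact hx)
  exact ⟨z, hz⟩

/-- Roots of unity of order prime to the residue characteristic are determined by their
reductions. -/
theorem eq_one_of_pow_eq_one {y : K} {m : ℕ} (hm : (m : 𝓀[K]) ≠ 0) (hy : y ^ m = 1)
    (h : red y = 1) : y = 1 := by
  have hm0 : m ≠ 0 := by rintro rfl; simp at hm
  have hy0 := mem_primePow_of_normVal_eq_one (normVal_eq_one_of_pow_eq_one hm0 hy)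
  have h1 : (y - 1) * ∑ i ∈ Finset.range m, y ^ i = 0 := by
    rw [mul_geom_sum, hy, sub_self]
  refine sub_eq_zero.1 ((mul_eq_zero.1 h1).resolve_right fun h2 => hm ?_)
  have h3 : ∀ s : ℕ, (∑ i ∈ Finset.range s, y ^ i) ∈ primePow K 0 ∧
      red (∑ i ∈ Finset.range s, y ^ i) = s := by
    intro s
    induction s with
    | zero => exact ⟨by simp, by simpa using red_natCast K 0⟩
    | succ s ih =>
      have h4 : y ^ s ∈ primePow K 0 := by simpa using pow_mem_primePow hy0 s
      rw [Finset.sum_range_succ]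
      refine ⟨add_mem ih.1 h4, ?_⟩
      rw [red_add ih.1 h4, ih.2, red_pow hy0, h, one_pow, Nat.cast_succ]
  rw [← (h3 m).2, h2]
  simpa using red_natCast K 0

theorem eq_of_pow_eq_one {y z : K} {m : ℕ} (hm : (m : 𝓀[K]) ≠ 0) (hy : y ^ m = 1)
    (hz : z ^ m = 1) (h : red y = red z) : y = z := by
  have hm0 : m ≠ 0 := by rintro rfl; simp at hm
  have hy1 := normVal_eq_one_of_pow_eq_one hm0 hy
  have hz1 := normVal_eq_one_of_pow_eq_one hm0 hz
  have hz0 : z ≠ 0 := by rintro rfl; simp at hz1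
  have hzi : normVal K z⁻¹ = 1 := by rw [map_inv₀, hz1, inv_one]
  have h1 : y * z⁻¹ = 1 := by
    refine eq_one_of_pow_eq_one hm (by rw [mul_pow, inv_pow, hy, hz, inv_one, one_mul]) ?_
    rw [red_mul (mem_primePow_of_normVal_eq_one hy1) (mem_primePow_of_normVal_eq_one hzi), h,
      ← red_mul (mem_primePow_of_normVal_eq_one hz1) (mem_primePow_of_normVal_eq_one hzi),
      mul_inv_cancel₀ hz0, red_one]
  field_simp at h1
  exact h1

variable (K) in
theorem natCast_card_residueField_sub_one_ne_zero :
    ((Nat.card 𝓀[K] - 1 : ℕ) : 𝓀[K]) ≠ 0 := by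
  have := Fintype.ofFinite 𝓀[K]
  rw [Nat.card_eq_fintype_card, Nat.cast_sub Fintype.card_pos, Nat.cast_card_eq_zero]
  simp

/-- Every nonzero element of the residue field lifts to a root of unity of order prime to the
residue characteristic. -/
theorem exists_teichmuller {r : 𝓀[K]} (hr : r ≠ 0) :
    ∃ y : K, y ^ (Nat.card 𝓀[K] - 1) = 1 ∧ red y = r := by
  have := Fintype.ofFinite 𝓀[K]
  obtain ⟨x, hx, rfl⟩ := exists_red_eq r
  refine exists_pow_eq_of_red one_mem_primePow ((normVal_eq_one_iff_red hx).2 hr)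
    (natCast_card_residueField_sub_one_ne_zero K) ?_
  rw [red_one, Nat.card_eq_fintype_card, FiniteField.pow_card_sub_one_eq_one _ hr]

section Teichmuller

variable (p : ℕ) [Fact p.Prime] [CharP 𝓀[K] p]

variable (K) in
theorem natCast_sub_one_ne_zero : ((p - 1 : ℕ) : 𝓀[K]) ≠ 0 := by
  rw [Nat.cast_sub (Fact.out : p.Prime).one_le, CharP.cast_eq_zero]
  simp

theorem exists_unitsCast_eq {r : 𝓀[K]} (hr : r ^ (p - 1) = 1) : ∃ c, unitsCast p 𝓀[K] c = r := by
  have hr0 : r ≠ 0 := by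
    rintro rfl
    rw [zero_pow (NeZero.ne _)] at hr
    exact zero_ne_one hr
  have h1 : r ∈ (⊥ : Subfield 𝓀[K]) := by
    rw [Subfield.mem_bot_iff_pow_eq_self 𝓀[K] p, ← Nat.sub_add_cancel (Fact.out : p.Prime).one_le, pow_succ, hr, one_mul]
  rw [← ZMod.fieldRange_castHom_eq_bot p] at h1
  obtain ⟨c, rfl⟩ := h1
  have hc : c ≠ 0 := by rintro rfl; simp at hr0
  exact ⟨Units.mk0 c hc, rfl⟩

variable (K) in
theorem exists_teichmullerUnits (c : (ZMod p)ˣ) :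
    ∃ y : K, y ^ (p - 1) = 1 ∧ red y = unitsCast p 𝓀[K] c := by
  obtain ⟨x, hx, hxc⟩ := exists_red_eq (unitsCast p 𝓀[K] c)
  have hx1 : normVal K x = 1 := (normVal_eq_one_iff_red hx).2 (by
    rw [hxc]; exact unitsCast_ne_zero _ _)
  rw [← hxc]
  refine exists_pow_eq_of_red one_mem_primePow hx1 (natCast_sub_one_ne_zero K p) ?_
  rw [red_one, hxc, ← map_pow, ZMod.units_pow_card_sub_one_eq_one, map_one]

variable (K) in
/-- The embedding of `𝔽_pˣ` into `K` as the group of `(p - 1)`-th roots of unity. -/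
noncomputable def teichmuller : (ZMod p)ˣ →* K where
  toFun c := (exists_teichmullerUnits K p c).choose
  map_one' := eq_one_of_pow_eq_one (natCast_sub_one_ne_zero K p)
    (exists_teichmullerUnits K p 1).choose_spec.1
    ((exists_teichmullerUnits K p 1).choose_spec.2.trans (map_one _))
  map_mul' c d := by
    obtain ⟨hc, hc'⟩ := (exists_teichmullerUnits K p c).choose_spec
    obtain ⟨hd, hd'⟩ := (exists_teichmullerUnits K p d).choose_spec
    obtain ⟨h, h'⟩ := (exists_teichmullerUnits K p (c * d)).choose_spec
    refine eq_of_pow_eq_one (natCast_sub_one_ne_zero K p) h (by rw [mul_pow, hc, hd, one_mul]) ?_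
    have hn : ∀ {y : K}, y ^ (p - 1) = 1 → y ∈ primePow K 0 := fun hy =>
      mem_primePow_of_normVal_eq_one (normVal_eq_one_of_pow_eq_one (NeZero.ne _) hy)
    rw [h', red_mul (hn hc) (hn hd), hc', hd', map_mul]

theorem teichmuller_pow (c : (ZMod p)ˣ) : teichmuller K p c ^ (p - 1) = 1 :=
  (exists_teichmullerUnits K p c).choose_spec.1

theorem red_teichmuller (c : (ZMod p)ˣ) : red (teichmuller K p c) = unitsCast p 𝓀[K] c :=
  (exists_teichmullerUnits K p c).choose_spec.2

theorem normVal_teichmuller (c : (ZMod p)ˣ) : normVal K (teichmuller K p c) = 1 :=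
  normVal_eq_one_of_pow_eq_one (NeZero.ne _) (teichmuller_pow p c)

theorem teichmuller_ne_zero (c : (ZMod p)ˣ) : teichmuller K p c ≠ 0 := by
  intro h
  have := normVal_teichmuller (K := K) p c
  simp [h] at this

theorem teichmuller_injective : Function.Injective (teichmuller K p) := fun c d h =>
  unitsCast_injective 𝓀[K] (by rw [← red_teichmuller, ← red_teichmuller, h])

theorem exists_teichmuller_eq {y : K} (hy : y ^ (p - 1) = 1) : ∃ c, teichmuller K p c = y := by
  have hy0 := mem_primePow_of_normVal_eq_one (normVal_eq_one_of_pow_eq_one (NeZero.ne _) hy)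
  obtain ⟨c, hc⟩ := exists_unitsCast_eq p (r := red y) (by rw [← red_pow hy0, hy, red_one])
  exact ⟨c, eq_of_pow_eq_one (natCast_sub_one_ne_zero K p) (teichmuller_pow p c) hy
    (by rw [red_teichmuller, hc])⟩

omit [Fact p.Prime] in
theorem normVal_natCast_eq_one {m : ℕ} (hm : ¬ p ∣ m) : normVal K (m : K) = 1 := by
  rw [normVal_eq_one_iff_red (natCast_mem_primePow m), red_natCast]
  exact fun h => hm ((CharP.cast_eq_zero_iff _ p m).1 h)

omit [Fact p.Prime] in
theorem natCast_mem_primePow_one : (p : K) ∈ primePow K 1 := by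
  rw [← red_eq_zero_iff (natCast_mem_primePow p), red_natCast, CharP.cast_eq_zero]

/-- The residue field being perfect, elements of valuation divisible by `p` are `p`-th powers to
first order. -/
theorem exists_sub_pow_mem {j : ℤ} {z : K} (hz : z ∈ primePow K (p * j)) :
    ∃ c ∈ primePow K j, z - c ^ p ∈ primePow K (p * j + 1) := by
  obtain ⟨x, hx⟩ := exists_normVal_eq_exp (K := K) j
  have hx0 := ne_zero_of_normVal_eq hx
  have hxp := normVal_pow hx p
  have hw : z * (x ^ p)⁻¹ ∈ primePow K 0 := by
    simpa using mul_mem_primePow hz (inv_mem_primePow hxp)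
  obtain ⟨r, hr⟩ := (frobeniusEquiv 𝓀[K] p).surjective (red (z * (x ^ p)⁻¹))
  obtain ⟨y, hy, rfl⟩ := exists_red_eq r
  rw [coe_frobeniusEquiv, frobenius_def, ← red_pow hy,
    red_eq_red_iff (by simpa using pow_mem_primePow hy p) hw] at hr
  refine ⟨x * y, by simpa using mul_mem_primePow (mem_primePow_of_normVal_eq hx) hy, ?_⟩
  have h1 := mul_mem_primePow (mem_primePow_of_normVal_eq hxp) (neg_mem hr)
  have h2 : x ^ p * -(y ^ p - z * (x ^ p)⁻¹) = z - (x * y) ^ p := by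
    field_simp
    ring
  rwa [h2] at h1

end Teichmuller

end LocalField

/-! ### The extension `K = F(ᵖ⁻¹√F^×)` and its Galois group -/

section Extension

variable {p : ℕ} [Fact p.Prime]
variable {F : Type*} [Field F] [ValuativeRel F] [TopologicalSpace F] [IsNonarchimedeanLocalField F]
variable {K : Type*} [Field K] [ValuativeRel K] [TopologicalSpace K] [IsNonarchimedeanLocalField K]
variable [Algebra F K] [ValuativeExtension F K]

variable (F K p) in
omit [Fact p.Prime] in
theorem charP_residueField [CharP 𝓀[F] p] : CharP 𝓀[K] p :=
  charP_of_injective_algebraMap (algebraMap 𝓀[F] 𝓀[K]).injective p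

theorem normVal_algebraMap_le_one_iff (a : F) : normVal K (algebraMap F K a) ≤ 1 ↔ normVal F a ≤ 1 := by
  rw [normVal_le_one_iff, normVal_le_one_iff]
  exact Valuation.HasExtension.val_map_le_one_iff (valuation F) (valuation K) a

variable (F K) in
/-- The ramification index `r` of `K` over `F` relates the two normalised valuations. -/
theorem exists_normVal_algebraMap : ∃ r : ℤ, 0 < r ∧ ∀ (a : F) (m : ℤ),
    normVal F a = exp (-m) → normVal K (algebraMap F K a) = exp (-(r * m)) := by
  have hone : ∀ a : F, normVal F a = 1 → normVal K (algebraMap F K a) = 1 := by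
    intro a ha
    have ha0 : a ≠ 0 := by rintro rfl; simp at ha
    refine le_antisymm ((normVal_algebraMap_le_one_iff a).2 ha.le) ?_
    have h := (normVal_algebraMap_le_one_iff (K := K) a⁻¹).2 (by simp [ha])
    rw [map_inv₀, map_inv₀] at h
    exact (inv_le_one₀ (by simp [zero_lt_iff, ha0])).1 h
  obtain ⟨π, hπ⟩ := exists_uniformizer F
  have hπ0 := ne_zero_of_normVal_eq hπ
  obtain ⟨r, hr⟩ := exists_normVal_eq (x := algebraMap F K π) (by simpa using hπ0)
  refine ⟨r, ?_, fun a m ha => ?_⟩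
  · by_contra! hle
    have h := (normVal_algebraMap_le_one_iff (K := K) π⁻¹).1 (by
      rw [map_inv₀, map_inv₀, hr, ← exp_neg, ← exp_zero, exp_le_exp]; omega)
    rw [map_inv₀, hπ, ← exp_neg, ← exp_zero, exp_le_exp] at h
    omega
  · have h1 := hone (a / π ^ m) (by
      rw [normVal_div ha (normVal_zpow hπ m), mul_one, sub_self, neg_zero, exp_zero])
    rw [map_div₀, map_zpow₀, map_div₀, normVal_zpow hr, div_eq_one_iff_eq exp_ne_zero] at h1
    rw [h1, mul_comm]

theorem algebraMap_mem_primePow {a : F} (ha : a ∈ primePow F 0) :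
    algebraMap F K a ∈ primePow K 0 := by
  rw [mem_primePow_zero] at ha ⊢
  exact (normVal_algebraMap_le_one_iff a).2 ha

theorem red_algebraMap {a : F} (ha : a ∈ primePow F 0) :
    red (algebraMap F K a) = algebraMap 𝓀[F] 𝓀[K] (red a) := by
  rw [red_of_mem ha, red_of_mem (algebraMap_mem_primePow ha), IsLocalRing.ResidueField.algebraMap_residue]
  rfl

theorem apply_mem_primePow (σ : Gal(K/F)) {n : ℤ} {x : K} (hx : x ∈ primePow K n) :
    σ x ∈ primePow K n := ringEquiv_mem_primePow (σ : K ≃+* K) hx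

theorem normVal_apply_gal (σ : Gal(K/F)) (x : K) : normVal K (σ x) = normVal K x :=
  normVal_ringEquiv (σ : K ≃+* K) x

theorem red_apply (σ : Gal(K/F)) {x : K} (hx : x ∈ primePow K 0) :
    red (σ x) = residueRep F K σ (red x) := by
  rw [red_of_mem hx, red_of_mem (apply_mem_primePow σ hx)]
  rfl

section Kummer

variable [CharP 𝓀[K] p]

variable (p K) in
theorem exists_isPrimitiveRoot : ∃ ζ : K, IsPrimitiveRoot ζ (p - 1) := by
  obtain ⟨ζ, hζ⟩ := HasEnoughRootsOfUnity.exists_primitiveRoot (ZMod p) (p - 1)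
  have h := hζ.isUnit_unit (NeZero.ne _)
  exact ⟨_, h.map_of_injective (teichmuller_injective (K := K) p)⟩

variable [CharP 𝓀[F] p] (hK : IsAdjoinRoots F K (p - 1))
include hK

theorem exists_pow_eq_uniformizer : ∃ ϖ : K, ∃ π : F, normVal F π = exp (-1) ∧
    ϖ ^ (p - 1) = algebraMap F K π := by
  obtain ⟨π, hπ⟩ := exists_uniformizer F
  obtain ⟨ϖ, hϖ⟩ := hK.exists_root π
  exact ⟨ϖ, π, hπ, hϖ⟩

/-- `K` is generated by a root of a uniformizer and by roots of unity. -/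
theorem exists_finite_adjoin_eq_top : ∃ S : Set K, S.Finite ∧
    (∀ y ∈ S, ∃ m : ℕ, m ≠ 0 ∧ ∃ a : F, y ^ m = algebraMap F K a) ∧
    IntermediateField.adjoin F S = ⊤ := by
  have hn : p - 1 ≠ 0 := NeZero.ne _
  obtain ⟨ϖ, π, hπ, hϖ⟩ := exists_pow_eq_uniformizer hK
  set q := Nat.card 𝓀[F] with hq
  have hq0 : q - 1 ≠ 0 := by
    have := Finite.one_lt_card (α := 𝓀[F])
    omega
  have hN : (p - 1) * (q - 1) ≠ 0 := mul_ne_zero hn hq0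
  have hNF : (((p - 1) * (q - 1) : ℕ) : 𝓀[F]) ≠ 0 := by
    rw [Nat.cast_mul]
    exact mul_ne_zero (natCast_sub_one_ne_zero F p) (natCast_card_residueField_sub_one_ne_zero F)
  have hπ0 := ne_zero_of_normVal_eq hπ
  have hϖ0 : ϖ ≠ 0 := by
    rintro rfl
    rw [zero_pow hn, eq_comm, map_eq_zero] at hϖ
    exact hπ0 hϖ
  have hS : {y : K | y ^ ((p - 1) * (q - 1)) = 1}.Finite := by
    classical
    refine (Polynomial.nthRootsFinset ((p - 1) * (q - 1)) (1 : K)).finite_toSet.subset fun y hy => ?_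
    exact (Polynomial.mem_nthRootsFinset (Nat.pos_of_ne_zero hN) 1).2 hy
  refine ⟨insert ϖ {y : K | y ^ ((p - 1) * (q - 1)) = 1}, hS.insert _, ?_, ?_⟩
  · rintro y (rfl | hy)
    · exact ⟨_, hn, π, hϖ⟩
    · exact ⟨_, hN, 1, by rw [map_one]; exact hy⟩
  rw [eq_top_iff, ← hK.adjoin_eq_top, IntermediateField.adjoin_le_iff]
  rintro y ⟨a, ha⟩
  by_cases ha0 : a = 0
  · rw [ha0, map_zero, pow_eq_zero_iff hn] at ha
    rw [ha]
    exact zero_mem _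
  -- `a = πᵐ b` with a unit `b`, and `b^(q-1)` is a one-unit, hence an `N`-th power
  obtain ⟨m, hm⟩ := exists_normVal_eq ha0
  set b := a / π ^ m with hb
  have hb1 : normVal F b = 1 := by
    rw [hb, normVal_div hm (normVal_zpow hπ m), mul_one, sub_self, neg_zero, exp_zero]
  have hb0 := mem_primePow_of_normVal_eq_one hb1
  have hab : π ^ m * b = a := by
    rw [hb]
    field_simp
  have hbq : b ^ (q - 1) - 1 ∈ primePow F 1 := by
    have := Fintype.ofFinite 𝓀[F]
    have h1 : b ^ (q - 1) ∈ primePow F 0 := by simpa using pow_mem_primePow hb0 (q - 1)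
    rw [← red_eq_red_iff h1 one_mem_primePow, red_one, red_pow hb0, hq, Nat.card_eq_fintype_card,
      FiniteField.pow_card_sub_one_eq_one _ (red_ne_zero_of_normVal_eq_one hb1)]
  obtain ⟨w, hw⟩ := exists_pow_eq_of_sub_one_mem hbq hNF
  have hw0 : algebraMap F K w ≠ 0 := by
    rw [Ne, map_eq_zero]
    rintro rfl
    rw [zero_pow hN, eq_comm, pow_eq_zero_iff hq0] at hw
    rw [hw, map_zero] at hb1
    exact zero_ne_one hb1
  have hy : y / (ϖ ^ m * algebraMap F K w) ∈ IntermediateField.adjoin F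
      (insert ϖ {y : K | y ^ ((p - 1) * (q - 1)) = 1}) := by
    refine IntermediateField.subset_adjoin _ _ (Or.inr ?_)
    have h1 : (ϖ ^ m) ^ (p - 1) = algebraMap F K (π ^ m) := by
      rw [← zpow_natCast, ← zpow_mul, mul_comm, zpow_mul, zpow_natCast, hϖ, map_zpow₀]
    change (_ / _) ^ _ = (1 : K)
    rw [div_pow, mul_pow, ← map_pow _ w, hw, map_pow, pow_mul, pow_mul, ha, h1, ← map_pow,
      ← map_pow, ← map_pow, ← map_mul, ← mul_pow, hab, div_self]
    rw [Ne, map_eq_zero]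
    exact pow_ne_zero _ ha0
  have hϖw : ϖ ^ m * algebraMap F K w ∈ IntermediateField.adjoin F
      (insert ϖ {y : K | y ^ ((p - 1) * (q - 1)) = 1}) :=
    mul_mem (zpow_mem (IntermediateField.subset_adjoin F _ (Set.mem_insert ϖ _)) m)
      (IntermediateField.algebraMap_mem _ _)
  have h2 := mul_mem hy hϖw
  rwa [div_mul_cancel₀ _ (mul_ne_zero (zpow_ne_zero _ hϖ0) hw0)] at h2

open Polynomial in
theorem finiteDimensional_of_isAdjoinRoots : FiniteDimensional F K := by
  obtain ⟨S, hfin, hS, htop⟩ := exists_finite_adjoin_eq_top hK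
  have := hfin.to_subtype
  have h : FiniteDimensional F (IntermediateField.adjoin F S) :=
    IntermediateField.finiteDimensional_adjoin fun y hy => by
      obtain ⟨m, hm, a, ha⟩ := hS y hy
      exact ⟨X ^ m - C a, monic_X_pow_sub_C _ hm, by simp [ha]⟩
  rw [htop] at h
  exact (IntermediateField.topEquiv (F := F) (E := K)).toLinearEquiv.finiteDimensional

open Polynomial in
theorem isGalois_of_isAdjoinRoots : IsGalois F K := by
  have hn : p - 1 ≠ 0 := NeZero.ne _
  have hnF : ((p - 1 : ℕ) : F) ≠ 0 := by
    intro h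
    have := red_natCast F (p - 1)
    rw [h, ← Nat.cast_zero, red_natCast, Nat.cast_zero] at this
    exact natCast_sub_one_ne_zero F p this.symm
  have := finiteDimensional_of_isAdjoinRoots hK
  have hdvd : ∀ (y : K) (a : F), y ^ (p - 1) = algebraMap F K a →
      minpoly F y ∣ X ^ (p - 1) - C a := fun y a h => minpoly.dvd _ _ (by simp [h])
  have hsep : Algebra.IsSeparable F K := by
    have h := (IntermediateField.isSeparable_adjoin_iff_isSeparable F K
      (S := {y : K | ∃ a : F, y ^ (p - 1) = algebraMap F K a})).2 (by
        rintro y ⟨a, ha⟩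
        by_cases ha0 : a = 0
        · rw [ha0, map_zero, pow_eq_zero_iff hn] at ha
          rw [ha]
          rw [← map_zero (algebraMap F K)]
          exact isSeparable_algebraMap _
        · exact (separable_X_pow_sub_C a hnF ha0).of_dvd (hdvd y a ha))
    rw [hK.adjoin_eq_top] at h
    exact AlgEquiv.Algebra.isSeparable (IntermediateField.topEquiv (F := F) (E := K))
  have hnormal : Normal F K := by
    refine ⟨fun x => ?_⟩
    refine IntermediateField.splits_of_mem_adjoin F K
      (S := {y : K | ∃ a : F, y ^ (p - 1) = algebraMap F K a}) ?_
      (by rw [hK.adjoin_eq_top]; trivial)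
    rintro y ⟨a, ha⟩
    refine ⟨Algebra.IsIntegral.isIntegral y, ?_⟩
    obtain ⟨ζ, hζ⟩ := exists_isPrimitiveRoot p K
    refine (X_pow_sub_C_splits_of_isPrimitiveRoot hζ ha).of_dvd (X_pow_sub_C_ne_zero
      (Nat.pos_of_ne_zero hn) _) ?_
    simpa using Polynomial.map_dvd (algebraMap F K) (hdvd y a ha)
  exact {}

omit hK [CharP 𝓀[F] p] in
theorem apply_teichmuller (σ : Gal(K/F)) (c : (ZMod p)ˣ) :
    σ (teichmuller K p c) = teichmuller K p c := by
  have h0 := mem_primePow_of_normVal_eq_one (normVal_teichmuller (K := K) p c)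
  refine eq_of_pow_eq_one (natCast_sub_one_ne_zero K p) (by
    rw [← map_pow, teichmuller_pow, map_one]) (teichmuller_pow p c) ?_
  rw [red_apply σ h0, red_teichmuller, unitsCast_apply]
  rw [ZMod.castHom_apply, ZMod.cast_eq_val]
  exact map_natCast (IsLocalRing.ResidueField.mapEquiv (integerEquiv (σ : K ≃+* K))) _

end Kummer

end Extension

/-! ### Kummer theory and the valuation of a character -/

section KummerTheory

variable {p : ℕ} [Fact p.Prime]
variable {F : Type*} [Field F] [ValuativeRel F] [TopologicalSpace F] [IsNonarchimedeanLocalField F]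
variable {K : Type*} [Field K] [ValuativeRel K] [TopologicalSpace K] [IsNonarchimedeanLocalField K]
variable [Algebra F K] [ValuativeExtension F K] [CharP 𝓀[K] p]

theorem exists_apply_eq_teichmuller_mul (σ : Gal(K/F)) {y : K} {a : F}
    (h : y ^ (p - 1) = algebraMap F K a) : ∃ c, σ y = teichmuller K p c * y := by
  by_cases hy : y = 0
  · exact ⟨1, by rw [hy, map_zero, mul_zero]⟩
  obtain ⟨c, hc⟩ := exists_teichmuller_eq p (y := σ y / y) (by
    rw [div_pow, ← map_pow, h, σ.commutes, ← h, div_self (pow_ne_zero _ hy)])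
  exact ⟨c, by rw [hc, div_mul_cancel₀ _ hy]⟩

/-- The character of `G` by which `G` acts on the class of a `(p - 1)`-th root. -/
theorem exists_character {y : K} (hy : y ≠ 0) {a : F} (h : y ^ (p - 1) = algebraMap F K a) :
    ∃ χ : Gal(K/F) →* (ZMod p)ˣ, ∀ σ, σ y = teichmuller K p (χ σ) * y := by
  choose c hc using fun σ : Gal(K/F) => exists_apply_eq_teichmuller_mul σ h
  refine ⟨MonoidHom.mk' c fun σ τ => teichmuller_injective (K := K) p ?_, hc⟩
  have h1 := hc (σ * τ)
  rw [AlgEquiv.mul_apply, hc, map_mul, apply_teichmuller, hc, ← mul_assoc] at h1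
  rw [map_mul, mul_comm, mul_right_cancel₀ hy h1]

variable [CharP 𝓀[F] p] (hK : IsAdjoinRoots F K (p - 1))
include hK

theorem gal_ext {σ τ : Gal(K/F)} (h : ∀ (y : K) (a : F), y ^ (p - 1) = algebraMap F K a → σ y = τ y) :
    σ = τ := by
  ext x
  have hx : x ∈ IntermediateField.adjoin F {y : K | ∃ a : F, y ^ (p - 1) = algebraMap F K a} := by
    rw [hK.adjoin_eq_top]
    trivial
  induction hx using IntermediateField.adjoin_induction with
  | mem y hy => exact h y hy.choose hy.choose_spec
  | algebraMap a => simp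
  | add x y _ _ hx hy => rw [map_add, map_add, hx, hy]
  | inv x _ hx => rw [map_inv₀, map_inv₀, hx]
  | mul x y _ _ hx hy => rw [map_mul, map_mul, hx, hy]

theorem gal_mul_comm (σ τ : Gal(K/F)) : σ * τ = τ * σ := by
  refine gal_ext hK fun y a h => ?_
  obtain ⟨c, hc⟩ := exists_apply_eq_teichmuller_mul (p := p) σ h
  obtain ⟨d, hd⟩ := exists_apply_eq_teichmuller_mul (p := p) τ h
  rw [AlgEquiv.mul_apply, AlgEquiv.mul_apply, hc, hd, map_mul, map_mul, apply_teichmuller,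
    apply_teichmuller, hc, hd]
  ring

theorem gal_pow_eq_one (σ : Gal(K/F)) : σ ^ (p - 1) = 1 := by
  refine gal_ext hK fun y a h => ?_
  obtain ⟨c, hc⟩ := exists_apply_eq_teichmuller_mul (p := p) σ h
  have h1 : ∀ m : ℕ, (σ ^ m) y = teichmuller K p c ^ m * y := by
    intro m
    induction m with
    | zero => simp
    | succ m ih =>
      rw [pow_succ, AlgEquiv.mul_apply, hc, map_mul, ih, apply_teichmuller]
      ring
  rw [h1, teichmuller_pow, one_mul, AlgEquiv.one_apply]

theorem finite_gal : Finite Gal(K/F) :=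
  have := finiteDimensional_of_isAdjoinRoots hK
  inferInstance

theorem not_dvd_card_gal : ¬ p ∣ Nat.card Gal(K/F) := by
  intro h
  have := finite_gal hK
  obtain ⟨σ, hσ⟩ := exists_prime_orderOf_dvd_card' p h
  have h0 := orderOf_dvd_of_pow_eq_one (gal_pow_eq_one hK σ)
  rw [hσ] at h0
  have h1 := Nat.le_of_dvd (Nat.pos_of_ne_zero (NeZero.ne _)) h0
  have := (Fact.out : p.Prime).pos
  omega

theorem exists_algebraMap_eq {x : K} (hx : ∀ σ : Gal(K/F), σ x = x) : ∃ a : F, algebraMap F K a = x := by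
  have := finiteDimensional_of_isAdjoinRoots hK
  have := isGalois_of_isAdjoinRoots hK
  exact IntermediateField.mem_bot.1 ((IsGalois.mem_bot_iff_fixed x).2 hx)

theorem exists_pow_eq_algebraMap {χ : Gal(K/F) →* (ZMod p)ˣ} {y : K}
    (h : ∀ σ, σ y = teichmuller K p (χ σ) * y) : ∃ a : F, y ^ (p - 1) = algebraMap F K a := by
  obtain ⟨a, ha⟩ := exists_algebraMap_eq hK (x := y ^ (p - 1)) fun σ => by
    rw [map_pow, h, mul_pow, teichmuller_pow, one_mul]
  exact ⟨a, ha.symm⟩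

/-- By Hilbert 90, every character comes from Kummer theory. -/
theorem exists_eigenvector (χ : Gal(K/F) →* (ZMod p)ˣ) :
    ∃ y : K, y ≠ 0 ∧ ∀ σ, σ y = teichmuller K p (χ σ) * y := by
  have := finiteDimensional_of_isAdjoinRoots hK
  obtain ⟨y, hy⟩ := groupCohomology.isMulCoboundary₁_of_isMulCocycle₁_of_aut_to_units
    (fun σ : Gal(K/F) => Units.mk0 (teichmuller K p (χ σ)) (teichmuller_ne_zero p _))
    (fun σ τ => Units.ext (by
      change teichmuller K p (χ (σ * τ)) = σ (teichmuller K p (χ τ)) * teichmuller K p (χ σ)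
      rw [apply_teichmuller, ← map_mul, map_mul χ, mul_comm]))
  refine ⟨y, y.ne_zero, fun σ => ?_⟩
  have h := congrArg Units.val (div_eq_iff_eq_mul.1 (hy σ))
  exact h

/-- The ramification index of `K` over `F` is `p - 1`.  It is divisible by `p - 1` since `K`
contains a root of a uniformizer of `F`.  Conversely, the decomposition of a uniformizer of `K` into
eigenvectors shows that there is a uniformizer of `K` whose `(p - 1)`-th power belongs to `F`. -/
theorem normVal_algebraMap {a : F} {m : ℤ} (ha : normVal F a = exp (-m)) :
    normVal K (algebraMap F K a) = exp (-((p - 1 : ℕ) * m)) := by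
  obtain ⟨r, hr0, hr⟩ := exists_normVal_algebraMap F K
  have h1 : ((p - 1 : ℕ) : ℤ) ∣ r := by
    obtain ⟨ϖ, π, hπ, hϖ⟩ := exists_pow_eq_uniformizer hK
    have h2 := hr π 1 hπ
    have hϖ0 : ϖ ≠ 0 := by
      rintro rfl
      rw [← hϖ, zero_pow (NeZero.ne _), map_zero] at h2
      exact exp_ne_zero h2.symm
    obtain ⟨s, hs⟩ := exists_normVal_eq hϖ0
    rw [← hϖ, normVal_pow hs, exp_inj, neg_inj, mul_one] at h2
    exact ⟨s, h2.symm⟩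
  have h2 : r ∣ ((p - 1 : ℕ) : ℤ) := by
    let _ : CommGroup Gal(K/F) := { (inferInstance : Group Gal(K/F)) with
      mul_comm := gal_mul_comm hK }
    have := finite_gal hK
    have := Fintype.ofFinite Gal(K/F)
    have := finite_characters (gal_pow_eq_one hK)
    have := Fintype.ofFinite (Gal(K/F) →* (ZMod p)ˣ)
    obtain ⟨π, hπ⟩ := exists_uniformizer K
    -- `|G| π` is the sum of its components `∑_σ χ(σ)⁻¹ σ(π)`, so one of these is a uniformizer
    have hsum := sum_eigenprojections (gal_pow_eq_one hK) (teichmuller K p)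
      (teichmuller_injective p) fun σ => σ π
    have hmem : ∀ χ : Gal(K/F) →* (ZMod p)ˣ,
        ∑ σ, teichmuller K p (χ σ⁻¹) • σ π ∈ primePow K 1 := by
      refine fun χ => sum_mem fun σ _ => ?_
      rw [smul_eq_mul]
      simpa using mul_mem_primePow
        (mem_primePow_of_normVal_eq_one (normVal_teichmuller p (χ σ⁻¹))) (apply_mem_primePow σ (mem_primePow_of_normVal_eq hπ))
    obtain ⟨χ, hχ⟩ : ∃ χ : Gal(K/F) →* (ZMod p)ˣ,
        ∑ σ, teichmuller K p (χ σ⁻¹) • σ π ∉ primePow K (1 + 1) := by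
      by_contra! hcon
      have h3 := sum_mem (fun χ (_ : χ ∈ Finset.univ) => hcon χ)
      rw [hsum, ← normVal_lt_iff, smul_eq_mul, map_mul,
        normVal_natCast_eq_one p (not_dvd_card_gal hK), one_mul, AlgEquiv.one_apply, hπ] at h3
      exact lt_irrefl _ h3
    set y := ∑ σ, teichmuller K p (χ σ⁻¹) • σ π with hy
    obtain ⟨b, hb⟩ := exists_pow_eq_algebraMap hK (χ := χ) (y := y) fun τ => by
      rw [hy, map_sum, Finset.mul_sum, ← Equiv.sum_comp (Equiv.mulLeft τ)
        (fun σ => teichmuller K p (χ τ) * teichmuller K p (χ σ⁻¹) • σ π)]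
      refine Finset.sum_congr rfl fun σ _ => ?_
      rw [smul_eq_mul, smul_eq_mul, map_mul, apply_teichmuller, Equiv.coe_mulLeft,
        AlgEquiv.mul_apply, ← mul_assoc, ← map_mul, mul_inv_rev, map_mul χ, map_inv χ τ]
      congr 2
      rw [mul_left_comm, mul_inv_cancel, mul_one]
    have hyn := normVal_pow (normVal_eq_iff.2 ⟨hmem χ, hχ⟩) (p - 1)
    have hb0 : b ≠ 0 := by
      rintro rfl
      rw [hb, map_zero, map_zero] at hyn
      exact exp_ne_zero hyn.symm
    obtain ⟨s, hs⟩ := exists_normVal_eq hb0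
    rw [hb, hr _ _ hs, exp_inj, neg_inj, mul_one] at hyn
    exact ⟨s, hyn.symm⟩
  rw [hr _ _ ha, Int.dvd_antisymm hr0.le (by positivity) h2 h1]

/-- The ramification index `p - 1` of `K` over `F` cancels the exponent `p - 1`: if `y^(p-1) = a ∈ F`,
then `v_K(y) = v_F(a)`. -/
theorem normVal_eq_of_pow_eq {y : K} {a : F} (h : y ^ (p - 1) = algebraMap F K a) {m : ℤ} :
    normVal K y = exp (-m) ↔ normVal F a = exp (-m) := by
  have hn : ((p - 1 : ℕ) : ℤ) ≠ 0 := by exact_mod_cast NeZero.ne (p - 1)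
  constructor
  · intro hy
    have ha0 : a ≠ 0 := by
      rintro rfl
      rw [map_zero, pow_eq_zero_iff (NeZero.ne _)] at h
      rw [h, map_zero] at hy
      exact exp_ne_zero hy.symm
    obtain ⟨s, hs⟩ := exists_normVal_eq ha0
    have h1 := normVal_pow hy (p - 1)
    rw [h, normVal_algebraMap hK hs, exp_inj, neg_inj] at h1
    rw [hs, mul_left_cancel₀ hn h1]
  · intro ha
    have hy0 : y ≠ 0 := by
      rintro rfl
      rw [zero_pow (NeZero.ne _), eq_comm, map_eq_zero] at h
      exact ne_zero_of_normVal_eq ha h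
    obtain ⟨s, hs⟩ := exists_normVal_eq hy0
    have h1 := normVal_pow hs (p - 1)
    rw [h, normVal_algebraMap hK ha, exp_inj, neg_inj] at h1
    rw [hs, mul_left_cancel₀ hn h1.symm]

omit hK in
/-- A `(p - 1)`-th root of `1` is determined by its reduction, so that the congruence modulo `𝔭` in the
definition of `IsKummerCharacter` can be replaced by an equality. -/
theorem isKummerCharacter_iff {χ : Gal(K/F) →* (ZMod p)ˣ} {a : F} :
    IsKummerCharacter p F K χ a ↔ a ≠ 0 ∧ ∃ y : K, y ^ (p - 1) = algebraMap F K a ∧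
      ∀ σ, σ y = teichmuller K p (χ σ) * y := by
  refine and_congr_right fun ha => exists_congr fun y => and_congr_right fun hy =>
    forall_congr' fun σ => ?_
  have hy0 : y ≠ 0 := by
    rintro rfl
    rw [zero_pow (NeZero.ne _), eq_comm, map_eq_zero] at hy
    exact ha hy
  obtain ⟨c, hc⟩ := exists_apply_eq_teichmuller_mul (p := p) σ hy
  rw [hc, mul_div_cancel_right₀ _ hy0, ← red_eq_red_iff (mem_primePow_of_normVal_eq_one
    (normVal_teichmuller p _)) (natCast_mem_primePow _), red_teichmuller, red_natCast,
    ← ZMod.cast_eq_val, ← ZMod.castHom_apply (h := dvd_refl p), ← unitsCast_apply,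
    (unitsCast_injective 𝓀[K]).eq_iff, mul_left_inj' hy0, (teichmuller_injective p).eq_iff]

/-- The quotient of two eigenvectors with the same character belongs to `F`. -/
theorem intCast_eq_of_eigenvector {χ : Gal(K/F) →* (ZMod p)ˣ} {y z : K} {m n : ℤ}
    (hy : normVal K y = exp (-m)) (hz : normVal K z = exp (-n))
    (hχy : ∀ σ, σ y = teichmuller K p (χ σ) * y) (hχz : ∀ σ, σ z = teichmuller K p (χ σ) * z) :
    (m : ZMod (p - 1)) = n := by
  obtain ⟨a, ha⟩ := exists_algebraMap_eq hK (x := y / z) fun σ => by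
    rw [map_div₀, hχy, hχz, mul_div_mul_left _ _ (teichmuller_ne_zero p _)]
  have h1 := normVal_div hy hz
  have ha0 : a ≠ 0 := by
    rintro rfl
    rw [← ha, map_zero, map_zero] at h1
    exact exp_ne_zero h1.symm
  obtain ⟨s, hs⟩ := exists_normVal_eq ha0
  rw [← ha, normVal_algebraMap hK hs, exp_inj, neg_inj] at h1
  rw [eq_comm, ZMod.intCast_eq_intCast_iff_dvd_sub]
  exact ⟨s, h1.symm⟩

/-- The valuation of a character is read off from the valuation in `K` of an eigenvector. -/
theorem charVal_eq_of_eigenvector {χ : Gal(K/F) →* (ZMod p)ˣ} {y : K} {i : ℤ}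
    (hy : normVal K y = exp (-i)) (hχ : ∀ σ, σ y = teichmuller K p (χ σ) * y) :
    charVal p F K χ = i := by
  obtain ⟨a, ha⟩ := exists_pow_eq_algebraMap hK hχ
  have hai := (normVal_eq_of_pow_eq hK ha).1 hy
  have h : ∃ n : ℤ, ∃ a : F, normVal F a = exp (-n) ∧ IsKummerCharacter p F K χ a :=
    ⟨i, a, hai, isKummerCharacter_iff.2 ⟨ne_zero_of_normVal_eq hai, y, ha, hχ⟩⟩
  rw [charVal, dif_pos h]
  obtain ⟨b, hb, hχb⟩ := h.choose_spec
  obtain ⟨-, z, hz, hχz⟩ := isKummerCharacter_iff.1 hχb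
  exact intCast_eq_of_eigenvector hK ((normVal_eq_of_pow_eq hK hz).2 hb) hy hχz hχ

/-- A character of valuation `i` is the character of an eigenvector of any valuation congruent to
`i` modulo `p - 1`. -/
theorem exists_eigenvector_of_charVal {χ : Gal(K/F) →* (ZMod p)ˣ} {i : ℤ}
    (h : charVal p F K χ = i) :
    ∃ y : K, normVal K y = exp (-i) ∧ ∀ σ, σ y = teichmuller K p (χ σ) * y := by
  obtain ⟨y, hy0, hχ⟩ := exists_eigenvector hK χ
  obtain ⟨j, hj⟩ := exists_normVal_eq hy0
  have h1 := charVal_eq_of_eigenvector hK hj hχ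
  rw [h, ZMod.intCast_eq_intCast_iff_dvd_sub] at h1
  obtain ⟨s, hs⟩ := h1
  obtain ⟨a, ha⟩ := exists_normVal_eq_exp (K := F) s
  refine ⟨y / algebraMap F K a, ?_, fun σ => ?_⟩
  · rw [normVal_div hj (normVal_algebraMap hK ha), ← hs, sub_sub_cancel]
  · rw [map_div₀, hχ, σ.commutes, mul_div_assoc]

theorem charVal_mul (χ ψ : Gal(K/F) →* (ZMod p)ˣ) :
    charVal p F K (χ * ψ) = charVal p F K χ + charVal p F K ψ := by
  obtain ⟨y, hy0, hy⟩ := exists_eigenvector hK χ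
  obtain ⟨z, hz0, hz⟩ := exists_eigenvector hK ψ
  obtain ⟨m, hm⟩ := exists_normVal_eq hy0
  obtain ⟨n, hn⟩ := exists_normVal_eq hz0
  rw [charVal_eq_of_eigenvector hK hm hy, charVal_eq_of_eigenvector hK hn hz, ← Int.cast_add]
  refine charVal_eq_of_eigenvector hK (normVal_mul hm hn) fun σ => ?_
  rw [map_mul, hy, hz, MonoidHom.mul_apply, map_mul]
  ring

theorem charVal_inv (χ : Gal(K/F) →* (ZMod p)ˣ) :
    charVal p F K χ⁻¹ = -charVal p F K χ := by
  obtain ⟨y, hy0, hy⟩ := exists_eigenvector hK χ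
  obtain ⟨m, hm⟩ := exists_normVal_eq hy0
  rw [charVal_eq_of_eigenvector hK hm hy, ← Int.cast_neg]
  refine charVal_eq_of_eigenvector hK (y := y⁻¹) (by rw [map_inv₀, hm, ← exp_neg]) fun σ => ?_
  have h1 := teichmuller_ne_zero (K := K) p (χ σ)
  rw [map_inv₀, hy, mul_inv, MonoidHom.inv_apply]
  congr 1
  refine inv_eq_of_mul_eq_one_right ?_
  rw [← map_mul, mul_inv_cancel, map_one]

theorem exists_isKummerCharacter (χ : Gal(K/F) →* (ZMod p)ˣ) : ∃ a : F, IsKummerCharacter p F K χ a := by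
  obtain ⟨y, hy0, hy⟩ := exists_eigenvector hK χ
  obtain ⟨a, ha⟩ := exists_pow_eq_algebraMap hK hy
  refine ⟨a, isKummerCharacter_iff.2 ⟨?_, y, ha, hy⟩⟩
  rintro rfl
  rw [map_zero, pow_eq_zero_iff (NeZero.ne _)] at ha
  exact hy0 ha

theorem charVal_of_isKummerCharacter {χ : Gal(K/F) →* (ZMod p)ˣ} {a : F} {n : ℤ}
    (h : IsKummerCharacter p F K χ a) (ha : normVal F a = exp (-n)) : charVal p F K χ = n := by
  obtain ⟨-, y, hy, hχ⟩ := isKummerCharacter_iff.1 h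
  exact charVal_eq_of_eigenvector hK ((normVal_eq_of_pow_eq hK hy).2 ha) hχ

theorem charVal_surjective (i : ZMod (p - 1)) : ∃ χ : Gal(K/F) →* (ZMod p)ˣ, charVal p F K χ = i := by
  obtain ⟨j, rfl⟩ := ZMod.intCast_surjective i
  obtain ⟨a, ha⟩ := exists_normVal_eq_exp (K := F) j
  obtain ⟨y, hy⟩ := hK.exists_root a
  have hy1 := (normVal_eq_of_pow_eq hK hy).2 ha
  obtain ⟨χ, hχ⟩ := exists_character (ne_zero_of_normVal_eq hy1) hy
  exact ⟨χ, charVal_eq_of_eigenvector hK hy1 hχ⟩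

end KummerTheory

/-! ### The trace of a finite field -/

/-- The trace `l → 𝔽_p` of a finite field `l`, with kernel the image of `x ↦ xᵖ - x`. -/
theorem exists_trace (p : ℕ) [Fact p.Prime] (l : Type*) [Field l] [Finite l] [CharP l p] :
    ∃ tr : l →+ ZMod p, Function.Surjective tr ∧ (∀ x, tr x = 0 ↔ ∃ y, y ^ p - y = x) ∧
      (∀ (f : l ≃+* l) x, tr (f x) = tr x) ∧
      ∀ (c : ZMod p) x, tr (ZMod.castHom (dvd_refl p) l c * x) = c * tr x := by
  let _ : Algebra (ZMod p) l := ZMod.algebra l p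
  have hinv : ∀ (f : l ≃+* l) x, Algebra.trace (ZMod p) l (f x) = Algebra.trace (ZMod p) l x :=
    fun f x => Algebra.trace_eq_of_algEquiv
      (AlgEquiv.ofRingEquiv (f := f) fun c => by
        rw [Subsingleton.elim (algebraMap (ZMod p) l) (ZMod.castHom (dvd_refl p) l),
          ZMod.castHom_apply, ZMod.cast_eq_val, map_natCast]) x
  have hsurj : Function.Surjective (Algebra.trace (ZMod p) l) := Algebra.trace_surjective _ _
  let A : l →ₗ[ZMod p] l := ((frobenius l p : l →+ l) - AddMonoidHom.id l).toZModLinearMap p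
  have hA : ∀ x, A x = x ^ p - x := fun x => rfl
  have hle : LinearMap.range A ≤ LinearMap.ker (Algebra.trace (ZMod p) l) := by
    rintro _ ⟨x, rfl⟩
    rw [LinearMap.mem_ker, hA, map_sub, sub_eq_zero]
    exact hinv (frobeniusEquiv l p) x
  have hkerA : LinearMap.ker A ≤ Submodule.span (ZMod p) {1} := by
    intro x hx
    rw [LinearMap.mem_ker, hA, sub_eq_zero, ← Subfield.mem_bot_iff_pow_eq_self l p,
      mem_bot_iff_intCast p l] at hx
    obtain ⟨n, rfl⟩ := hx
    rw [← zsmul_one]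
    exact zsmul_mem (Submodule.mem_span_singleton_self 1) n
  have heq : LinearMap.range A = LinearMap.ker (Algebra.trace (ZMod p) l) := by
    refine Submodule.eq_of_le_of_finrank_le hle ?_
    have h1 := LinearMap.finrank_range_add_finrank_ker A
    have h2 := LinearMap.finrank_range_add_finrank_ker (Algebra.trace (ZMod p) l)
    rw [LinearMap.range_eq_top.2 hsurj, finrank_top, Module.finrank_self] at h2
    have h3 := Submodule.finrank_mono hkerA
    rw [finrank_span_singleton one_ne_zero] at h3
    omega
  refine ⟨(Algebra.trace (ZMod p) l).toAddMonoidHom, hsurj, fun x => ?_, hinv, fun c x => ?_⟩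
  · change Algebra.trace (ZMod p) l x = 0 ↔ _
    rw [← LinearMap.mem_ker, ← heq]
    rfl
  · change Algebra.trace (ZMod p) l _ = c * Algebra.trace (ZMod p) l x
    rw [← smul_eq_mul c, ← map_smul, Algebra.smul_def,
      Subsingleton.elim (algebraMap (ZMod p) l) (ZMod.castHom (dvd_refl p) l)]

/-! ### The modules `l[i]` and `V_i` -/

section Residue

variable {p : ℕ} [Fact p.Prime]
variable {F : Type*} [Field F] [ValuativeRel F] [TopologicalSpace F] [IsNonarchimedeanLocalField F]
variable {K : Type*} [Field K] [ValuativeRel K] [TopologicalSpace K] [IsNonarchimedeanLocalField K]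
variable [Algebra F K] [ValuativeExtension F K] [CharP 𝓀[K] p]

theorem castHom_smul [CharP 𝓀[F] p] (c : ZMod p) (x : 𝓀[K]) :
    ZMod.castHom (dvd_refl p) 𝓀[F] c • x = ZMod.castHom (dvd_refl p) 𝓀[K] c * x := by
  rw [Algebra.smul_def, ← RingHom.comp_apply,
    Subsingleton.elim ((algebraMap 𝓀[F] 𝓀[K]).comp (ZMod.castHom (dvd_refl p) 𝓀[F]))
      (ZMod.castHom (dvd_refl p) 𝓀[K])]

theorem residueRep_mul (σ : Gal(K/F)) (x y : 𝓀[K]) :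
    residueRep F K σ (x * y) = residueRep F K σ x * residueRep F K σ y :=
  map_mul (IsLocalRing.ResidueField.mapEquiv (integerEquiv (σ : K ≃+* K))) x y

/-- Eigenvectors in the residue field lift to eigenvectors in `K`, namely to roots of unity. -/
theorem exists_eigenvector_lift {ψ : Gal(K/F) →* (ZMod p)ˣ} {x : 𝓀[K]} (hx : x ≠ 0)
    (h : ∀ σ, residueRep F K σ x = unitsCast p 𝓀[K] (ψ σ) * x) :
    ∃ y : K, normVal K y = 1 ∧ red y = x ∧ ∀ σ, σ y = teichmuller K p (ψ σ) * y := by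
  set Q := Nat.card 𝓀[K] with hQ
  have hQ0 : Q - 1 ≠ 0 := by
    have := Finite.one_lt_card (α := 𝓀[K])
    omega
  obtain ⟨y, hy, rfl⟩ := exists_teichmuller hx
  have hy1 := normVal_eq_one_of_pow_eq_one hQ0 hy
  have hy0 := mem_primePow_of_normVal_eq_one hy1
  have hdvd : p - 1 ∣ Q - 1 := by
    have := Fintype.ofFinite 𝓀[K]
    obtain ⟨n, -, hn⟩ := FiniteField.card 𝓀[K] p
    rw [hQ, Nat.card_eq_fintype_card, hn]
    simpa using Nat.sub_dvd_pow_sub_pow p 1 n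
  refine ⟨y, hy1, rfl, fun σ => eq_of_pow_eq_one (natCast_card_residueField_sub_one_ne_zero K)
    (by rw [← map_pow, hy, map_one]) ?_ ?_⟩
  · obtain ⟨s, hs⟩ := hdvd
    rw [mul_pow, hy, mul_one, ← hQ, hs, pow_mul, teichmuller_pow, one_pow]
  · rw [red_apply σ hy0, h, red_mul (mem_primePow_of_normVal_eq_one (normVal_teichmuller p _)) hy0,
      red_teichmuller]

variable [CharP 𝓀[F] p] (hK : IsAdjoinRoots F K (p - 1))
include hK

/-- Only characters of valuation `0` occur in the residue field `l`. -/
theorem eq_zero_of_charVal_ne_zero {ψ : Gal(K/F) →* (ZMod p)ˣ} (hψ : charVal p F K ψ ≠ 0)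
    {x : 𝓀[K]} (h : ∀ σ, residueRep F K σ x = unitsCast p 𝓀[K] (ψ σ) * x) : x = 0 := by
  by_contra hx
  obtain ⟨y, hy, -, hσ⟩ := exists_eigenvector_lift hx h
  refine hψ ?_
  rw [charVal_eq_of_eigenvector hK (i := 0) (by rw [hy, neg_zero, exp_zero]) hσ, Int.cast_zero]

/-- The invariants of `G` in `l` are `k`. -/
theorem exists_algebraMap_residue_eq {x : 𝓀[K]} (h : ∀ σ, residueRep F K σ x = x) :
    ∃ c : 𝓀[F], algebraMap 𝓀[F] 𝓀[K] c = x := by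
  by_cases hx : x = 0
  · exact ⟨0, by rw [hx, map_zero]⟩
  obtain ⟨y, hy, rfl, hσ⟩ := exists_eigenvector_lift (ψ := (1 : Gal(K/F) →* (ZMod p)ˣ)) hx
    fun σ => by rw [h, MonoidHom.one_apply, map_one, one_mul]
  obtain ⟨a, rfl⟩ := exists_algebraMap_eq hK fun σ => by
    rw [hσ, MonoidHom.one_apply, map_one, one_mul]
  have ha : a ∈ primePow F 0 := mem_primePow_zero.2 ((normVal_algebraMap_le_one_iff (K := K) a).1 hy.le)
  exact ⟨red a, (red_algebraMap ha).symm⟩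

/-- If `v̄(ψ) = 0`, the `ψ`-eigenspace of `l` is a `k`-line, generated by the reduction of an eigenvector
of `K` of valuation `0`. -/
theorem exists_residue_eigenvector {ψ : Gal(K/F) →* (ZMod p)ˣ} (hψ : charVal p F K ψ = 0) :
    ∃ x₀ : 𝓀[K], x₀ ≠ 0 ∧ (∀ σ, residueRep F K σ x₀ = unitsCast p 𝓀[K] (ψ σ) * x₀) ∧
      ∀ x : 𝓀[K], (∀ σ, residueRep F K σ x = unitsCast p 𝓀[K] (ψ σ) * x) → ∃ c : 𝓀[F], c • x₀ = x := by
  obtain ⟨y, hy, hσ⟩ := exists_eigenvector_of_charVal hK (χ := ψ) (i := 0) (by rw [hψ, Int.cast_zero])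
  rw [neg_zero, exp_zero] at hy
  have hy0 := mem_primePow_of_normVal_eq_one hy
  have hx0 := red_ne_zero_of_normVal_eq_one hy
  have hx : ∀ σ, residueRep F K σ (red y) = unitsCast p 𝓀[K] (ψ σ) * red y := fun σ => by
    rw [← red_apply σ hy0, hσ, red_mul (mem_primePow_of_normVal_eq_one (normVal_teichmuller p _)) hy0,
      red_teichmuller]
  refine ⟨red y, hx0, hx, fun x h => ?_⟩
  obtain ⟨c, hc⟩ := exists_algebraMap_residue_eq hK (x := x / red y) fun σ => by
    have h1 : residueRep F K σ (x / red y) * residueRep F K σ (red y) = residueRep F K σ x := by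
      rw [← residueRep_mul, div_mul_cancel₀ _ hx0]
    rw [hx, h] at h1
    have h2 := unitsCast_ne_zero 𝓀[K] (ψ σ)
    rw [eq_div_iff hx0]
    refine mul_left_cancel₀ h2 ?_
    rw [← h1]
    ring
  exact ⟨c, by rw [Algebra.smul_def, hc, div_mul_cancel₀ _ hx0]⟩

omit hK in
theorem mem_eigenspace_twist {ξ χ : Gal(K/F) →* (ZMod p)ˣ} {x : 𝓀[K]} :
    x ∈ eigenspace p (twist p (residueRep F K) ξ) χ ↔
      ∀ σ, residueRep F K σ x = unitsCast p 𝓀[K] ((χ * ξ⁻¹) σ) * x := by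
  refine forall_congr' fun σ => ?_
  change ZMod.castHom (dvd_refl p) 𝓀[F] (ξ σ : ZMod p) • residueRep F K σ x =
    ZMod.castHom (dvd_refl p) 𝓀[F] (χ σ : ZMod p) • x ↔ _
  rw [castHom_smul, castHom_smul, ← unitsCast_apply, ← unitsCast_apply, MonoidHom.mul_apply,
    MonoidHom.inv_apply, map_mul, mul_comm (unitsCast p 𝓀[K] (χ σ)), mul_assoc]
  have h : unitsCast p 𝓀[K] (ξ σ) * unitsCast p 𝓀[K] (ξ σ)⁻¹ = 1 := by
    rw [← map_mul, mul_inv_cancel, map_one]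
  constructor
  · intro h1
    linear_combination unitsCast p 𝓀[K] (ξ σ)⁻¹ * h1 - residueRep F K σ x * h
  · intro h1
    linear_combination unitsCast p 𝓀[K] (ξ σ) * h1 + unitsCast p 𝓀[K] (χ σ) * x * h

theorem finrank_eigenspace_twist {ξ χ : Gal(K/F) →* (ZMod p)ˣ}
    (h : charVal p F K χ = charVal p F K ξ) :
    Module.finrank 𝓀[F] (eigenspace p (twist p (residueRep F K) ξ) χ) = 1 := by
  obtain ⟨x₀, hx₀, hx₁, hx₂⟩ := exists_residue_eigenvector hK (ψ := χ * ξ⁻¹)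
    (by rw [charVal_mul hK, charVal_inv hK, h, add_neg_cancel])
  refine finrank_eq_one_iff'.2 ⟨⟨x₀, mem_eigenspace_twist.2 hx₁⟩, fun h0 => hx₀ (congrArg Subtype.val h0),
    fun x => ?_⟩
  obtain ⟨c, hc⟩ := hx₂ x (mem_eigenspace_twist.1 x.2)
  exact ⟨c, Subtype.ext hc⟩

theorem eigenspace_twist_eq_bot {ξ χ : Gal(K/F) →* (ZMod p)ˣ}
    (h : charVal p F K χ ≠ charVal p F K ξ) :
    eigenspace p (twist p (residueRep F K) ξ) χ = ⊥ := by
  refine eq_bot_iff.2 fun x hx => ?_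
  refine eq_zero_of_charVal_ne_zero hK (ψ := χ * ξ⁻¹) ?_ (mem_eigenspace_twist.1 hx)
  rwa [charVal_mul hK, charVal_inv hK, ← sub_eq_add_neg, sub_ne_zero]

omit hK in
theorem twist_twist {R G V : Type*} [CommRing R] [CharP R p] [Group G] [AddCommGroup V]
    [Module R V] (ρ : Representation R G V) (ξ ω : G →* (ZMod p)ˣ) :
    twist p (twist p ρ ξ) ω = twist p ρ (ξ * ω) := by
  refine MonoidHom.ext fun σ => LinearMap.ext fun x => ?_
  change ZMod.castHom _ R (ω σ : ZMod p) • ZMod.castHom _ R (ξ σ : ZMod p) • ρ σ x =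
    ZMod.castHom _ R ((ξ σ * ω σ : (ZMod p)ˣ) : ZMod p) • ρ σ x
  rw [smul_smul, Units.val_mul, map_mul, mul_comm]

variable (p) in
omit hK [CharP 𝓀[F] p] [CharP 𝓀[K] p] [ValuativeExtension F K] in
theorem intCast_prime_eq_one : ((p : ℤ) : ZMod (p - 1)) = 1 := by
  have := ZMod.natCast_self (p - 1)
  rw [Nat.cast_sub (Fact.out : p.Prime).one_le, sub_eq_zero] at this
  rw [Int.cast_natCast, this, Nat.cast_one]

omit hK [CharP 𝓀[F] p] [CharP 𝓀[K] p] [ValuativeExtension F K] in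
theorem existsUnique_level_eq (i : ℕ) (v : ZMod (p - 1)) :
    ∃! j : Fin (p - 1), ((level p i j : ℤ) : ZMod (p - 1)) = v := by
  have hlev : ∀ j : Fin (p - 1), ((level p i j : ℤ) : ZMod (p - 1)) = v ↔
      ((j : ℕ) : ZMod (p - 1)) = v - i - 1 := fun j => by
    rw [level]
    push_cast
    rw [← Int.cast_natCast p, intCast_prime_eq_one, one_mul, eq_sub_iff_add_eq, eq_sub_iff_add_eq]
    constructor <;> intro h <;> rw [← h] <;> ring
  refine ⟨⟨(v - i - 1).val, ZMod.val_lt _⟩, (hlev _).2 (ZMod.natCast_zmod_val _), fun j hj => ?_⟩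
  refine Fin.ext ?_
  change (j : ℕ) = (v - i - 1).val
  rw [← (hlev j).1 hj, ZMod.val_cast_of_lt j.2]

/-- Since the levels of the summands of a block represent every class modulo `p - 1` once, every
character occurs once in the block. -/
theorem finrank_eigenspace_blockRep {ξ : ℤ → (Gal(K/F) →* (ZMod p)ˣ)}
    (hξ : ∀ i : ℤ, charVal p F K (ξ i) = i) (i : ℕ) (χ : Gal(K/F) →* (ZMod p)ˣ) :
    Module.finrank 𝓀[F] (eigenspace p (blockRep p F K ξ i) χ) = 1 := by
  classical
  have hmem : ∀ x : Fin (p - 1) → 𝓀[K], x ∈ eigenspace p (blockRep p F K ξ i) χ ↔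
      ∀ j, x j ∈ eigenspace p (twist p (residueRep F K) (ξ (-level p i j) * omega p F K)) χ := by
    intro x
    simp only [← twist_twist]
    exact ⟨fun h j σ => congrFun (h σ) j, fun h σ => funext fun j => h j σ⟩
  have hval : ∀ j, charVal p F K (ξ (-level p i j) * omega p F K) =
      -((level p i j : ℤ) : ZMod (p - 1)) + charVal p F K (omega p F K) := fun j => by
    rw [charVal_mul hK, hξ, Int.cast_neg]
  obtain ⟨j, hj, huniq⟩ := existsUnique_level_eq (p := p) i
    (charVal p F K (omega p F K) - charVal p F K χ)
  obtain ⟨x₀, hx₀, hspan⟩ := finrank_eq_one_iff'.1 (finrank_eigenspace_twist hK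
    (ξ := ξ (-level p i j) * omega p F K) (χ := χ) (by rw [hval, hj]; ring))
  have hbot : ∀ j', j' ≠ j →
      eigenspace p (twist p (residueRep F K) (ξ (-level p i j') * omega p F K)) χ = ⊥ := fun j' hj' => by
    refine eigenspace_twist_eq_bot hK fun h => hj' (huniq j' ?_)
    change ((level p i j' : ℤ) : ZMod (p - 1)) = _
    rw [h, hval]
    ring
  have : Module.Free 𝓀[F] (eigenspace p (blockRep p F K ξ i) χ) := Module.Free.of_divisionRing _ _
  refine finrank_eq_one_iff'.2 ⟨⟨Pi.single j x₀, (hmem _).2 fun j' => ?_⟩, fun h0 => ?_, fun x => ?_⟩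
  · by_cases h : j' = j
    · subst h
      rw [Pi.single_eq_same]
      exact x₀.2
    · rw [Pi.single_eq_of_ne h]
      exact zero_mem _
  · refine hx₀ (Subtype.ext ?_)
    have := congrFun (congrArg Subtype.val h0) j
    simpa using this
  · obtain ⟨c, hc⟩ := hspan ⟨x.1 j, (hmem _).1 x.2 j⟩
    refine ⟨c, Subtype.ext (funext fun j' => ?_)⟩
    by_cases h : j' = j
    · subst h
      simpa using congrArg Subtype.val hc
    · have h1 := (hmem _).1 x.2 j'
      rw [hbot j' h, Submodule.mem_bot] at h1
      simp [h, h1]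

theorem nonempty_blockRep_asModule_equiv {ξ : ℤ → (Gal(K/F) →* (ZMod p)ˣ)}
    (hξ : ∀ i : ℤ, charVal p F K (ξ i) = i) (i : ℕ) :
    Nonempty ((blockRep p F K ξ i).asModule ≃ₗ[MonoidAlgebra 𝓀[F] Gal(K/F)]
      MonoidAlgebra 𝓀[F] Gal(K/F)) := by
  let _ : CommGroup Gal(K/F) := { (inferInstance : Group Gal(K/F)) with
    mul_comm := gal_mul_comm hK }
  have := finite_gal hK
  exact nonempty_asModule_equiv (gal_pow_eq_one hK) (not_dvd_card_gal hK) _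
    (finrank_eigenspace_blockRep hK hξ i)

end Residue

/-! ### The filtered modules built from the `V_i` -/

section Model

variable {p : ℕ} [Fact p.Prime]
variable {F : Type*} [Field F] [ValuativeRel F] [TopologicalSpace F] [IsNonarchimedeanLocalField F]
variable {K : Type*} [Field K] [ValuativeRel K] [TopologicalSpace K] [IsNonarchimedeanLocalField K]
variable [Algebra F K] [ValuativeExtension F K] [CharP 𝓀[K] p] [CharP 𝓀[F] p]

omit [Fact p.Prime] [CharP 𝓀[F] p] in
theorem level_inj {i i' : ℕ} {j j' : Fin (p - 1)} (h : level p i j = level p i' j') :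
    i = i' ∧ j = j' := by
  have hj := j.2
  have hj' := j'.2
  simp only [level] at h
  have h1 : i = i' := by
    rcases lt_trichotomy i i' with hlt | heq | hlt
    · have : (p : ℤ) * (i + 1) ≤ p * i' := by gcongr; omega
      rw [mul_add] at this
      omega
    · exact heq
    · have : (p : ℤ) * (i' + 1) ≤ p * i := by gcongr; omega
      rw [mul_add] at this
      omega
  subst h1
  exact ⟨rfl, Fin.ext (by omega)⟩

omit [Fact p.Prime] in
theorem level_pos (i : ℕ) (j : Fin (p - 1)) : 0 < level p i j := by
  simp only [level]
  positivity

theorem level_lt (i : ℕ) (j : Fin (p - 1)) : level p i j < p * (i + 1) := by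
  have hj := j.2
  simp only [level, mul_add]
  omega

theorem not_dvd_level (i : ℕ) (j : Fin (p - 1)) : ¬ (p : ℤ) ∣ level p i j := by
  intro h
  have h1 : (p : ℤ) ∣ (j : ℤ) + 1 := by
    rw [level, add_assoc] at h
    exact (dvd_add_right (dvd_mul_right _ _)).1 h
  have := Int.le_of_dvd (by positivity) h1
  have := j.2
  omega

theorem exists_level_eq {m : ℤ} (hm : 0 < m) (hp : ¬ (p : ℤ) ∣ m) :
    ∃ (i : ℕ) (j : Fin (p - 1)), level p i j = m := by
  have hp0 : (0 : ℤ) < p := by exact_mod_cast (Fact.out : p.Prime).pos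
  have h1 := Int.emod_nonneg m hp0.ne'
  have h2 := Int.emod_lt_of_pos m hp0
  have h3 : m % p ≠ 0 := fun h => hp (Int.dvd_of_emod_eq_zero h)
  have h4 := Int.mul_ediv_add_emod m p
  have h5 : 0 ≤ m / p := Int.ediv_nonneg hm.le hp0.le
  refine ⟨(m / p).toNat, ⟨(m % p - 1).toNat, by omega⟩, ?_⟩
  simp only [level]
  rw [Int.toNat_of_nonneg h5, Int.toNat_of_nonneg (by omega)]
  omega

variable {ι : Type*} (c : ι → ℕ)

theorem mem_directSumFil_block {m : ℤ} {x : ⨁ _ : ι, Block p F K} :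
    x ∈ directSumFil (fun i => blockFilFp p F K (c i)) m ↔
      ∀ i j, m < level p (c i) j → (x i : Fin (p - 1) → 𝓀[K]) j = 0 := by
  rw [directSumFil, Submodule.mem_iInf]
  refine forall_congr' fun i => ?_
  rw [Submodule.mem_comap]
  have h : ∀ y : Fin (p - 1) → 𝓀[K], y ∈ blockFil p F K (c i) m ↔
      ∀ j, m < level p (c i) j → y j = 0 := fun y => by
    rw [blockFil, Submodule.mem_pi]
    simp only [Set.mem_univ, forall_true_left]
    exact forall_congr' fun j => mem_levelFil
  exact h _

theorem directSum_blockRepFp_apply (ξ : ℤ → (Gal(K/F) →* (ZMod p)ˣ)) (σ : Gal(K/F))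
    (x : ⨁ _ : ι, Block p F K) (i : ι) (j : Fin (p - 1)) :
    (Representation.directSum (fun i => blockRepFp p F K ξ (c i)) σ x i : Fin (p - 1) → 𝓀[K]) j =
      unitsCast p 𝓀[K] ((ξ (-level p (c i) j) * omega p F K) σ) *
        residueRep F K σ ((x i : Fin (p - 1) → 𝓀[K]) j) := by
  change (blockRepFp p F K ξ (c i) σ (x i) : Fin (p - 1) → 𝓀[K]) j = _
  change twist p (twist p (residueRep F K) (ξ (-level p (c i) j))) (omega p F K) σ _ = _
  rw [twist_twist]
  exact castHom_smul _ _

variable (p F K) in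
open Classical in
/-- The inclusion of the `j`-th summand of the `i`-th block. -/
noncomputable def blockIncl (i : ι) (j : Fin (p - 1)) : 𝓀[K] →+ ⨁ _ : ι, Block p F K :=
  (DirectSum.of (fun _ : ι => Block p F K) i).comp
    (AddMonoidHom.single (fun _ : Fin (p - 1) => 𝓀[K]) j : 𝓀[K] →+ Block p F K)

variable (p F K) in
/-- The projection to the `j`-th summand of the `i`-th block. -/
noncomputable def blockProj (i : ι) (j : Fin (p - 1)) : (⨁ _ : ι, Block p F K) →+ 𝓀[K] where
  toFun x := (x i : Fin (p - 1) → 𝓀[K]) j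
  map_zero' := rfl
  map_add' _ _ := rfl

theorem blockProj_apply (i : ι) (j : Fin (p - 1)) (x : ⨁ _ : ι, Block p F K) :
    blockProj p F K i j x = (x i : Fin (p - 1) → 𝓀[K]) j := rfl

theorem blockIncl_apply_self (i : ι) (j : Fin (p - 1)) (w : 𝓀[K]) :
    (blockIncl p F K i j w i : Fin (p - 1) → 𝓀[K]) j = w := by
  classical
  have h : (blockIncl p F K i j w) i = (Pi.single j w : Fin (p - 1) → 𝓀[K]) := by
    refine (DirectSum.of_eq_same (β := fun _ : ι => Block p F K) i _).trans ?_
    simp only [AddMonoidHom.single]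
    rfl
  rw [h, Pi.single_eq_same]

theorem blockIncl_apply_of_ne {i i' : ι} {j j' : Fin (p - 1)} (h : ¬ (i' = i ∧ j' = j)) (w : 𝓀[K]) :
    (blockIncl p F K i j w i' : Fin (p - 1) → 𝓀[K]) j' = 0 := by
  classical
  by_cases hi : i' = i
  · subst hi
    have h1 : (blockIncl p F K i' j w) i' = (Pi.single j w : Fin (p - 1) → 𝓀[K]) := by
      refine (DirectSum.of_eq_same (β := fun _ : ι => Block p F K) i' _).trans ?_
      simp only [AddMonoidHom.single]
      rfl
    rw [h1, Pi.single_eq_of_ne fun hj => h ⟨rfl, hj⟩]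
  · have h1 : (blockIncl p F K i j w) i' = 0 :=
      DirectSum.of_eq_of_ne (β := fun _ : ι => Block p F K) _ _ _ hi
    rw [h1]
    rfl

theorem directSum_block_ext {x y : ⨁ _ : ι, Block p F K}
    (h : ∀ i j, (x i : Fin (p - 1) → 𝓀[K]) j = (y i : Fin (p - 1) → 𝓀[K]) j) : x = y :=
  DFinsupp.ext fun i => funext fun j => h i j

/-- The action on the `j`-th summand of the `i`-th block, which is `l` twisted by the character
`ξ(-b) ω`, with `b` the level of the summand. -/
theorem blockIncl_act (ξ : ℤ → (Gal(K/F) →* (ZMod p)ˣ)) (σ : Gal(K/F)) (i : ι) (j : Fin (p - 1))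
    (w : 𝓀[K]) :
    blockIncl p F K i j (unitsCast p 𝓀[K] ((ξ (-level p (c i) j) * omega p F K) σ) *
      residueRep F K σ w) =
      Representation.directSum (fun i => blockRepFp p F K ξ (c i)) σ (blockIncl p F K i j w) := by
  refine directSum_block_ext fun i' j' => ?_
  rw [directSum_blockRepFp_apply]
  by_cases h : i' = i ∧ j' = j
  · obtain ⟨rfl, rfl⟩ := h
    rw [blockIncl_apply_self, blockIncl_apply_self]
  · rw [blockIncl_apply_of_ne h, blockIncl_apply_of_ne h, map_zero, mul_zero]

theorem blockIncl_mem (i : ι) (j : Fin (p - 1)) (w : 𝓀[K]) :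
    blockIncl p F K i j w ∈ directSumFil (fun i => blockFilFp p F K (c i)) (level p (c i) j) := by
  rw [mem_directSumFil_block]
  intro i' j' h
  refine blockIncl_apply_of_ne ?_ w
  rintro ⟨rfl, rfl⟩
  exact lt_irrefl _ h

variable {c}

/-- The graded piece of the level of the `j`-th summand of the `i`-th block is this summand. -/
theorem mem_directSumFil_sub_one_iff (hc : Function.Injective c) (i : ι) (j : Fin (p - 1))
    (x : ⨁ _ : ι, Block p F K) :
    x ∈ directSumFil (fun i => blockFilFp p F K (c i)) (level p (c i) j - 1) ↔
      x ∈ directSumFil (fun i => blockFilFp p F K (c i)) (level p (c i) j) ∧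
        blockProj p F K i j x = 0 := by
  simp only [mem_directSumFil_block, blockProj_apply]
  refine ⟨fun h => ⟨fun i' j' h' => h i' j' (by omega), h i j (by omega)⟩, fun h i' j' h' => ?_⟩
  rcases (show level p (c i) j ≤ level p (c i') j' by omega).lt_or_eq with hlt | heq
  · exact h.1 i' j' hlt
  · obtain ⟨h1, rfl⟩ := level_inj heq
    obtain rfl := hc h1
    exact h.2

theorem directSumFil_le_sub_one {m : ℤ} (hm : ∀ i j, level p (c i) j ≠ m) :
    directSumFil (fun i => blockFilFp p F K (c i)) m ≤
      directSumFil (fun i => blockFilFp p F K (c i)) (m - 1) := by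
  intro x hx
  rw [mem_directSumFil_block] at hx ⊢
  intro i j h
  exact hx i j (lt_of_le_of_ne (by omega) (hm i j).symm)

variable (c)

theorem isBoundedFil_directSum_block (ξ : ℤ → (Gal(K/F) →* (ZMod p)ˣ)) :
    IsBoundedFil (Representation.directSum (fun i => blockRepFp p F K ξ (c i)))
      (directSumFil (fun i => blockFilFp p F K (c i))) := by
  classical
  refine ⟨fun m n hmn x hx => ?_, fun m σ x hx => ?_, fun m hm => ?_, fun x => ?_⟩
  · rw [mem_directSumFil_block] at hx ⊢
    exact fun i j h => hx i j (by omega)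
  · rw [mem_directSumFil_block] at hx ⊢
    intro i j h
    rw [directSum_blockRepFp_apply, hx i j h, map_zero, mul_zero]
  · refine eq_bot_iff.2 fun x hx => directSum_block_ext fun i j => ?_
    rw [mem_directSumFil_block] at hx
    exact hx i j (hm.trans (level_pos _ _))
  · refine ⟨p * ((DFinsupp.support x).sup c + 1), (mem_directSumFil_block c).2 fun i j h => ?_⟩
    by_contra hne
    have h1 : c i ≤ (DFinsupp.support x).sup c := Finset.le_sup (DFinsupp.mem_support_iff.2 fun h0 =>
      hne (congrFun h0 j))
    have h2 := level_lt (p := p) (c i) j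
    have h3 : (p : ℤ) * (c i + 1) ≤ p * (((DFinsupp.support x).sup c : ℕ) + 1) := by gcongr
    omega

end Model

/-! ### Leading coefficients -/

section LeadingCoefficient

/-- A function on `A` that is constant on the fibres of `π` factors through `π`; its values outside the
image of `A` are arbitrary. -/
theorem exists_factorization_on {X V L : Type*} [Nonempty L] (π : X → V) (A : Set X) (f : X → L)
    (h : ∀ x ∈ A, ∀ x' ∈ A, π x = π x' → f x = f x') : ∃ θ : V → L, ∀ x ∈ A, θ (π x) = f x := by
  classical
  refine ⟨fun v => if hv : ∃ x ∈ A, π x = v then f hv.choose else Classical.arbitrary L,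
    fun x hx => ?_⟩
  have hv : ∃ x' ∈ A, π x' = π x := ⟨x, hx, rfl⟩
  dsimp only
  rw [dif_pos hv]
  exact h _ hv.choose_spec.1 _ hx hv.choose_spec.2

variable {p : ℕ} [Fact p.Prime]
variable {F : Type*} [Field F] [ValuativeRel F] [TopologicalSpace F] [IsNonarchimedeanLocalField F]
variable {K : Type*} [Field K] [ValuativeRel K] [TopologicalSpace K] [IsNonarchimedeanLocalField K]
variable {i : ℤ} {y : K}

theorem div_mem_primePow (hy : normVal K y = exp (-i)) {n : ℤ} {z : K} (hz : z ∈ primePow K n) :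
    z / y ∈ primePow K (n - i) := by
  rw [div_eq_mul_inv, sub_eq_add_neg]
  exact mul_mem_primePow hz (inv_mem_primePow hy)

theorem div_mem_primePow_zero (hy : normVal K y = exp (-i)) {z : K} (hz : z ∈ primePow K i) :
    z / y ∈ primePow K 0 := by
  simpa using div_mem_primePow hy hz

theorem red_div_add (hy : normVal K y = exp (-i)) {z z' : K} (hz : z ∈ primePow K i)
    (hz' : z' ∈ primePow K i) : red ((z + z') / y) = red (z / y) + red (z' / y) := by
  rw [add_div, red_add (div_mem_primePow_zero hy hz) (div_mem_primePow_zero hy hz')]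

theorem red_div_eq_zero_iff (hy : normVal K y = exp (-i)) {z : K} (hz : z ∈ primePow K i) :
    red (z / y) = 0 ↔ z ∈ primePow K (i + 1) := by
  rw [red_eq_zero_iff (div_mem_primePow_zero hy hz)]
  constructor <;> intro h
  · have h1 := mul_mem_primePow (mem_primePow_of_normVal_eq hy) h
    rwa [mul_div_cancel₀ _ (ne_zero_of_normVal_eq hy)] at h1
  · have h1 := div_mem_primePow hy h
    rwa [add_sub_cancel_left] at h1

theorem red_div_eq_iff (hy : normVal K y = exp (-i)) {z z' : K} (hz : z ∈ primePow K i)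
    (hz' : z' ∈ primePow K i) : red (z / y) = red (z' / y) ↔ z - z' ∈ primePow K (i + 1) := by
  rw [← red_div_eq_zero_iff hy (sub_mem hz hz'), sub_div,
    red_sub (div_mem_primePow_zero hy hz) (div_mem_primePow_zero hy hz'), sub_eq_zero]

theorem exists_red_div_eq (hy : normVal K y = exp (-i)) (w : 𝓀[K]) :
    ∃ z ∈ primePow K i, red (z / y) = w := by
  obtain ⟨x, hx, rfl⟩ := exists_red_eq w
  refine ⟨y * x, by simpa using mul_mem_primePow (mem_primePow_of_normVal_eq hy) hx, ?_⟩
  rw [mul_div_cancel_left₀ _ (ne_zero_of_normVal_eq hy)]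

variable [Algebra F K] [ValuativeExtension F K]

/-- Dividing by an eigenvector `y` of valuation `i` and character `χ` identifies `𝔭^i/𝔭^{i+1}` with the
residue field twisted by `χ`. -/
theorem red_apply_div [CharP 𝓀[K] p] (hy : normVal K y = exp (-i)) {χ : Gal(K/F) →* (ZMod p)ˣ}
    (hχ : ∀ σ, σ y = teichmuller K p (χ σ) * y) (σ : Gal(K/F)) {z : K} (hz : z ∈ primePow K i) :
    red (σ z / y) = unitsCast p 𝓀[K] (χ σ) * residueRep F K σ (red (z / y)) := by
  have hy0 := ne_zero_of_normVal_eq hy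
  have h1 : σ z / y = teichmuller K p (χ σ) * σ (z / y) := by
    rw [map_div₀, hχ]
    have := teichmuller_ne_zero (K := K) p (χ σ)
    field_simp
  have h2 := div_mem_primePow_zero hy hz
  rw [h1, red_mul (mem_primePow_of_normVal_eq_one (normVal_teichmuller p _))
    (apply_mem_primePow σ h2), red_teichmuller, red_apply σ h2]

theorem red_algebraMap_mul_div (hy : normVal K y = exp (-i)) (a : 𝒪[F]) {z : K}
    (hz : z ∈ primePow K i) :
    red (algebraMap F K a * z / y) = IsLocalRing.residue 𝒪[F] a • red (z / y) := by
  rw [mul_div_assoc, red_mul (algebraMap_mem_primePow (coe_mem_primePow a))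
    (div_mem_primePow_zero hy hz), red_algebraMap (coe_mem_primePow a), Algebra.smul_def, red_coe]

end LeadingCoefficient

/-! ### The filtered module `K/℘(K)` -/

section ArtinSchreier

variable {p : ℕ} [Fact p.Prime]
variable {F : Type*} [Field F] [ValuativeRel F] [TopologicalSpace F] [IsNonarchimedeanLocalField F]
variable {K : Type*} [Field K] [ValuativeRel K] [TopologicalSpace K] [IsNonarchimedeanLocalField K]
variable [Algebra F K] [ValuativeExtension F K] [CharP 𝓀[K] p]

open Polynomial in
/-- Hensel's lemma for the polynomials congruent to `Xᵖ - X - z`. -/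
theorem exists_pow_sub_eq (R : 𝒪[K][X]) (hdeg : R.degree < p)
    (hR : ∀ a, IsLocalRing.residue 𝒪[K] (R.eval a) = IsLocalRing.residue 𝒪[K] a)
    (hR' : ∀ a, IsLocalRing.residue 𝒪[K] (R.derivative.eval a) = 1)
    {z : 𝒪[K]} {r : 𝓀[K]} (h : r ^ p - r = IsLocalRing.residue 𝒪[K] z) :
    ∃ x : 𝒪[K], x ^ p - R.eval x = z ∧ IsLocalRing.residue 𝒪[K] x = r := by
  obtain ⟨a, rfl⟩ := IsLocalRing.residue_surjective r
  have hp : 0 < p := (Fact.out : p.Prime).pos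
  obtain ⟨x, hx, hxr⟩ := exists_root_of_residue (X ^ p - (R + C z))
    (monic_X_pow_sub ((degree_add_le _ _).trans_lt (max_lt hdeg
      (degree_C_le.trans_lt (by exact_mod_cast hp))))) a
    (by simp [hR, ← h])
    (by simp [hR', derivative_X_pow, CharP.cast_eq_zero])
  refine ⟨x, ?_, hxr⟩
  simp only [eval_sub, eval_pow, eval_X, eval_add, eval_C] at hx
  linear_combination hx

theorem exists_artinSchreier_eq {z : K} (hz : z ∈ primePow K 0) {r : 𝓀[K]} (h : r ^ p - r = red z) :
    ∃ x : K, x ^ p - x = z := by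
  rw [red_of_mem hz] at h
  obtain ⟨x, hx, -⟩ := exists_pow_sub_eq (p := p) Polynomial.X
    (Polynomial.degree_X.trans_lt (by exact_mod_cast (Fact.out : p.Prime).one_lt)) (by simp) (by simp) h
  refine ⟨x, ?_⟩
  simpa using congrArg Subtype.val hx

theorem normVal_pow_sub_self {x : K} {j : ℤ} (hj : j < 0) (hx : normVal K x = exp (-j)) :
    normVal K (x ^ p - x) = exp (-(p * j)) := by
  have hp : (1 : ℤ) < p := by exact_mod_cast (Fact.out : p.Prime).one_lt
  have h1 := normVal_pow hx p
  rw [Valuation.map_sub_eq_of_lt_left, h1]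
  rw [h1, hx, exp_lt_exp]
  nlinarith

theorem mem_of_pow_sub_self_mem {x : K} (h : x ^ p - x ∈ primePow K 0) : x ∈ primePow K 0 := by
  by_cases hx0 : x = 0
  · rw [hx0]
    exact zero_mem _
  obtain ⟨j, hj⟩ := exists_normVal_eq hx0
  rcases le_or_gt 0 j with hj0 | hj0
  · exact primePow_anti hj0 (mem_primePow_of_normVal_eq hj)
  · have hp : (0 : ℤ) < p := by exact_mod_cast (Fact.out : p.Prime).pos
    rw [mem_primePow, normVal_pow_sub_self hj0 hj, exp_le_exp] at h
    nlinarith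

variable [CharP K p]

theorem addMk_eq_iff {z z' : K} : addMk p K z = addMk p K z' ↔ ∃ x : K, x ^ p - x = z - z' := by
  rw [← sub_eq_zero, ← map_sub]
  exact (QuotientAddGroup.eq_zero_iff _)

theorem addMk_eq_zero_iff {z : K} : addMk p K z = 0 ↔ ∃ x : K, x ^ p - x = z := by
  rw [← map_zero (addMk p K), addMk_eq_iff, sub_zero]

theorem mem_addStep {n : ℤ} {x : AddMod p K} :
    x ∈ (addStep p F K n).toSubmodule ↔ ∃ z ∈ primePow K n, addMk p K z = x := Iff.rfl

theorem addStep_anti {m n : ℤ} (h : m ≤ n) :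
    (addStep p F K n).toSubmodule ≤ (addStep p F K m).toSubmodule := by
  intro x hx
  rw [mem_addStep] at hx ⊢
  obtain ⟨z, hz, rfl⟩ := hx
  exact ⟨z, primePow_anti h hz, rfl⟩

theorem addMk_eq_zero_of_mem {z : K} (hz : z ∈ primePow K 1) : addMk p K z = 0 := by
  have hz0 := primePow_anti zero_le_one hz
  refine addMk_eq_zero_iff.2 (exists_artinSchreier_eq (r := 0) hz0 ?_)
  rw [(red_eq_zero_iff hz0).2 hz, zero_pow (Fact.out : p.Prime).ne_zero, sub_zero]

theorem isBoundedFil_addFil : IsBoundedFil (addRep p F K) (addFil p F K) := by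
  refine ⟨fun m n hmn => addStep_anti (by omega), fun m σ x hx =>
    (addStep p F K (-m)).apply_mem_toSubmodule σ hx, fun m hm => eq_bot_iff.2 fun x hx => ?_,
    fun x => ?_⟩
  · obtain ⟨z, hz, rfl⟩ := mem_addStep.1 hx
    exact addMk_eq_zero_of_mem (primePow_anti (by omega) hz)
  · obtain ⟨z, rfl⟩ := addMk_surjective p K x
    by_cases hz : z = 0
    · exact ⟨0, by rw [hz, map_zero]; exact zero_mem _⟩
    · obtain ⟨n, hn⟩ := exists_normVal_eq hz
      exact ⟨-n, mem_addStep.2 ⟨z, by rw [neg_neg]; exact mem_primePow_of_normVal_eq hn, rfl⟩⟩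

/-- In negative degrees prime to `p`, the graded pieces of `K/℘(K)` and of `K` agree. -/
theorem sub_mem_primePow_of_addMk_eq {i : ℤ} (hi : i < 0) (hp : ¬ (p : ℤ) ∣ i) {z z' : K}
    (hz : z ∈ primePow K i) (hz' : z' ∈ primePow K i) (h : addMk p K z = addMk p K z') :
    z - z' ∈ primePow K (i + 1) := by
  obtain ⟨x, hx⟩ := addMk_eq_iff.1 h
  by_contra hcon
  have hv := normVal_eq_iff.2 ⟨sub_mem hz hz', hcon⟩
  rw [← hx] at hcon hv
  by_cases hx0 : x ∈ primePow K 0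
  · refine hcon (primePow_anti (show i + 1 ≤ 0 by omega) (sub_mem ?_ hx0))
    simpa using pow_mem_primePow hx0 p
  · obtain ⟨j, hj⟩ := exists_normVal_eq (x := x) (by rintro rfl; exact hx0 (zero_mem _))
    have hj0 : j < 0 := by
      by_contra! hj0
      exact hx0 (primePow_anti hj0 (mem_primePow_of_normVal_eq hj))
    rw [normVal_pow_sub_self hj0 hj, exp_inj, neg_inj] at hv
    exact hp ⟨j, hv.symm⟩

/-- The coordinate on a graded piece of negative degree prime to `p`, obtained by dividing by an
eigenvector of the right valuation. -/
theorem exists_gradedCoord_add {i : ℤ} (hi : i < 0) (hp : ¬ (p : ℤ) ∣ i) {y : K}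
    (hy : normVal K y = exp (-i)) {χ : Gal(K/F) →* (ZMod p)ˣ}
    (hχ : ∀ σ, σ y = teichmuller K p (χ σ) * y) :
    ∃ θ : AddMod p K → 𝓀[K], (∀ z ∈ primePow K i, θ (addMk p K z) = red (z / y)) ∧
      IsGradedCoord (addRep p F K) (addStep p F K i).toSubmodule (addStep p F K (i + 1)).toSubmodule
        (fun σ w => unitsCast p 𝓀[K] (χ σ) * residueRep F K σ w) θ := by
  obtain ⟨θ, hθ⟩ := exists_factorization_on (addMk p K) (primePow K i : Set K)
    (fun z => red (z / y)) fun z hz z' hz' h =>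
      (red_div_eq_iff hy hz hz').2 (sub_mem_primePow_of_addMk_eq hi hp hz hz' h)
  refine ⟨θ, hθ, ?_, ?_, ?_, ?_⟩
  · rintro _ ⟨z, hz, rfl⟩ _ ⟨z', hz', rfl⟩
    rw [← map_add, hθ _ (add_mem hz hz'), hθ z hz, hθ z' hz', red_div_add hy hz hz']
  · rintro _ ⟨z, hz, rfl⟩ σ
    rw [addRep_mk, hθ _ (apply_mem_primePow σ hz), hθ z hz, red_apply_div hy hχ σ hz]
  · rintro _ ⟨z, hz, rfl⟩
    rw [hθ z hz, red_div_eq_zero_iff hy hz]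
    refine ⟨fun h => ⟨z, h, rfl⟩, ?_⟩
    rintro ⟨z', hz', h⟩
    have h1 := sub_mem_primePow_of_addMk_eq hi hp hz (primePow_anti (by omega) hz') h.symm
    simpa using add_mem h1 hz'
  · intro w
    obtain ⟨z, hz, hzw⟩ := exists_red_div_eq hy w
    exact ⟨addMk p K z, ⟨z, hz, rfl⟩, by rw [hθ z hz, hzw]⟩

/-- The coordinate on the graded piece of degree `0`: the trace of the reduction. -/
theorem exists_gradedCoord_add_zero :
    ∃ θ : AddMod p K → ZMod p, IsGradedCoord (addRep p F K) (addStep p F K 0).toSubmodule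
      (addStep p F K 1).toSubmodule (fun _ w => w) θ := by
  obtain ⟨tr, htr, hker, hinv, -⟩ := exists_trace p 𝓀[K]
  obtain ⟨θ, hθ⟩ := exists_factorization_on (addMk p K) (primePow K 0 : Set K)
    (fun z => tr (red z)) fun z hz z' hz' h => by
      obtain ⟨x, hx⟩ := addMk_eq_iff.1 h
      have hx0 : x ∈ primePow K 0 := mem_of_pow_sub_self_mem (p := p) (by
        rw [hx]; exact sub_mem hz hz')
      rw [← sub_eq_zero, ← map_sub, ← red_sub hz hz', hker]
      refine ⟨red x, ?_⟩
      rw [← red_pow hx0, ← red_sub (by simpa using pow_mem_primePow hx0 p) hx0, hx]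
  refine ⟨θ, ?_, ?_, ?_, ?_⟩
  · rintro _ ⟨z, hz, rfl⟩ _ ⟨z', hz', rfl⟩
    rw [← map_add, hθ _ (add_mem hz hz'), hθ z hz, hθ z' hz', red_add hz hz', map_add]
  · rintro _ ⟨z, hz, rfl⟩ σ
    rw [addRep_mk, hθ _ (apply_mem_primePow σ hz), hθ z hz, red_apply σ hz]
    exact hinv (IsLocalRing.ResidueField.mapEquiv (integerEquiv (σ : K ≃+* K))) _
  · rintro _ ⟨z, hz, rfl⟩
    rw [hθ z hz, hker]
    constructor
    · rintro ⟨r, hr⟩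
      rw [addMk_eq_zero_iff.2 (exists_artinSchreier_eq hz hr)]
      exact zero_mem _
    · rintro ⟨z', hz', h⟩
      rw [← hker, ← hθ z hz, ← h, addMk_eq_zero_of_mem hz', ← map_zero (addMk p K),
        hθ 0 (zero_mem _), (red_eq_zero_iff (zero_mem _)).2 (zero_mem _), map_zero]
  · intro w
    obtain ⟨r, rfl⟩ := htr w
    obtain ⟨z, hz, rfl⟩ := exists_red_eq r
    exact ⟨addMk p K z, ⟨z, hz, rfl⟩, hθ z hz⟩

/-- In degrees divisible by `p` the graded piece vanishes: modulo `℘(K)`, a `p`-th power `cᵖ` is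
equivalent to `c`, which has a smaller pole. -/
theorem addStep_le_of_dvd {j : ℤ} (hj : j < 0) :
    (addStep p F K (p * j)).toSubmodule ≤ (addStep p F K (p * j + 1)).toSubmodule := by
  rintro _ ⟨z, hz, rfl⟩
  have hp : (2 : ℤ) ≤ p := by exact_mod_cast (Fact.out : p.Prime).two_le
  obtain ⟨c, hc, hzc⟩ := exists_sub_pow_mem p hz
  refine ⟨z - c ^ p + c, add_mem hzc (primePow_anti (by nlinarith) hc), ?_⟩
  rw [addMk_eq_iff]
  have h : (-c) ^ p = -c ^ p := map_neg (frobenius K p) c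
  exact ⟨-c, by rw [h]; ring⟩

end ArtinSchreier

/-! ### Characteristic `p` -/

section CharP

variable {p : ℕ} [Fact p.Prime]
variable {F : Type*} [Field F] [ValuativeRel F] [TopologicalSpace F] [IsNonarchimedeanLocalField F]
variable {K : Type*} [Field K] [ValuativeRel K] [TopologicalSpace K] [IsNonarchimedeanLocalField K]
variable [Algebra F K] [ValuativeExtension F K] [CharP 𝓀[K] p] [CharP 𝓀[F] p]

omit [CharP 𝓀[K] p] in
theorem lineRep_apply {G : Type*} [Group G] (χ : G →* (ZMod p)ˣ) (σ : G) (w : ZMod p) :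
    lineRep p χ σ w = (χ σ : ZMod p) * w := by
  change ZMod.castHom (dvd_refl p) (ZMod p) (χ σ : ZMod p) • w = _
  rw [ZMod.castHom_self, RingHom.id_apply, smul_eq_mul]

theorem twist_residueRep_apply (χ : Gal(K/F) →* (ZMod p)ˣ) (σ : Gal(K/F)) (w : 𝓀[K]) :
    twist p (residueRep F K) χ σ w = unitsCast p 𝓀[K] (χ σ) * residueRep F K σ w :=
  castHom_smul _ _

omit [CharP 𝓀[K] p] [CharP 𝓀[F] p] in
/-- In characteristic `p` the only `p`-th root of `1` is `1`. -/
theorem omega_eq_one [CharP K p] : omega p F K = 1 := by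
  rw [omega, dif_neg]
  intro h
  have h1 : ∀ u : rootsOfUnity p K, u = 1 := fun u => by
    have hu : ((u : Kˣ) : K) ^ p = 1 := by
      have := (mem_rootsOfUnity p (u : Kˣ)).1 u.2
      simpa using congrArg Units.val this
    have h2 : (((u : Kˣ) : K) - 1) ^ p = 0 := by
      rw [sub_pow_char, hu, one_pow, sub_self]
    exact Subtype.ext (Units.ext (sub_eq_zero.1 (pow_eq_zero_iff (Fact.out : p.Prime).ne_zero |>.1 h2)))
  have : Subsingleton (rootsOfUnity p K) := ⟨fun u v => (h1 u).trans (h1 v).symm⟩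
  have h3 := Finite.card_le_one_iff_subsingleton (α := rootsOfUnity p K) |>.2 this
  rw [h] at h3
  exact absurd (Fact.out : p.Prime).one_lt (not_lt.2 h3)

variable (hK : IsAdjoinRoots F K (p - 1))
include hK

theorem charVal_one : charVal p F K 1 = 0 := by
  have h := charVal_eq_of_eigenvector hK (χ := (1 : Gal(K/F) →* (ZMod p)ˣ)) (y := 1) (i := 0)
    (by rw [map_one, neg_zero, exp_zero]) fun σ => by
      rw [map_one, MonoidHom.one_apply, map_one, mul_one]
  simpa using h

variable [CharP K p]

theorem addGradedIso {ξ : ℤ → (Gal(K/F) →* (ZMod p)ˣ)} (hξ : ∀ i : ℤ, charVal p F K (ξ i) = i)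
    {i : ℤ} (hi : i < 0) (hp : ¬ (p : ℤ) ∣ i) :
    AddGradedIso p F K i (twist p (residueRep F K) (ξ i)) := by
  obtain ⟨y, hy, hχ⟩ := exists_eigenvector_of_charVal hK (hξ i)
  obtain ⟨θ, hθ, hcoord⟩ := exists_gradedCoord_add hi hp hy hχ
  obtain ⟨e, he, hact⟩ := hcoord.exists_equiv
  obtain ⟨hmod, hsmul, ρ, hρ, hiso⟩ := exists_module_of_addEquiv e (twist p (residueRep F K) (ξ i))
    (fun σ x => gradedRep (addStep p F K i) (addStep p F K (i + 1)) σ x) fun σ x => by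
      rw [hact, twist_residueRep_apply]
  refine ⟨hmod, fun a x z hx hz hzx => e.injective ?_, ρ, hρ, hiso⟩
  rw [hsmul, addGradedMk, addGradedMk, he, he, hθ x hx, hθ z hz, hzx, red_algebraMap_mul_div hy a hx]

theorem filteredIso_addRep {ξ : ℤ → (Gal(K/F) →* (ZMod p)ˣ)}
    (hξ : ∀ i : ℤ, charVal p F K (ξ i) = i) :
    FilteredIso (addRep p F K) (addFil p F K) (addModel p F K ξ) (addModelFil p F K) := by
  have := finite_gal hK
  refine filteredIso_of_graded (not_dvd_card_gal hK) isBoundedFil_addFil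
    ((isBoundedFil_levelFil _ le_rfl).prod (isBoundedFil_directSum_block (fun i : ℕ => i) ξ))
    fun m => ?_
  have hfil : ∀ n : ℤ, addFil p F K (n - 1) = (addStep p F K (-n + 1)).toSubmodule := fun n => by
    rw [addFil, neg_sub, sub_eq_add_neg, add_comm]
  have hle : ∀ n : ℤ, addFil p F K (n - 1) ≤ addFil p F K n := fun n => by
    rw [hfil]
    exact addStep_anti (by omega)
  rcases Nat.eq_zero_or_pos m with rfl | hm
  -- level `0`: the line `𝔽_p`
  · obtain ⟨θ, hθ⟩ := exists_gradedCoord_add_zero (p := p) (F := F) (K := K)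
    refine hasGradedLift_of_summand (hle _) (act := fun _ w => w)
      (AddMonoidHom.inl (ZMod p) (⨁ _ : ℕ, Block p F K)) (AddMonoidHom.fst _ _) (fun w => rfl)
      (fun σ w => Prod.ext ?_ ?_) (fun w => ⟨mem_levelFil.2 fun h => ?_, zero_mem _⟩) (fun z => ?_)
      (θ := θ) ?_
    · change w = lineRep p 1 σ w
      rw [lineRep_apply, MonoidHom.one_apply, Units.val_one, one_mul]
    · exact (map_zero (Representation.directSum (fun i : ℕ => blockRepFp p F K ξ i) σ)).symm
    · exact absurd h (by simp)
    · have h0 : directSumFil (fun i : ℕ => blockFilFp p F K i) ((0 : ℕ) : ℤ) ≤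
          directSumFil (fun i : ℕ => blockFilFp p F K i) (((0 : ℕ) : ℤ) - 1) :=
        directSumFil_le_sub_one (c := fun i : ℕ => i) fun i j => (level_pos i j).ne'
      have h1 := (isBoundedFil_directSum_block (p := p) (F := F) (K := K) (fun i : ℕ => i) ξ).mono
        (show ((0 : ℕ) : ℤ) - 1 ≤ ((0 : ℕ) : ℤ) by omega)
      exact ⟨fun h => ⟨⟨mem_levelFil.2 fun h => absurd h (by simp), h1 h.2⟩,
        mem_levelFil.1 h.1 (by omega)⟩,
        fun h => ⟨mem_levelFil.2 fun _ => h.2, h0 h.1.2⟩⟩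
    · rw [hfil, addFil]
      exact hθ
  have hlevel : ∀ {z : ZMod p} {n : ℤ}, 0 ≤ n → z ∈ (levelFil 0 n : Submodule (ZMod p) (ZMod p)) :=
    fun hn => mem_levelFil.2 fun h => absurd h (not_lt.2 hn)
  -- positive levels: nothing if `p` divides the level, a summand of a block otherwise
  by_cases hp : (p : ℤ) ∣ m
  · obtain ⟨j, hj⟩ := hp
    have hj0 : -j < 0 := by
      have hp : (0 : ℤ) < p := by exact_mod_cast (Fact.out : p.Prime).pos
      have : 0 < (p : ℤ) * j := hj ▸ (by exact_mod_cast hm)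
      have := pos_of_mul_pos_right this hp.le
      omega
    refine hasGradedLift_of_eq ?_ fun z hz => ⟨hlevel (by omega), ?_⟩
    · rw [hfil, addFil, hj, ← mul_neg]
      exact addStep_le_of_dvd hj0
    · refine directSumFil_le_sub_one (c := fun i : ℕ => i) (fun i j' h => ?_) hz.2
      exact not_dvd_level i j' (h ▸ ⟨j, hj⟩)
  · obtain ⟨i, j, hij⟩ := exists_level_eq (p := p) (m := m) (by exact_mod_cast hm) hp
    have hval : charVal p F K (ξ (-level p i j) * omega p F K) = ((-m : ℤ) : ZMod (p - 1)) := by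
      rw [charVal_mul hK, omega_eq_one, charVal_one hK, add_zero, hξ, hij]
    obtain ⟨y, hy, hχ⟩ := exists_eigenvector_of_charVal hK hval
    obtain ⟨θ, -, hθ⟩ := exists_gradedCoord_add (F := F) (i := -m) (by omega) (by rwa [dvd_neg]) hy hχ
    refine hasGradedLift_of_summand (hle _)
      ((AddMonoidHom.inr (ZMod p) _).comp (blockIncl p F K i j))
      ((blockProj p F K i j).comp (AddMonoidHom.snd _ _)) (fun w => ?_)
      (fun σ w => Prod.ext ?_ ?_) (fun w => ⟨zero_mem _, ?_⟩) (fun z => ?_)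
      (θ := θ) (by rw [hfil, addFil]; exact hθ)
    · exact blockIncl_apply_self i j w
    · exact (map_zero (lineRep p (1 : Gal(K/F) →* (ZMod p)ˣ) σ)).symm
    · exact blockIncl_act (fun i : ℕ => i) ξ σ i j w
    · rw [← hij]
      exact blockIncl_mem (fun i : ℕ => i) i j w
    · have h := mem_directSumFil_sub_one_iff (F := F) (c := fun i : ℕ => i) Function.injective_id i j z.2
      simp only [hij] at h
      exact ⟨fun hz => ⟨⟨hlevel (by omega), (h.1 hz.2).1⟩, (h.1 hz.2).2⟩,
        fun hz => ⟨hlevel (by omega), h.2 ⟨hz.1.2, hz.2⟩⟩⟩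

end CharP

/-! ### `p`-th powers of units in characteristic zero -/

section PthPowers

variable {p : ℕ} [Fact p.Prime]
variable {K : Type*} [Field K] [ValuativeRel K] [TopologicalSpace K] [IsNonarchimedeanLocalField K]
variable [CharP 𝓀[K] p]

open Polynomial in
/-- With `π^(p-1) = -p`, the substitution `u = 1 + π x` turns `uᵖ - 1` into `πᵖ` times a polynomial
congruent to `xᵖ - x`. -/
theorem exists_one_add_mul_pow_sub_one_eq {π : 𝒪[K]} (hπ : π ^ (p - 1) = -(p : 𝒪[K])) :
    ∃ R : 𝒪[K][X], R.degree < p ∧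
      (∀ a, IsLocalRing.residue 𝒪[K] (R.eval a) = IsLocalRing.residue 𝒪[K] a) ∧
      (∀ a, IsLocalRing.residue 𝒪[K] (R.derivative.eval a) = 1) ∧
      ∀ x, (1 + π * x) ^ p - 1 = π ^ p * (x ^ p - R.eval x) := by
  have hp := (Fact.out : p.Prime)
  have hp1 : p - 1 + 1 = p := Nat.sub_add_cancel hp.one_le
  have hπ0 : IsLocalRing.residue 𝒪[K] π = 0 := by
    have h := congrArg (IsLocalRing.residue 𝒪[K]) hπ
    rw [map_pow, map_neg, map_natCast, CharP.cast_eq_zero, neg_zero] at h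
    exact pow_eq_zero_iff (NeZero.ne (p - 1)) |>.1 h
  have hc0 : p / p = 1 := Nat.div_self hp.pos
  have h0 : 0 ∈ Finset.range (p - 1) :=
    Finset.mem_range.2 (Nat.sub_pos_of_lt hp.one_lt)
  refine ⟨∑ i ∈ Finset.range (p - 1), C ((p.choose (i + 1) / p : ℕ) * π ^ i) * X ^ (i + 1),
    ?_, fun a => ?_, fun a => ?_, fun x => ?_⟩
  · refine (degree_sum_le _ _).trans_lt ((Finset.sup_lt_iff (by
      exact WithBot.bot_lt_coe _)).2 fun i hi => ?_)
    refine (degree_C_mul_X_pow_le _ _).trans_lt ?_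
    have := Finset.mem_range.1 hi
    exact_mod_cast (show i + 1 < p by omega)
  · rw [eval_finsetSum, map_sum, Finset.sum_eq_single_of_mem 0 h0]
    · simp [hc0]
    · intro i _ hi
      simp [hπ0, hi]
  · simp only [derivative_sum, derivative_C_mul_X_pow]
    rw [eval_finsetSum, map_sum, Finset.sum_eq_single_of_mem 0 h0]
    · simp [hc0]
    · intro i _ hi
      simp [hπ0, hi]
  · -- the binomial coefficient `p d` contributes `p d π^(i+1) = -πᵖ d π^i`
    have hterm : ∀ i ∈ Finset.range (p - 1), (π * x) ^ (i + 1) * 1 ^ (p - (i + 1)) *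
        (p.choose (i + 1) : 𝒪[K]) =
        -(π ^ p * eval x (C ((p.choose (i + 1) / p : ℕ) * π ^ i) * X ^ (i + 1) : 𝒪[K][X])) := by
      intro i hi
      have hi' := Finset.mem_range.1 hi
      obtain ⟨d, hd⟩ := hp.dvd_choose_self (Nat.succ_ne_zero i) (by omega : i + 1 < p)
      have hπp : π ^ p = -(p : 𝒪[K]) * π := by rw [← hπ, ← pow_succ, hp1]
      simp only [Nat.succ_eq_add_one] at hd
      rw [hd, Nat.mul_div_cancel_left _ hp.pos, hπp]
      simp only [eval_mul, eval_C, eval_pow, eval_X]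
      push_cast
      ring
    -- in the binomial expansion, the first and the last term are `1` and `(π x)ᵖ`
    rw [add_comm 1 (π * x), add_pow, Finset.sum_range_succ, ← hp1, Finset.sum_range_succ', hp1,
      Finset.sum_congr rfl hterm, eval_finsetSum, Finset.sum_neg_distrib, ← Finset.mul_sum]
    simp
    ring

/-- The factorisation of `(1 + z)ᵖ - 1` that governs its valuation. -/
theorem exists_one_add_pow_eq {z : K} (hz : z ∈ primePow K 0) :
    ∃ s ∈ primePow K 0, (1 + z) ^ p = 1 + z ^ p + p * z * s := by
  obtain ⟨r, hr⟩ := exists_add_pow_prime_eq (Fact.out : p.Prime) (1 : 𝒪[K]) ⟨z, mem_integer hz⟩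
  refine ⟨r, coe_mem_primePow r, ?_⟩
  have := congrArg Subtype.val hr
  simpa using this

variable {e : ℕ} {π : K}

theorem normVal_natCast_of_pow_eq (hπ : π ^ (p - 1) = -(p : K)) (hπv : normVal K π = exp (-(e : ℤ))) :
    normVal K (p : K) = exp (-((p - 1 : ℕ) * (e : ℤ))) := by
  rw [← normVal_pow hπv, hπ, Valuation.map_neg]

theorem pos_of_normVal_eq (hπ : π ^ (p - 1) = -(p : K)) (hπv : normVal K π = exp (-(e : ℤ))) :
    0 < e := by
  have h := (mem_primePow K).1 (natCast_mem_primePow_one (K := K) p)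
  rw [normVal_natCast_of_pow_eq hπ hπv, exp_le_exp] at h
  by_contra! h0
  rw [Nat.le_zero.1 h0] at h
  simp at h

theorem natCast_mul_mem_primePow (hπ : π ^ (p - 1) = -(p : K))
    (hπv : normVal K π = exp (-(e : ℤ))) {j : ℤ} {z s : K} (hz : z ∈ primePow K j)
    (hs : s ∈ primePow K 0) : p * z * s ∈ primePow K ((p - 1 : ℕ) * (e : ℤ) + j) := by
  have h := mul_mem_primePow (mul_mem_primePow
    (mem_primePow_of_normVal_eq (normVal_natCast_of_pow_eq hπ hπv)) hz) hs
  rwa [add_zero] at h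

variable (p) in
theorem cast_sub_one_mul (e : ℤ) : ((p - 1 : ℕ) : ℤ) * e = p * e - e := by
  rw [Nat.cast_sub (Fact.out : p.Prime).one_le, Nat.cast_one]
  ring

/-- For `v(z) < e` the term `zᵖ` dominates the term `p z s` in `(1 + z)ᵖ - 1`. -/
theorem normVal_one_add_pow_sub_one (hπ : π ^ (p - 1) = -(p : K))
    (hπv : normVal K π = exp (-(e : ℤ))) {j : ℤ} (hj0 : 0 ≤ j) (hj : j < e) {z : K}
    (hz : normVal K z = exp (-j)) : normVal K ((1 + z) ^ p - 1) = exp (-(p * j)) := by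
  have hp : (2 : ℤ) ≤ p := by exact_mod_cast (Fact.out : p.Prime).two_le
  have hzj := mem_primePow_of_normVal_eq hz
  obtain ⟨s, hs, h⟩ := exists_one_add_pow_eq (p := p) (primePow_anti hj0 hzj)
  have h1 := natCast_mul_mem_primePow hπ hπv hzj hs
  have h2 := normVal_pow hz p
  rw [h, show 1 + z ^ p + p * z * s - 1 = z ^ p + p * z * s by ring, Valuation.map_add_eq_of_lt_left,
    h2]
  rw [h2, normVal_lt_iff]
  refine primePow_anti ?_ h1
  rw [cast_sub_one_mul]
  nlinarith

theorem one_add_pow_sub_one_mem (hπ : π ^ (p - 1) = -(p : K))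
    (hπv : normVal K π = exp (-(e : ℤ))) {z : K} (hz : z ∈ primePow K e) :
    (1 + z) ^ p - 1 ∈ primePow K (p * e) := by
  obtain ⟨s, hs, h⟩ := exists_one_add_pow_eq (p := p) (primePow_anti (by omega) hz)
  have h1 := natCast_mul_mem_primePow hπ hπv hz hs
  rw [cast_sub_one_mul, sub_add_cancel] at h1
  rw [h, show 1 + z ^ p + p * z * s - 1 = z ^ p + p * z * s by ring]
  exact add_mem (pow_mem_primePow hz p) h1

theorem sub_one_mem_of_pow {t : K} (ht : t ^ p - 1 ∈ primePow K 1) : t - 1 ∈ primePow K 1 := by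
  have hp := (Fact.out : p.Prime).ne_zero
  have h0 : t ^ p ∈ primePow K 0 := by
    simpa using add_mem (primePow_anti zero_le_one ht) one_mem_primePow
  have ht0 : t ∈ primePow K 0 := by
    rw [mem_primePow_zero, map_pow] at h0
    exact mem_primePow_zero.2 ((pow_le_one_iff hp).1 h0)
  rw [← red_eq_red_iff h0 one_mem_primePow, red_pow ht0, red_one] at ht
  rw [← red_eq_red_iff ht0 one_mem_primePow, red_one, ← sub_eq_zero, ← pow_eq_zero_iff hp, sub_pow_char, ht,
    one_pow, sub_self]

/-- The valuation of `tᵖ - 1`, where `t` is a principal unit, is a multiple of `p` or at least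
`pe`. -/
theorem pow_sub_one_mem_succ (hπ : π ^ (p - 1) = -(p : K)) (hπv : normVal K π = exp (-(e : ℤ)))
    {i : ℤ} (hi : 0 < i) (hie : i < p * e) (hp : ¬ (p : ℤ) ∣ i) {t : K}
    (ht : t ^ p - 1 ∈ primePow K i) : t ^ p - 1 ∈ primePow K (i + 1) := by
  have h1 := sub_one_mem_of_pow (primePow_anti hi ht)
  by_cases ht1 : t - 1 = 0
  · rw [sub_eq_zero.1 ht1, one_pow, sub_self]
    exact zero_mem _
  obtain ⟨j, hj⟩ := exists_normVal_eq ht1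
  have hj0 : 0 ≤ j := by
    rw [mem_primePow, hj, exp_le_exp] at h1
    omega
  rcases lt_or_ge j e with hje | hje
  · have h2 := normVal_one_add_pow_sub_one hπ hπv hj0 hje hj
    rw [add_sub_cancel] at h2
    by_contra hcon
    have h3 := normVal_eq_iff.2 ⟨ht, hcon⟩
    rw [h2, exp_inj, neg_inj] at h3
    exact hp ⟨j, h3.symm⟩
  · have h2 := one_add_pow_sub_one_mem hπ hπv (primePow_anti hje (mem_primePow_of_normVal_eq hj))
    rw [add_sub_cancel] at h2
    exact primePow_anti (by omega) h2

/-- A `p`-th power in `U_{pe}` is the `p`-th power of an element of `U_e`. -/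
theorem sub_one_mem_of_pow_sub_one_mem (hπ : π ^ (p - 1) = -(p : K))
    (hπv : normVal K π = exp (-(e : ℤ))) {t : K} (ht : t ^ p - 1 ∈ primePow K (p * e)) :
    t - 1 ∈ primePow K e := by
  have hp : (2 : ℤ) ≤ p := by exact_mod_cast (Fact.out : p.Prime).two_le
  have he : (1 : ℤ) ≤ e := by exact_mod_cast pos_of_normVal_eq hπ hπv
  have h1 := sub_one_mem_of_pow (primePow_anti (show (1 : ℤ) ≤ p * e by nlinarith) ht)
  by_cases ht1 : t - 1 = 0
  · rw [ht1]
    exact zero_mem _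
  obtain ⟨j, hj⟩ := exists_normVal_eq ht1
  have hj0 : 0 ≤ j := by
    rw [mem_primePow, hj, exp_le_exp] at h1
    omega
  rcases lt_or_ge j e with hje | hje
  · have h2 := normVal_one_add_pow_sub_one hπ hπv hj0 hje hj
    rw [add_sub_cancel] at h2
    rw [mem_primePow, h2, exp_le_exp] at ht
    nlinarith
  · exact primePow_anti hje (mem_primePow_of_normVal_eq hj)

/-- A unit `1 + πᵖ w` is a `p`-th power if the residue of `w` is in the image of `x ↦ xᵖ - x`; the
root can be prescribed modulo `𝔭 π`. -/
theorem exists_one_add_mul_pow_eq (hπ : π ^ (p - 1) = -(p : K)) (hπv : normVal K π = exp (-(e : ℤ)))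
    {w : K} (hw : w ∈ primePow K 0) {r : 𝓀[K]} (h : r ^ p - r = red w) :
    ∃ x ∈ primePow K 0, red x = r ∧ (1 + π * x) ^ p = 1 + π ^ p * w := by
  have hπ0 : π ∈ primePow K 0 := primePow_anti (by omega) (mem_primePow_of_normVal_eq hπv)
  obtain ⟨R, hdeg, hR, hR', hRx⟩ := exists_one_add_mul_pow_sub_one_eq (K := K) (p := p)
    (π := ⟨π, mem_integer hπ0⟩) (Subtype.ext (by simpa using hπ))
  rw [red_of_mem hw] at h
  obtain ⟨x, hx, hxr⟩ := exists_pow_sub_eq R hdeg hR hR' h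
  refine ⟨x, coe_mem_primePow x, (red_coe x).trans hxr, ?_⟩
  have h1 := hRx x
  rw [hx] at h1
  have h2 := congrArg Subtype.val h1
  simp only [AddSubgroupClass.coe_sub, SubmonoidClass.coe_pow, AddMemClass.coe_add, OneMemClass.coe_one,
    MulMemClass.coe_mul] at h2
  linear_combination h2

/-- Modulo `𝔭`, the `p`-th power map from `U_e/U_{e+1}` to `U_{pe}/U_{pe+1}` is `x ↦ xᵖ - x`. -/
theorem red_one_add_mul_pow_sub_one_div (hπ : π ^ (p - 1) = -(p : K))
    (hπv : normVal K π = exp (-(e : ℤ))) {x : K} (hx : x ∈ primePow K 0) :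
    red (((1 + π * x) ^ p - 1) / π ^ p) = red x ^ p - red x := by
  have hπ0 : π ∈ primePow K 0 := primePow_anti (by omega) (mem_primePow_of_normVal_eq hπv)
  obtain ⟨R, -, hR, -, hRx⟩ := exists_one_add_mul_pow_sub_one_eq (K := K) (p := p)
    (π := ⟨π, mem_integer hπ0⟩) (Subtype.ext (by simpa using hπ))
  have h2 := congrArg Subtype.val (hRx ⟨x, mem_integer hx⟩)
  simp only [AddSubgroupClass.coe_sub, SubmonoidClass.coe_pow, AddMemClass.coe_add, OneMemClass.coe_one,
    MulMemClass.coe_mul] at h2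
  rw [h2, mul_div_cancel_left₀ _ (pow_ne_zero _ (ne_zero_of_normVal_eq hπv)),
    red_sub (by simpa using pow_mem_primePow hx p) (coe_mem_primePow _), red_pow hx, red_coe, hR,
    ← red_of_mem hx]

end PthPowers

/-! ### The cyclotomic character -/

section Cyclotomic

variable {p : ℕ} [Fact p.Prime]
variable {F : Type*} [Field F] [ValuativeRel F] [TopologicalSpace F] [IsNonarchimedeanLocalField F]
variable {K : Type*} [Field K] [ValuativeRel K] [TopologicalSpace K] [IsNonarchimedeanLocalField K]
variable [Algebra F K] [ValuativeExtension F K] [CharP 𝓀[K] p]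

theorem omega_spec {ζ : K} (hζ : IsPrimitiveRoot ζ p) (σ : Gal(K/F)) :
    σ ζ = ζ ^ (omega p F K σ : ZMod p).val := by
  have h := hζ.card_rootsOfUnity
  have h1 := modularCyclotomicCharacter.spec K h (σ : K ≃+* K) (hζ.toRootsOfUnity).2
  rw [omega, dif_pos h]
  exact h1

variable [CharP 𝓀[F] p] (hK : IsAdjoinRoots F K (p - 1))
include hK

/-- `ω` is the Kummer character of `-p`: for `ζ = 1 + π x` a primitive `p`-th root of `1`, the
residue of `(ζⁿ - 1) / π` is `n`. -/
theorem apply_eq_teichmuller_omega_mul {e : ℕ} {π : K} (hπ : π ^ (p - 1) = -(p : K))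
    (hπv : normVal K π = exp (-(e : ℤ))) (σ : Gal(K/F)) : σ π = teichmuller K p (omega p F K σ) * π := by
  have hπ0 := ne_zero_of_normVal_eq hπv
  obtain ⟨χ, hχ⟩ := exists_character (F := F) hπ0 (a := -(p : F)) (by rw [hπ, map_neg, map_natCast])
  obtain ⟨x, hx, hxr, hxp⟩ := exists_one_add_mul_pow_eq hπ hπv (w := 0) (zero_mem _) (r := 1)
    (by rw [one_pow, sub_self, (red_eq_zero_iff (zero_mem _)).2 (zero_mem _)])
  rw [mul_zero, add_zero] at hxp
  set ζ := 1 + π * x with hζ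
  have hζ1 : ζ - 1 = π * x := by rw [hζ]; ring
  have hζp : IsPrimitiveRoot ζ p := by
    have h1 : ζ ≠ 1 := fun h => by
      rw [← sub_eq_zero, hζ1, mul_eq_zero, or_iff_right hπ0] at h
      rw [h, (red_eq_zero_iff (zero_mem _)).2 (zero_mem _)] at hxr
      exact zero_ne_one hxr
    rw [← orderOf_eq_prime hxp h1]
    exact IsPrimitiveRoot.orderOf ζ
  have hζ0 : normVal K ζ = 1 := normVal_eq_one_of_pow_eq_one (Fact.out : p.Prime).ne_zero hxp
  have hζ0' := mem_primePow_of_normVal_eq_one hζ0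
  have hpe : (ζ - 1) ∈ primePow K e := by
    rw [hζ1]
    simpa using mul_mem_primePow (mem_primePow_of_normVal_eq hπv) hx
  have he : (1 : ℤ) ≤ e := by exact_mod_cast pos_of_normVal_eq hπ hπv
  have hζred : red ζ = 1 := by
    rw [← red_one K, red_eq_red_iff hζ0' one_mem_primePow]
    exact primePow_anti he hpe
  have hn : ∀ n : ℕ, ζ ^ n - 1 ∈ primePow K e ∧ red ((ζ ^ n - 1) / π) = n := by
    intro n
    induction n with
    | zero =>
      rw [pow_zero, sub_self, zero_div, Nat.cast_zero]
      exact ⟨zero_mem _, (red_eq_zero_iff (zero_mem _)).2 (zero_mem _)⟩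
    | succ n ih =>
      have h1 : ζ ^ (n + 1) - 1 = ζ * (ζ ^ n - 1) + (ζ - 1) := by ring
      have h2 : ζ * (ζ ^ n - 1) ∈ primePow K e := by simpa using mul_mem_primePow hζ0' ih.1
      rw [h1]
      refine ⟨add_mem h2 hpe, ?_⟩
      rw [red_div_add hπv h2 hpe, mul_div_assoc, red_mul hζ0' (div_mem_primePow_zero hπv ih.1), ih.2,
        hζred, hζ1, mul_div_cancel_left₀ _ hπ0, hxr, one_mul, Nat.cast_succ]
  have h1 := red_apply_div hπv hχ σ hpe
  rw [map_sub, map_one, omega_spec hζp, (hn _).2, hζ1, mul_div_cancel_left₀ _ hπ0, hxr,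
    ← red_one K, ← red_apply σ one_mem_primePow, map_one, red_one, mul_one] at h1
  have h2 : unitsCast p 𝓀[K] (omega p F K σ) = unitsCast p 𝓀[K] (χ σ) := by
    rw [← h1, unitsCast_apply, ZMod.castHom_apply, ZMod.cast_eq_val]
  rw [hχ, unitsCast_injective _ h2]

theorem charVal_omega {e : ℕ} {π : K} (hπ : π ^ (p - 1) = -(p : K))
    (hπv : normVal K π = exp (-(e : ℤ))) : charVal p F K (omega p F K) = (e : ℤ) :=
  charVal_eq_of_eigenvector hK hπv (apply_eq_teichmuller_omega_mul hK hπ hπv)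

omit [CharP 𝓀[K] p] in
theorem exists_pow_eq_neg_natCast {e : ℕ} (he : normVal F (p : F) = exp (-(e : ℤ))) :
    ∃ π : K, π ^ (p - 1) = -(p : K) ∧ normVal K π = exp (-(e : ℤ)) := by
  have := charP_residueField p F K
  obtain ⟨π, hπ⟩ := hK.exists_root (-(p : F))
  refine ⟨π, by rw [hπ, map_neg, map_natCast], (normVal_eq_of_pow_eq hK hπ).2 ?_⟩
  rw [Valuation.map_neg, he]

end Cyclotomic

/-! ### The filtered module `Kˣ/Kˣᵖ` -/

section Units

variable {p : ℕ} [Fact p.Prime]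
variable {F : Type*} [Field F] [ValuativeRel F] [TopologicalSpace F] [IsNonarchimedeanLocalField F]
variable {K : Type*} [Field K] [ValuativeRel K] [TopologicalSpace K] [IsNonarchimedeanLocalField K]
variable [Algebra F K] [ValuativeExtension F K]

omit [ValuativeRel K] [TopologicalSpace K] [IsNonarchimedeanLocalField K] in
theorem mulMk_eq_iff {u u' : Kˣ} : mulMk p K (Additive.ofMul u) = mulMk p K (Additive.ofMul u') ↔
    ∃ t : K, (u : K) = u' * t ^ p := by
  have h : mulMk p K (Additive.ofMul u) = mulMk p K (Additive.ofMul u') ↔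
      ∃ t : Kˣ, t ^ p = u'⁻¹ * u := by
    rw [eq_comm]
    exact QuotientGroup.eq
  rw [h]
  constructor
  · rintro ⟨t, ht⟩
    refine ⟨t, ?_⟩
    rw [← Units.val_pow_eq_pow_val, ht, ← Units.val_mul, mul_inv_cancel_left]
  · rintro ⟨t, ht⟩
    have ht0 : t ≠ 0 := by
      rintro rfl
      rw [zero_pow (Fact.out : p.Prime).ne_zero, mul_zero] at ht
      exact u.ne_zero ht
    refine ⟨Units.mk0 t ht0, ?_⟩
    rw [eq_inv_mul_iff_mul_eq]
    exact Units.ext (by simpa using ht.symm)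

theorem mem_mulStep {n : ℤ} (hn : 0 < n) {x : MulMod p K} : x ∈ (mulStep p F K n).toSubmodule ↔
    ∃ u ∈ unitGroup K n, mulMk p K (Additive.ofMul u) = x := by
  rw [mulStep, AddSubgroup.mem_toZModSubmodule, if_pos hn]
  exact Iff.rfl

theorem mulStep_eq_top {n : ℤ} (hn : n ≤ 0) : (mulStep p F K n).toSubmodule = ⊤ := by
  refine eq_top_iff.2 fun x _ => ?_
  rw [mulStep, AddSubgroup.mem_toZModSubmodule, if_neg (not_lt.2 hn)]
  trivial

theorem mulStep_anti {m n : ℤ} (h : m ≤ n) :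
    (mulStep p F K n).toSubmodule ≤ (mulStep p F K m).toSubmodule := by
  rcases le_or_gt m 0 with hm | hm
  · rw [mulStep_eq_top hm]
    exact le_top
  · intro x hx
    rw [mem_mulStep (hm.trans_le h)] at hx
    obtain ⟨u, hu, rfl⟩ := hx
    exact (mem_mulStep hm).2 ⟨u, ⟨hu.1, primePow_anti h hu.2⟩, rfl⟩

theorem exists_unitGroup_eq {n : ℤ} (hn : 0 < n) {z : K} (hz : z ∈ primePow K n) :
    ∃ u ∈ unitGroup K n, (u : K) - 1 = z := by
  have h1 : normVal K (1 + z) = 1 := Valuation.map_one_add_of_lt _ (by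
    have := normVal_lt_iff.2 (primePow_anti (show (0 : ℤ) + 1 ≤ n by omega) hz)
    rwa [neg_zero, exp_zero] at this)
  have h0 : 1 + z ≠ 0 := by
    intro h
    rw [h, map_zero] at h1
    exact zero_ne_one h1
  exact ⟨Units.mk0 _ h0, ⟨h1, by simpa using hz⟩, by simp⟩

/-- The map `u ↦ u - 1` is additive on `U_i` modulo `𝔭^{i+1}`. -/
theorem mul_sub_one_sub_mem {i : ℤ} (hi : 0 < i) {u u' : Kˣ} (hu : u ∈ unitGroup K i)
    (hu' : u' ∈ unitGroup K i) :
    ((u * u' : Kˣ) : K) - 1 - ((u - 1) + (u' - 1)) ∈ primePow K (i + 1) := by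
  rw [show ((u * u' : Kˣ) : K) - 1 - ((u - 1) + (u' - 1)) = (u - 1) * (u' - 1) by push_cast; ring]
  exact primePow_anti (by omega) (mul_mem_primePow hu.2 hu'.2)

variable [CharP 𝓀[K] p]

/-- The coordinate on a graded piece `Ū_i/Ū_{i+1}` obtained by composing `u ↦ (u - 1) / y mod 𝔭` with
an additive map `f` from the residue field, provided that the kernel of this composition corresponds
to the `p`-th powers. -/
theorem exists_gradedCoord_mul {L : Type*} [AddCommGroup L] {i : ℤ} (hi : 0 < i) {y : K}
    (hy : normVal K y = exp (-i)) {χ : Gal(K/F) →* (ZMod p)ˣ}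
    (hχ : ∀ σ, σ y = teichmuller K p (χ σ) * y) (f : 𝓀[K] →+ L) (hf : Function.Surjective f)
    {act : Gal(K/F) → L → L}
    (hact : ∀ σ w, f (unitsCast p 𝓀[K] (χ σ) * residueRep F K σ w) = act σ (f w))
    (hpow : ∀ t : K, t ^ p - 1 ∈ primePow K i → f (red ((t ^ p - 1) / y)) = 0)
    (hker : ∀ u ∈ unitGroup K i, f (red ((u - 1) / y)) = 0 →
      mulMk p K (Additive.ofMul u) ∈ (mulStep p F K (i + 1)).toSubmodule) :
    ∃ θ : MulMod p K → L,
      (∀ u ∈ unitGroup K i, θ (mulMk p K (Additive.ofMul u)) = f (red ((u - 1) / y))) ∧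
      IsGradedCoord (mulRep p F K) (mulStep p F K i).toSubmodule (mulStep p F K (i + 1)).toSubmodule
        act θ := by
  obtain ⟨θ, hθ⟩ := exists_factorization_on (fun u : Kˣ => mulMk p K (Additive.ofMul u))
    (unitGroup K i : Set Kˣ) (fun u => f (red ((u - 1) / y))) fun u hu u' hu' h => by
      obtain ⟨t, ht⟩ := mulMk_eq_iff.1 h
      have h1 : t ^ p = ((u'⁻¹ * u : Kˣ) : K) := by
        rw [Units.val_mul, ht, Units.inv_mul_cancel_left]
      have h2 : t ^ p - 1 ∈ primePow K i := by
        rw [h1]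
        exact (mul_mem (inv_mem hu') hu).2
      obtain ⟨v, hv, hvt⟩ := exists_unitGroup_eq hi h2
      have huv : u = u' * v := Units.ext (by
        rw [Units.val_mul, ht, ← sub_add_cancel (v : K) 1, hvt, sub_add_cancel])
      have h3 := mul_sub_one_sub_mem hi hu' hv
      rw [← huv] at h3
      rw [(red_div_eq_iff hy hu.2 (add_mem hu'.2 hv.2)).2 h3, red_div_add hy hu'.2 hv.2, map_add, hvt,
        hpow t h2, add_zero]
  refine ⟨θ, hθ, ?_, ?_, ?_, ?_⟩
  · intro x hx x' hx'
    obtain ⟨u, hu, rfl⟩ := (mem_mulStep hi).1 hx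
    obtain ⟨u', hu', rfl⟩ := (mem_mulStep hi).1 hx'
    rw [← map_add, ← ofMul_mul, hθ _ (mul_mem hu hu'), hθ _ hu, hθ _ hu', ← map_add,
      ← red_div_add hy hu.2 hu'.2, (red_div_eq_iff hy (mul_mem hu hu').2 (add_mem hu.2 hu'.2)).2
        (mul_sub_one_sub_mem hi hu hu')]
  · intro x hx σ
    obtain ⟨u, hu, rfl⟩ := (mem_mulStep hi).1 hx
    have hσ : Units.map (σ : K →* K) u ∈ unitGroup K i := ringEquiv_mem_unitGroup (σ : K ≃+* K) hu
    have h1 : ((Units.map (σ : K →* K) u : Kˣ) : K) - 1 = σ (u - 1) := by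
      rw [map_sub, map_one]
      rfl
    rw [mulRep_mk, hθ _ hσ, hθ _ hu, h1, red_apply_div hy hχ σ hu.2, hact]
  · intro x hx
    obtain ⟨u, hu, rfl⟩ := (mem_mulStep hi).1 hx
    rw [hθ _ hu]
    refine ⟨hker u hu, fun h => ?_⟩
    obtain ⟨u', hu', h'⟩ := (mem_mulStep (by omega)).1 h
    have hu'i : u' ∈ unitGroup K i := ⟨hu'.1, primePow_anti (by omega) hu'.2⟩
    rw [← hθ _ hu]
    rw [← h', hθ _ hu'i, (red_div_eq_zero_iff hy hu'i.2).2 hu'.2, map_zero]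
  · intro w
    obtain ⟨r, rfl⟩ := hf w
    obtain ⟨z, hz, rfl⟩ := exists_red_div_eq hy r
    obtain ⟨u, hu, huz⟩ := exists_unitGroup_eq hi hz
    exact ⟨_, mulMk_mem_mulStep p F K hu, by rw [hθ _ hu, huz]⟩

variable {e : ℕ} {π : K}

/-- For `0 < i < pe` prime to `p`, no `p`-th power interferes with the graded piece of degree `i`. -/
theorem exists_gradedCoord_mul_of_not_dvd (hπ : π ^ (p - 1) = -(p : K))
    (hπv : normVal K π = exp (-(e : ℤ))) {i : ℤ} (hi : 0 < i) (hie : i < p * e)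
    (hp : ¬ (p : ℤ) ∣ i) {y : K} (hy : normVal K y = exp (-i)) {χ : Gal(K/F) →* (ZMod p)ˣ}
    (hχ : ∀ σ, σ y = teichmuller K p (χ σ) * y) :
    ∃ θ : MulMod p K → 𝓀[K],
      (∀ u ∈ unitGroup K i, θ (mulMk p K (Additive.ofMul u)) = red ((u - 1) / y)) ∧
      IsGradedCoord (mulRep p F K) (mulStep p F K i).toSubmodule (mulStep p F K (i + 1)).toSubmodule
        (fun σ w => unitsCast p 𝓀[K] (χ σ) * residueRep F K σ w) θ := by
  refine exists_gradedCoord_mul hi hy hχ (AddMonoidHom.id _) Function.surjective_id (fun _ _ => rfl)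
    (fun t ht => (red_div_eq_zero_iff hy ht).2 (pow_sub_one_mem_succ hπ hπv hi hie hp ht))
    fun u hu h => mulMk_mem_mulStep p F K ⟨hu.1, (red_div_eq_zero_iff hy hu.2).1 h⟩

theorem exists_pow_eq_of_red_div (hπ : π ^ (p - 1) = -(p : K)) (hπv : normVal K π = exp (-(e : ℤ)))
    {u : K} (hu : u - 1 ∈ primePow K (p * e)) {r : 𝓀[K]} (h : r ^ p - r = red ((u - 1) / π ^ p)) :
    ∃ t : K, t ^ p = u := by
  have hπp := normVal_pow hπv p
  obtain ⟨x, -, -, hx⟩ := exists_one_add_mul_pow_eq hπ hπv (div_mem_primePow_zero hπp hu) h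
  refine ⟨1 + π * x, ?_⟩
  rw [hx, mul_div_cancel₀ _ (ne_zero_of_normVal_eq hπp), add_sub_cancel]

/-- `U_n ⊆ Kˣᵖ` for `n > pe`. -/
theorem mulStep_eq_bot (hπ : π ^ (p - 1) = -(p : K)) (hπv : normVal K π = exp (-(e : ℤ)))
    {n : ℤ} (hn : p * e < n) : (mulStep p F K n).toSubmodule = ⊥ := by
  refine eq_bot_iff.2 fun x hx => ?_
  have h0 : (0 : ℤ) ≤ p * e := by positivity
  obtain ⟨u, hu, rfl⟩ := (mem_mulStep (by omega)).1 hx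
  have hu1 := primePow_anti hn.le hu.2
  obtain ⟨t, ht⟩ := exists_pow_eq_of_red_div hπ hπv hu1 (r := 0) (by
    rw [(red_div_eq_zero_iff (normVal_pow hπv p) hu1).2 (primePow_anti (by omega) hu.2),
      zero_pow (Fact.out : p.Prime).ne_zero, sub_zero])
  rw [Submodule.mem_bot, ← map_zero (mulMk p K)]
  exact mulMk_eq_iff.2 ⟨t, by rw [ht, Units.val_one, one_mul]⟩

/-- The coordinate on `Ū_{pe}` is the trace of the reduction of `(u - 1) / πᵖ`. The eigenvector `πᵖ` has
character `ωᵖ = ω`. -/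
theorem exists_gradedCoord_mul_bottom [CharP 𝓀[F] p] (hK : IsAdjoinRoots F K (p - 1))
    (hπ : π ^ (p - 1) = -(p : K)) (hπv : normVal K π = exp (-(e : ℤ))) :
    ∃ θ : MulMod p K → ZMod p, IsGradedCoord (mulRep p F K) (mulStep p F K (p * e)).toSubmodule
      (mulStep p F K (p * e + 1)).toSubmodule (fun σ w => (omega p F K σ : ZMod p) * w) θ := by
  have he : (0 : ℤ) < p * e := by
    have := pos_of_normVal_eq hπ hπv
    have := (Fact.out : p.Prime).pos
    positivity
  have hπp := normVal_pow hπv p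
  have hπ0 := ne_zero_of_normVal_eq hπv
  obtain ⟨tr, htr, hker, hinv, hsmul⟩ := exists_trace p 𝓀[K]
  have hχ : ∀ σ : Gal(K/F), σ (π ^ p) = teichmuller K p (omega p F K σ) * π ^ p := fun σ => by
    have h1 : teichmuller K p (omega p F K σ) ^ p = teichmuller K p (omega p F K σ) := by
      rw [← pow_sub_one_mul (Fact.out : p.Prime).ne_zero, teichmuller_pow, one_mul]
    rw [map_pow, apply_eq_teichmuller_omega_mul hK hπ hπv, mul_pow, h1]
  have hact : ∀ (σ : Gal(K/F)) (w : 𝓀[K]), tr (unitsCast p 𝓀[K] (omega p F K σ) *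
      residueRep F K σ w) = (omega p F K σ : ZMod p) * tr w := fun σ w => by
    rw [unitsCast_apply, hsmul]
    congr 1
    exact hinv (IsLocalRing.ResidueField.mapEquiv (integerEquiv (σ : K ≃+* K))) w
  have hpow : ∀ t : K, t ^ p - 1 ∈ primePow K (p * e) → tr (red ((t ^ p - 1) / π ^ p)) = 0 := by
    intro t ht
    have h1 := div_mem_primePow_zero hπv (sub_one_mem_of_pow_sub_one_mem hπ hπv ht)
    have h2 : t = 1 + π * ((t - 1) / π) := by
      rw [mul_div_cancel₀ _ hπ0, add_sub_cancel]
    rw [hker]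
    refine ⟨red ((t - 1) / π), ?_⟩
    rw [← red_one_add_mul_pow_sub_one_div hπ hπv h1, ← h2]
  obtain ⟨θ, -, hθ⟩ := exists_gradedCoord_mul he hπp hχ tr htr
    (act := fun σ w => (omega p F K σ : ZMod p) * w) hact hpow fun u hu h => by
      obtain ⟨r, hr⟩ := (hker _).1 h
      obtain ⟨t, ht⟩ := exists_pow_eq_of_red_div hπ hπv hu.2 hr
      rw [mulMk_eq_iff (u' := 1) |>.2 ⟨t, by rw [ht, Units.val_one, one_mul]⟩]
      exact zero_mem _
  exact ⟨θ, hθ⟩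

/-- In degrees divisible by `p` below `pe` the graded piece vanishes: an element `1 + cᵖ` is congruent
to the `p`-th power of `1 + c`. -/
theorem mulStep_le_of_dvd (hπ : π ^ (p - 1) = -(p : K)) (hπv : normVal K π = exp (-(e : ℤ))) {j : ℤ}
    (hj : 0 < j) (hje : j < e) :
    (mulStep p F K (p * j)).toSubmodule ≤ (mulStep p F K (p * j + 1)).toSubmodule := by
  intro x hx
  have hp : (2 : ℤ) ≤ p := by exact_mod_cast (Fact.out : p.Prime).two_le
  have hpj : 0 < p * j := by positivity
  obtain ⟨u, hu, rfl⟩ := (mem_mulStep hpj).1 hx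
  obtain ⟨c, hc, huc⟩ := exists_sub_pow_mem p hu.2
  obtain ⟨s, hs, hcs⟩ := exists_one_add_pow_eq (p := p) (primePow_anti hj.le hc)
  obtain ⟨v, hv, hvc⟩ := exists_unitGroup_eq hj hc
  have h1 : p * c * s ∈ primePow K (p * j + 1) := by
    refine primePow_anti ?_ (natCast_mul_mem_primePow hπ hπv hc hs)
    rw [cast_sub_one_mul]
    nlinarith
  have hvp : ((v : K)) ^ p = 1 + c ^ p + p * c * s := by
    rw [← hcs, ← hvc, add_sub_cancel]
  have h2 : (u : K) - v ^ p ∈ primePow K (p * j + 1) := by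
    rw [hvp]
    convert sub_mem huc h1 using 1
    ring
  have hv1 : normVal K ((v ^ p : Kˣ)⁻¹ : K) = 1 := by
    rw [map_inv₀, Units.val_pow_eq_pow_val, map_pow, hv.1, one_pow, inv_one]
  refine (mem_mulStep (by omega)).2 ⟨u * (v ^ p)⁻¹, ⟨?_, ?_⟩, ?_⟩
  · rw [Units.val_mul, map_mul, hu.1, one_mul, Units.val_inv_eq_inv_val]
    exact hv1
  · have h3 : ((u * (v ^ p)⁻¹ : Kˣ) : K) - 1 = ((u : K) - v ^ p) * ((v ^ p : Kˣ) : K)⁻¹ := by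
      have := v.ne_zero
      rw [Units.val_mul, Units.val_inv_eq_inv_val, Units.val_pow_eq_pow_val]
      field_simp
    rw [h3]
    simpa using mul_mem_primePow h2 (mem_primePow_of_normVal_eq_one hv1)
  · rw [mulMk_eq_iff]
    refine ⟨((v⁻¹ : Kˣ) : K), ?_⟩
    rw [Units.val_mul, ← inv_pow, Units.val_pow_eq_pow_val]

/-- The coordinate on the top piece `Kˣ/Ū_1` is, up to sign, the valuation modulo `p`. -/
theorem exists_gradedCoord_mul_top :
    ∃ θ : MulMod p K → ZMod p, IsGradedCoord (mulRep p F K) (mulStep p F K 0).toSubmodule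
      (mulStep p F K 1).toSubmodule (fun _ w => w) θ := by
  have hp := (Fact.out : p.Prime).ne_zero
  have hne : ∀ u : Kˣ, normVal K (u : K) ≠ 0 := fun u => by
    rw [ne_eq, map_eq_zero]
    exact u.ne_zero
  obtain ⟨θ, hθ⟩ := exists_factorization_on (fun u : Kˣ => mulMk p K (Additive.ofMul u)) Set.univ
    (fun u => ((log (normVal K (u : K)) : ℤ) : ZMod p)) fun u _ u' _ h => by
      obtain ⟨t, ht⟩ := mulMk_eq_iff.1 h
      have ht0 : t ≠ 0 := by
        rintro rfl
        rw [zero_pow hp, mul_zero] at ht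
        exact u.ne_zero ht
      rw [ht, map_mul, map_pow, log_mul (hne u') (pow_ne_zero _ (by simpa using ht0)), log_pow]
      simp
  replace hθ : ∀ u : Kˣ, θ (mulMk p K (Additive.ofMul u)) = ((log (normVal K (u : K)) : ℤ) : ZMod p) :=
    fun u => hθ u (Set.mem_univ u)
  have hsurj : ∀ x : MulMod p K, ∃ u : Kˣ, mulMk p K (Additive.ofMul u) = x := fun x => by
    obtain ⟨u, hu⟩ := mulMk_surjective p K x
    exact ⟨u.toMul, hu⟩
  refine ⟨θ, ?_, ?_, ?_, ?_⟩
  · intro x _ x' _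
    obtain ⟨u, rfl⟩ := hsurj x
    obtain ⟨u', rfl⟩ := hsurj x'
    rw [← map_add, ← ofMul_mul, hθ, hθ, hθ, Units.val_mul, map_mul, log_mul (hne u) (hne u'),
      Int.cast_add]
  · intro x _ σ
    obtain ⟨u, rfl⟩ := hsurj x
    rw [mulRep_mk, hθ, hθ]
    congr 2
    exact normVal_apply_gal σ (u : K)
  · intro x _
    obtain ⟨u, rfl⟩ := hsurj x
    rw [hθ, ZMod.intCast_zmod_eq_zero_iff_dvd]
    constructor
    · rintro ⟨j, hj⟩
      have hu : normVal K (u : K) = exp (-(p * -j)) := by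
        rw [mul_neg, neg_neg, ← hj, exp_log (hne u)]
      obtain ⟨c, hc, huc⟩ := exists_sub_pow_mem p (mem_primePow_of_normVal_eq hu)
      have hcp : normVal K (c ^ p) = exp (-(p * -j)) := by
        rw [← hu, show c ^ p = u - (u - c ^ p) by ring]
        refine Valuation.map_sub_eq_of_lt_left _ ?_
        rw [hu, normVal_lt_iff]
        exact huc
      have hcp0 := ne_zero_of_normVal_eq hcp
      have h1 := div_mem_primePow hcp huc
      rw [add_sub_cancel_left, sub_div, div_self hcp0] at h1
      obtain ⟨v, hv, hvc⟩ := exists_unitGroup_eq one_pos h1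
      refine (mem_mulStep one_pos).2 ⟨v, hv, Eq.symm (mulMk_eq_iff.2 ⟨c, ?_⟩)⟩
      rw [← div_eq_iff hcp0]
      linear_combination -hvc
    · intro h
      obtain ⟨v, hv, h'⟩ := (mem_mulStep one_pos).1 h
      rw [← ZMod.intCast_zmod_eq_zero_iff_dvd, ← hθ, ← h', hθ, hv.1, log_one, Int.cast_zero]
  · intro w
    obtain ⟨n, rfl⟩ := ZMod.intCast_surjective w
    obtain ⟨x, hx⟩ := normVal_surjective K (exp n)
    refine ⟨mulMk p K (Additive.ofMul (Units.mk0 x (ne_zero_of_normVal_eq hx))), ?_, ?_⟩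
    · rw [mulStep_eq_top le_rfl]
      trivial
    · rw [hθ, Units.val_mk0, hx, log_exp]

theorem isBoundedFil_mulFil (hπ : π ^ (p - 1) = -(p : K)) (hπv : normVal K π = exp (-(e : ℤ))) :
    IsBoundedFil (mulRep p F K) (mulFil p F K e) := by
  refine ⟨fun m n hmn => mulStep_anti (by omega), fun m σ x hx =>
    (mulStep p F K (p * e - m)).apply_mem_toSubmodule σ hx, fun m hm =>
    mulStep_eq_bot hπ hπv (by omega), fun x => ⟨p * e, ?_⟩⟩
  rw [mulFil, sub_self, mulStep_eq_top le_rfl]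
  trivial

end Units

/-! ### Characteristic zero -/

section CharZero

variable {p : ℕ} [Fact p.Prime]
variable {F : Type*} [Field F] [ValuativeRel F] [TopologicalSpace F] [IsNonarchimedeanLocalField F]
variable {K : Type*} [Field K] [ValuativeRel K] [TopologicalSpace K] [IsNonarchimedeanLocalField K]
variable [Algebra F K] [ValuativeExtension F K] [CharP 𝓀[K] p] [CharP 𝓀[F] p]
variable (hK : IsAdjoinRoots F K (p - 1)) {e : ℕ} {π : K}
include hK

theorem mulGradedIso (hπ : π ^ (p - 1) = -(p : K)) (hπv : normVal K π = exp (-(e : ℤ)))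
    {ξ : ℤ → (Gal(K/F) →* (ZMod p)ˣ)} (hξ : ∀ i : ℤ, charVal p F K (ξ i) = i)
    {i : ℤ} (hi : 0 < i) (hie : i < p * e) (hp : ¬ (p : ℤ) ∣ i) :
    MulGradedIso p F K i (twist p (residueRep F K) (ξ i)) := by
  obtain ⟨y, hy, hχ⟩ := exists_eigenvector_of_charVal hK (hξ i)
  obtain ⟨θ, hθ, hcoord⟩ := exists_gradedCoord_mul_of_not_dvd hπ hπv hi hie hp hy hχ
  obtain ⟨f, hf, hact⟩ := hcoord.exists_equiv
  obtain ⟨hmod, hsmul, ρ, hρ, hiso⟩ := exists_module_of_addEquiv f (twist p (residueRep F K) (ξ i))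
    (fun σ x => gradedRep (mulStep p F K i) (mulStep p F K (i + 1)) σ x) fun σ x => by
      rw [hact, twist_residueRep_apply]
  refine ⟨hmod, fun a u w hu hw huw => f.injective ?_, ρ, hρ, hiso⟩
  rw [hsmul, mulGradedMk, mulGradedMk, hf, hf, hθ u hu, hθ w hw, huw, red_algebraMap_mul_div hy a hu.2]

theorem filteredIso_mulRep (hπ : π ^ (p - 1) = -(p : K)) (hπv : normVal K π = exp (-(e : ℤ)))
    {ξ : ℤ → (Gal(K/F) →* (ZMod p)ˣ)} (hξ : ∀ i : ℤ, charVal p F K (ξ i) = i) :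
    FilteredIso (mulRep p F K) (mulFil p F K e) (mulModel p F K ξ e) (mulModelFil p F K e) := by
  have := finite_gal hK
  have hp0 : (0 : ℤ) < p := by exact_mod_cast (Fact.out : p.Prime).pos
  have he : (0 : ℤ) < e := by exact_mod_cast pos_of_normVal_eq hπ hπv
  have hpe : (0 : ℤ) < p * e := mul_pos hp0 he
  have hblock := isBoundedFil_directSum_block (p := p) (F := F) (K := K)
    (fun i : Fin e => (i : ℕ)) ξ
  refine filteredIso_of_graded (not_dvd_card_gal hK) (isBoundedFil_mulFil hπ hπv)
    ((isBoundedFil_levelFil _ le_rfl).prod (hblock.prod (isBoundedFil_levelFil _ hpe.le)))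
    fun m => ?_
  have hfil : ∀ n : ℤ, mulFil p F K e (n - 1) = (mulStep p F K (p * e - n + 1)).toSubmodule :=
    fun n => by rw [mulFil, sub_sub_eq_add_sub, add_sub_right_comm]
  have hle : ∀ n : ℤ, mulFil p F K e (n - 1) ≤ mulFil p F K e n := fun n => by
    rw [hfil]
    exact mulStep_anti (by omega)
  have hlevel : ∀ {s : ℤ} {z : ZMod p} {n : ℤ}, s ≤ n →
      z ∈ (levelFil s n : Submodule (ZMod p) (ZMod p)) :=
    fun hn => mem_levelFil.2 fun h => absurd h (not_lt.2 hn)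
  have hlevel0 : ∀ {s : ℤ} {z : ZMod p} {n : ℤ}, n < s →
      z ∈ (levelFil s n : Submodule (ZMod p) (ZMod p)) → z = 0 := fun hn h => mem_levelFil.1 h hn
  -- `p ∤ level < pe` for the summands of the blocks
  have hjump : ∀ n : ℤ, ((p : ℤ) ∣ n ∨ p * e ≤ n) →
      directSumFil (fun i : Fin e => blockFilFp p F K i) n ≤
        directSumFil (fun i : Fin e => blockFilFp p F K i) (n - 1) := by
    intro n hn
    refine directSumFil_le_sub_one (c := fun i : Fin e => (i : ℕ)) fun i j h => ?_
    rcases hn with hn | hn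
    · exact not_dvd_level (i : ℕ) j (h ▸ hn)
    · have h1 := level_lt (p := p) (i : ℕ) j
      have h2 : (p : ℤ) * ((i : ℕ) + 1) ≤ p * e := by
        have := i.2
        gcongr
        omega
      omega
  have hmono : ∀ n : ℤ, directSumFil (fun i : Fin e => blockFilFp p F K i) (n - 1) ≤
      directSumFil (fun i : Fin e => blockFilFp p F K i) n := fun n => hblock.mono (by omega)
  have hline : ∀ (χ : Gal(K/F) →* (ZMod p)ˣ) σ, 0 = lineRep p χ σ 0 := fun χ σ => (map_zero _).symm
  rcases Nat.eq_zero_or_pos m with rfl | hm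
  -- level `0`: the line `𝔽_p{ω}`
  · obtain ⟨θ, hθ⟩ := exists_gradedCoord_mul_bottom hK hπ hπv
    refine hasGradedLift_of_summand (hle _) (act := fun σ w => (omega p F K σ : ZMod p) * w)
      (AddMonoidHom.inl (ZMod p) ((⨁ _ : Fin e, Block p F K) × ZMod p)) (AddMonoidHom.fst _ _)
      (fun w => rfl) (fun σ w => Prod.ext (lineRep_apply _ σ w).symm (Prod.ext ?_ (hline 1 σ)))
      (fun w => ⟨hlevel (by simp), zero_mem _⟩) (fun z => ?_) (θ := θ) ?_
    · exact (map_zero (Representation.directSum (fun i : Fin e => blockRepFp p F K ξ i) σ)).symm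
    · constructor
      · rintro ⟨h1, h2, h3⟩
        exact ⟨⟨hlevel (by simp), hmono _ h2, mem_levelFil.2 fun _ => hlevel0 (by omega) h3⟩,
          hlevel0 (by omega) h1⟩
      · rintro ⟨⟨-, h2, h3⟩, h1⟩
        exact ⟨mem_levelFil.2 fun _ => h1, hjump _ (Or.inl (by simp)) h2,
          mem_levelFil.2 fun _ => hlevel0 (by omega) h3⟩
    · rw [hfil, mulFil, Nat.cast_zero, sub_zero]
      exact hθ
  have hm' : (0 : ℤ) < m := by exact_mod_cast hm
  rcases lt_trichotomy (m : ℤ) (p * e) with hmpe | hmpe | hmpe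
  -- levels between `0` and `pe`: nothing if `p` divides the level, a summand of a block otherwise
  · by_cases hp : (p : ℤ) ∣ m
    · obtain ⟨j, hj⟩ := hp
      have hj0 : 0 < j := pos_of_mul_pos_right (hj ▸ hm') hp0.le
      have hje : j < e := lt_of_mul_lt_mul_left (hj ▸ hmpe) hp0.le
      refine hasGradedLift_of_eq ?_ fun z hz => ⟨hlevel (by omega), hjump _ (Or.inl ⟨j, hj⟩) hz.2.1,
        mem_levelFil.2 fun _ => hlevel0 hmpe hz.2.2⟩
      rw [hfil, mulFil, hj, ← mul_sub]
      exact mulStep_le_of_dvd hπ hπv (by omega) (by omega)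
    · obtain ⟨i, j, hij⟩ := exists_level_eq (p := p) (m := m) hm' hp
      have hie : i < e := by
        by_contra! hei
        have h1 : (p : ℤ) * e ≤ p * i := by gcongr
        simp only [level] at hij
        omega
      -- the `i`-th block is twisted by `ω`, of valuation `e`, and `e - m ≡ pe - m` modulo `p - 1`
      have hval : charVal p F K (ξ (-level p i j) * omega p F K) =
          ((p * e - m : ℤ) : ZMod (p - 1)) := by
        rw [charVal_mul hK, charVal_omega hK hπ hπv, hξ, hij, Int.cast_sub, Int.cast_mul, intCast_prime_eq_one,
          Int.cast_neg, one_mul, neg_add_eq_sub]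
      obtain ⟨y, hy, hχ⟩ := exists_eigenvector_of_charVal hK hval
      obtain ⟨θ, -, hθ⟩ := exists_gradedCoord_mul_of_not_dvd (F := F) hπ hπv (i := p * e - m)
        (by omega) (by omega) (fun h => hp ((dvd_sub_right (dvd_mul_right _ _)).1 h)) hy hχ
      refine hasGradedLift_of_summand (hle _)
        ((AddMonoidHom.inr (ZMod p) ((⨁ _ : Fin e, Block p F K) × ZMod p)).comp
          ((AddMonoidHom.inl (⨁ _ : Fin e, Block p F K) (ZMod p)).comp
            (blockIncl p F K (⟨i, hie⟩ : Fin e) j)))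
        ((blockProj p F K (⟨i, hie⟩ : Fin e) j).comp
          ((AddMonoidHom.fst _ (ZMod p)).comp (AddMonoidHom.snd (ZMod p) _)))
        (fun w => ?_) (fun σ w => Prod.ext (hline _ σ) (Prod.ext ?_ (hline 1 σ)))
        (fun w => ⟨zero_mem _, ?_, zero_mem _⟩) (fun z => ?_) (θ := θ)
        (by rw [hfil, mulFil]; exact hθ)
      · exact blockIncl_apply_self (⟨i, hie⟩ : Fin e) j w
      · exact blockIncl_act (fun i : Fin e => (i : ℕ)) ξ σ ⟨i, hie⟩ j w
      · rw [← hij]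
        exact blockIncl_mem (fun i : Fin e => (i : ℕ)) ⟨i, hie⟩ j w
      · have h := mem_directSumFil_sub_one_iff (F := F) (c := fun i : Fin e => (i : ℕ))
          Fin.val_injective ⟨i, hie⟩ j z.2.1
        simp only [hij] at h
        constructor
        · rintro ⟨-, h2, h3⟩
          exact ⟨⟨hlevel (by omega), (h.1 h2).1, mem_levelFil.2 fun _ => hlevel0 (by omega) h3⟩,
            (h.1 h2).2⟩
        · rintro ⟨⟨-, h2, h3⟩, h1⟩
          exact ⟨hlevel (by omega), h.2 ⟨h2, h1⟩, mem_levelFil.2 fun _ => hlevel0 (by omega) h3⟩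
  -- level `pe`: the line `𝔽_p` with trivial action
  · obtain ⟨θ, hθ⟩ := exists_gradedCoord_mul_top (p := p) (F := F) (K := K)
    refine hasGradedLift_of_summand (hle _) (act := fun _ w => w)
      ((AddMonoidHom.inr (ZMod p) ((⨁ _ : Fin e, Block p F K) × ZMod p)).comp
        (AddMonoidHom.inr (⨁ _ : Fin e, Block p F K) (ZMod p)))
      ((AddMonoidHom.snd _ (ZMod p)).comp (AddMonoidHom.snd (ZMod p) _)) (fun w => rfl)
      (fun σ w => Prod.ext (hline _ σ) (Prod.ext ?_ ?_))
      (fun w => ⟨zero_mem _, zero_mem _, hlevel hmpe.ge⟩) (fun z => ?_) (θ := θ) ?_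
    · exact (map_zero (Representation.directSum (fun i : Fin e => blockRepFp p F K ξ i) σ)).symm
    · change w = lineRep p 1 σ w
      rw [lineRep_apply, MonoidHom.one_apply, Units.val_one, one_mul]
    · constructor
      · rintro ⟨-, h2, h3⟩
        exact ⟨⟨hlevel (by omega), hmono _ h2, hlevel hmpe.ge⟩, hlevel0 (by omega) h3⟩
      · rintro ⟨⟨-, h2, -⟩, h1⟩
        exact ⟨hlevel (by omega), hjump _ (Or.inr hmpe.ge) h2, mem_levelFil.2 fun _ => h1⟩
    · rw [hfil, mulFil, hmpe, sub_self, zero_add]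
      exact hθ
  · refine hasGradedLift_of_eq ?_ fun z hz => ⟨hlevel (by omega), hjump _ (Or.inr hmpe.le) hz.2.1,
      hlevel (by omega)⟩
    rw [hfil, mulStep_eq_top (by omega)]
    exact le_top

end CharZero

end FilteredGalois

theorem proposition35 (p : ℕ) [Fact p.Prime]
    (F : Type*) [Field F] [ValuativeRel F] [TopologicalSpace F] [IsNonarchimedeanLocalField F]
    [CharP 𝓀[F] p]
    (K : Type*) [Field K] [ValuativeRel K] [TopologicalSpace K] [IsNonarchimedeanLocalField K]
    [Algebra F K] [ValuativeExtension F K] (hK : IsAdjoinRoots F K (p - 1)) :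
    -- characters of `G` and their valuations
    (∀ χ : Gal(K/F) →* (ZMod p)ˣ, ∃ a : F, IsKummerCharacter p F K χ a) ∧
    (∀ (χ : Gal(K/F) →* (ZMod p)ˣ) (a : F) (n : ℤ), IsKummerCharacter p F K χ a →
      normVal F a = exp (-n) → charVal p F K χ = n) ∧
    (∀ i : ZMod (p - 1), ∃ χ : Gal(K/F) →* (ZMod p)ˣ, charVal p F K χ = i) ∧
    -- let `l[i] = l{ξ i}`, where `ξ i` is any character of valuation `i`
    ∀ ξ : ℤ → (Gal(K/F) →* (ZMod p)ˣ), (∀ i : ℤ, charVal p F K (ξ i) = i) →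
      -- eigenspaces of `l[i]`
      (∀ (i : ℤ) (χ : Gal(K/F) →* (ZMod p)ˣ),
        (charVal p F K χ = i →
          Module.finrank 𝓀[F] (eigenspace p (twist p (residueRep F K) (ξ i)) χ) = 1) ∧
        (charVal p F K χ ≠ i → eigenspace p (twist p (residueRep F K) (ξ i)) χ = ⊥)) ∧
      -- each `V_{i+1}` is free of rank one over `k[G]`
      (∀ i : ℕ, Nonempty ((blockRep p F K ξ i).asModule ≃ₗ[MonoidAlgebra 𝓀[F] Gal(K/F)]
        MonoidAlgebra 𝓀[F] Gal(K/F))) ∧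
      -- characteristic zero
      (∀ [CharZero F] (e : ℕ), normVal F (p : F) = exp (-(e : ℤ)) →
        (∀ i : ℤ, 0 < i → i < p * e → IsCoprime i (p : ℤ) →
          MulGradedIso p F K i (twist p (residueRep F K) (ξ i))) ∧
        FilteredIso (mulRep p F K) (mulFil p F K e) (mulModel p F K ξ e) (mulModelFil p F K e)) ∧
      -- characteristic `p`
      (∀ [CharP F p] [CharP K p],
        (∀ i : ℤ, i < 0 → IsCoprime i (p : ℤ) →
          AddGradedIso p F K i (twist p (residueRep F K) (ξ i))) ∧
        FilteredIso (addRep p F K) (addFil p F K) (addModel p F K ξ) (addModelFil p F K)) := by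
  have := charP_residueField p F K
  refine ⟨exists_isKummerCharacter hK, fun χ a n h ha => charVal_of_isKummerCharacter hK h ha,
    charVal_surjective hK, fun ξ hξ => ⟨fun i χ => ⟨fun h => ?_, fun h => ?_⟩,
    nonempty_blockRep_asModule_equiv hK hξ, ?_, ?_⟩⟩
  · exact finrank_eigenspace_twist hK (by rw [h, hξ])
  · exact eigenspace_twist_eq_bot hK (by rwa [hξ])
  · intro _ e he
    obtain ⟨π, hπ, hπv⟩ := exists_pow_eq_neg_natCast hK he
    refine ⟨fun i hi hie hip => mulGradedIso hK hπ hπv hξ hi hie fun h => ?_,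
      filteredIso_mulRep hK hπ hπv hξ⟩
    exact (Nat.prime_iff_prime_int.1 (Fact.out : p.Prime)).not_isUnit (hip.isUnit_of_dvd' h dvd_rfl)
  · intro _ _
    refine ⟨fun i hi hip => addGradedIso hK hξ hi fun h => ?_, filteredIso_addRep hK hξ⟩
    exact (Nat.prime_iff_prime_int.1 (Fact.out : p.Prime)).not_isUnit (hip.isUnit_of_dvd' h dvd_rfl)
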